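/- Conventions. A PPT algorithm is a probabilistic polynomial-time algorithm with output in $\{0,1\}^*$; all probabilities are also over its coins. $U(\Pi,1^s)$ is the output of the single-tape Turing machine $M$ on input $w$, where the bit string $\Pi$ describes the pair $(M,w)$, when $M(w)$ is emulated by a fixed universal machine $U$ for $s$ steps of $M$ (no output if $\Pi$ describes no pair or $M(w)$ has not halted). For $t:\mathbb N\to\mathbb N$, $K^t(x)=\min\{|\Pi| : U(\Pi,1^{t(|x|)})=x\}$. For a function $F$ on bit strings and $\alpha:\mathbb N\to\mathbb R$, $F$ is $\alpha$-hard-on-average if for every PPT algorithm $H$, for all sufficiently large $n$, $\Pr[x\leftarrow\{0,1\}^n : H(x)=F(x)]<1-\alpha(n)$. A polynomial-time computable $f:\{0,1\}^*\to\{0,1\}^*$ is a one-way function if for every PPT algorithm $A$ there is a negligible $\mu$ with $\Pr[x\leftarrow\{0,1\}^n : A(1^n,f(x))\in f^{-1}(f(x))]\le\mu(n)$ for all $n\in\mathbb N$; it is a weak one-way function if there is a positive polynomial $q$ such that for every PPT algorithm $A$ this probability is less than $1-\frac1{q(n)}$ for all sufficiently large $n$. Theorem. Let $t$ and $p$ be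 polynomials with $t(n)>0$, $p(n)>0$ for all $n\ge1$, where $t$ takes integer values at the integers $n\ge1$, and suppose that $K^t$ (with values written in binary) is $\frac1{p(\cdot)}$-hard-on-average. Then: 1. Let $c$ be any constant with $K^t(x)\le|x|+c$ for all $x\in\{0,1\}^*$ (such a $c$ exists), and put $k(n)=\lceil\log_2(n+c)\rceil$ and $m(n)=k(n)+n+c$. For $\ell\|\Pi'\in\{0,1\}^{m(n)}$ with $|\ell|=k(n)$ and $|\Pi'|=n+c$, let $f_n(\ell\|\Pi')=\ell\,\|\,U(\Pi,1^{t(n)})$, where $\ell$ is read as a number in $\{1,\dots,2^{k(n)}\}$, $\Pi$ is the $\ell$-bit prefix of $\Pi'$ (all of $\Pi'$ if $\ell>|\Pi'|$), and a missing output of $U$ is read as the empty string. Then $f_n(x)$ can be computed from $1^n$ and $x$ in polynomial time, and the family $f_n:\{0,1\}^{m(n)}\to\{0,1\}^*$ is weakly one-way: there is a positive polynomial $s$ such that for every PPT algorithm $A$, for all sufficiently large $n$, $$\Pr\left[x\leftarrow\{0,1\}^{m(n)} : A(1^{m(n)},f_n(x))=x'\text{ with } x'\in\{0,1\}^{m(n)},\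 f_n(x')=f_n(x)\right]<1-\frac1{s(n)}.$$ 2. There exists a weak one-way function $f:\{0,1\}^*\to\{0,1\}^*$. 3. There exists a one-way function $f:\{0,1\}^*\to\{0,1\}^*$. -/

import Mathlib

namespace KOWF

/-! ## Single-tape Turing machines and their descriptions -/

/-- One transition of a single-tape Turing machine: in state `q`, reading `a`, write `b`,
move in direction `dir` (`0` is left, `1` is right, anything else is stay), enter state `q'`. -/
structure Rule where
  q : ℕ
  a : ℕ
  q' : ℕ
  b : ℕ
  dir : ℕ

/-- A single-tape Turing machine is a finite transition table, whose first applicable entry is used.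
States are natural numbers with start state `0`; tape symbols are natural numbers, where `0` is the
blank, `1` and `2` are the bits `0` and `1`, and the others are work symbols. The machine halts
when no entry applies. -/
abbrev Machine := List Rule

/-- Configuration with a two-way infinite tape: `left` (nearest cell first), the scanned cell
`head`, and `right`; all cells not listed are blank. -/
structure Cfg where
  state : ℕ
  left : List ℕ
  head : ℕ
  right : List ℕ

def bitSymbol (b : Bool) : ℕ := if b then 2 else 1

/-- The input is written on the tape with the head on its first symbol. -/
def Cfg.init (w : List Bool) : Cfg :=
  ⟨0, [], (w.map bitSymbol).headD 0, (w.map bitSymbol).tail⟩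

/-- The output is the maximal block of bits that starts at the head. -/
def Cfg.output (c : Cfg) : List Bool :=
  ((c.head :: c.right).takeWhile fun s => s = 1 ∨ s = 2).map fun s => decide (s = 2)

/-- Writing a symbol, moving, and changing the state. -/
def Cfg.apply (c : Cfg) (r : Rule) : Cfg :=
  if r.dir = 0 then ⟨r.q', c.left.tail, c.left.headD 0, r.b :: c.right⟩
  else if r.dir = 1 then ⟨r.q', r.b :: c.left, c.right.headD 0, c.right.tail⟩
  else ⟨r.q', c.left, r.b, c.right⟩

/-- One step; `none` if the machine has halted. -/
def step (M : Machine) (c : Cfg) : Option Cfg :=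
  (M.find? fun r => r.q = c.state ∧ r.a = c.head).map c.apply

/-- `some` of the output of `M(w)` if `M` halts on `w` within `t` steps, otherwise `none`. -/
def runFor (M : Machine) (w : List Bool) (t : ℕ) : Option (List Bool) :=
  let c := (fun c => (step M c).getD c)^[t] (Cfg.init w)
  if (step M c).isNone then some c.output else none

/-- The unary self-delimiting code `1ᵏ0` of a natural number. -/
def unary (k : ℕ) : List Bool := List.replicate k true ++ [false]

def readUnary : List Bool → Option (ℕ × List Bool)
  | [] => none
  | false :: l => some (0, l)
  | true :: l => (readUnary l).map fun p => (p.1 + 1, p.2)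

def encodeRule (r : Rule) : List Bool :=
  unary r.q ++ unary r.a ++ unary r.q' ++ unary r.b ++ unary r.dir

def readRule (l : List Bool) : Option (Rule × List Bool) := do
  let (q, l) ← readUnary l
  let (a, l) ← readUnary l
  let (q', l) ← readUnary l
  let (b, l) ← readUnary l
  let (d, l) ← readUnary l
  return (⟨q, a, q', b, d⟩, l)

def readRules : ℕ → List Bool → Option (Machine × List Bool)
  | 0, l => some ([], l)
  | k + 1, l => do
    let (r, l) ← readRule l
    let (M, l) ← readRules k l
    return (r :: M, l)

/-- The description of the pair `(M, w)`: the number of entries of the table of `M`, the entries,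
and then `w` verbatim. -/
def encodeDesc (M : Machine) (w : List Bool) : List Bool :=
  unary M.length ++ M.flatMap encodeRule ++ w

/-- The pair `(M, w)` that a bit string describes, if any. -/
def decodeDesc (l : List Bool) : Option (Machine × List Bool) :=
  (readUnary l).bind fun p => readRules p.1 p.2

theorem readUnary_unary (k : ℕ) (l : List Bool) : readUnary (unary k ++ l) = some (k, l) := by
  induction k with
  | zero => rfl
  | succ k ih =>
    have h : unary (k + 1) ++ l = true :: (unary k ++ l) := rfl
    rw [h, readUnary, ih]
    rfl

theorem readRule_encodeRule (r : Rule) (l : List Bool) :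
    readRule (encodeRule r ++ l) = some (r, l) := by
  simp [readRule, encodeRule, readUnary_unary, List.append_assoc]

theorem readRules_flatMap (M : Machine) (l : List Bool) :
    readRules M.length (M.flatMap encodeRule ++ l) = some (M, l) := by
  induction M with
  | nil => rfl
  | cons r M ih => simp [readRules, readRule_encodeRule, List.append_assoc, ih]

/-- Every pair of a machine and an input has a description. -/
theorem decodeDesc_encodeDesc (M : Machine) (w : List Bool) :
    decodeDesc (encodeDesc M w) = some (M, w) := by
  simp [decodeDesc, encodeDesc, readUnary_unary, List.append_assoc, readRules_flatMap]

/-- The universal machine: `U D t` is the output of `M(w)` run for `t` steps, where `D` describes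
`(M, w)`; it is `none` if `D` describes no pair or if `M(w)` does not halt within `t` steps. -/
def U (D : List Bool) (t : ℕ) : Option (List Bool) :=
  (decodeDesc D).bind fun p => runFor p.1 p.2 t

/-- `t`-time-bounded Kolmogorov complexity. -/
noncomputable def Kt (t : ℕ → ℕ) (x : List Bool) : ℕ :=
  sInf {k | ∃ D : List Bool, D.length = k ∧ U D (t x.length) = some x}

/-- The machine with empty table outputs its input. -/
theorem U_false_cons (x : List Bool) (t : ℕ) : U (false :: x) t = some x := by
  have hstep : ∀ c, step [] c = none := fun c => rfl
  have hit : (fun c => (step [] c).getD c)^[t] (Cfg.init x) = Cfg.init x := by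
    have : (fun c => (step [] c).getD c) = id := by funext c; simp [hstep]
    rw [this, Function.iterate_id]; rfl
  have hout : (Cfg.init x).output = x := by
    cases x with
    | nil => rfl
    | cons b x =>
      have h : ∀ s ∈ (b :: x).map bitSymbol, decide (s = 1 ∨ s = 2) = true := by
        intro s hs
        obtain ⟨b, -, rfl⟩ := List.mem_map.1 hs
        cases b <;> rfl
      have e : (Cfg.init (b :: x)).output =
          (((b :: x).map bitSymbol).takeWhile fun s => s = 1 ∨ s = 2).map
            fun s => decide (s = 2) := rfl
      rw [e, List.takeWhile_eq_self_iff.2 h, List.map_map]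
      have : ((fun s => decide (s = 2)) ∘ bitSymbol) = id := by funext b; cases b <;> rfl
      rw [this, List.map_id]
  have e : U (false :: x) t =
      if (step [] ((fun c => (step [] c).getD c)^[t] (Cfg.init x))).isNone then
        some ((fun c => (step [] c).getD c)^[t] (Cfg.init x)).output else none := rfl
  rw [e, hit, hout]
  rfl

/-- The set whose minimum is `Kt t x` is never empty, and `Kt t x ≤ |x| + 1`. -/
theorem Kt_le (t : ℕ → ℕ) (x : List Bool) : Kt t x ≤ x.length + 1 :=
  Nat.sInf_le ⟨false :: x, rfl, U_false_cons x _⟩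

/-! ## Polynomial-time and probabilistic polynomial-time algorithms -/

/-- `f : {0,1}* → {0,1}*` is computable in polynomial time. -/
def PolyTime (f : List Bool → List Bool) : Prop :=
  Nonempty (Turing.TM2ComputableInPolyTime (id : List Bool → List Bool)
    (id : List Bool → List Bool) f)

/-- An input together with a random tape, as one word in which the two parts are marked. -/
def withTape (p : List Bool × List Bool) : List (Bool ⊕ Bool) :=
  p.1.map Sum.inl ++ p.2.map Sum.inr

/-- A probabilistic polynomial-time algorithm: a polynomial-time machine that is given, besides its
input `x`, a tape with `coins(|x|)` random bits, for a polynomial `coins`. -/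
structure PPT where
  coins : Polynomial ℕ
  run : List Bool × List Bool → List Bool
  polyTime : Nonempty (Turing.TM2ComputableInPolyTime withTape (id : List Bool → List Bool) run)

/-- The average of `g` over the uniform distribution on `{0,1}ⁿ`. -/
noncomputable def avg (n : ℕ) (g : List Bool → ℝ) : ℝ :=
  (∑ x : Fin n → Bool, g (List.ofFn x)) / 2 ^ n

open Classical in
/-- The probability, over the random tape, that `A(x) ∈ S`. -/
noncomputable def PPT.prob (A : PPT) (x : List Bool) (S : Set (List Bool)) : ℝ :=
  avg (A.coins.eval x.length) fun r => if A.run (x, r) ∈ S then 1 else 0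

/-- `f` is `α`-hard-on-average. -/
def IsHardOnAverage (α : ℕ → ℝ) (f : List Bool → List Bool) : Prop :=
  ∀ H : PPT, ∀ᶠ n in Filter.atTop, avg n (fun x => H.prob x {f x}) < 1 - α n

/-! ## One-way functions -/

/-- The pair `(1ⁿ, y)` as a bit string. -/
def withSecurity (n : ℕ) (y : List Bool) : List Bool := unary n ++ y

/-- `Pr[x ← {0,1}ⁿ; y = f(x) : A(1ⁿ, y) ∈ f⁻¹(f(x))]`. -/
noncomputable def invProb (f : List Bool → List Bool) (A : PPT) (n : ℕ) : ℝ :=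
  avg n fun x => A.prob (withSecurity n (f x)) (f ⁻¹' {f x})

/-- `f` is a one-way function. -/
def IsOWF (f : List Bool → List Bool) : Prop :=
  PolyTime f ∧ ∀ A : PPT, ∃ μ : ℕ → ℝ,
    Asymptotics.SuperpolynomialDecay Filter.atTop (fun n : ℕ => (n : ℝ)) μ ∧
    ∀ n, invProb f A n ≤ μ n

/-- `f` is a weak one-way function: for some positive polynomial `s`, it is a `1/s`-weak one. -/
def IsWeakOWF (f : List Bool → List Bool) : Prop :=
  PolyTime f ∧ ∃ s : Polynomial ℕ, (∀ n, 0 < s.eval n) ∧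
    ∀ A : PPT, ∀ᶠ n in Filter.atTop, invProb f A n < 1 - 1 / ((s.eval n : ℕ) : ℝ)

/-- Weak one-wayness of a family of functions `f n : {0,1}^(m n) → {0,1}*`: it is uniformly
computable in polynomial time, and for some positive polynomial `s` every PPT algorithm, given
`1^(m n)` and `f n x` for uniform `x`, finds a preimage in the domain of `f n` with probability
less than `1 - 1/s(n)` for all sufficiently large `n`. -/
def IsWeakOWFFamily (m : ℕ → ℕ) (f : ℕ → List Bool → List Bool) : Prop :=
  (∃ g : List Bool → List Bool, PolyTime g ∧ ∀ n x, x.length = m n → g (unary n ++ x) = f n x) ∧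
  ∃ s : Polynomial ℕ, (∀ n, 0 < s.eval n) ∧
    ∀ A : PPT, ∀ᶠ n in Filter.atTop,
      avg (m n) (fun x => A.prob (withSecurity (m n) (f n x))
        {x' | x'.length = m n ∧ f n x' = f n x}) < 1 - 1 / ((s.eval n : ℕ) : ℝ)

/-! ## The candidate weak one-way function -/

/-- Length `⌈log₂(n+c)⌉ + n + c` of the inputs `ℓ || Π'`. -/
def ktLength (c n : ℕ) : ℕ := Nat.clog 2 (n + c) + (n + c)

/-- The number in `{1, …, 2ᵏ}` that a string of `k` bits (least significant first) stands for. -/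
def indexOf (l : List Bool) : ℕ := Nat.ofDigits 2 (l.map Bool.toNat) + 1

/-- `ℓ || Π' ↦ ℓ || U(Π, 1^(t(n)))`, where `Π` is the `ℓ`-bit prefix of `Π'`, and the output of
`U` is read as the empty string when there is none. -/
def ktFun (t : ℕ → ℕ) (c n : ℕ) (x : List Bool) : List Bool :=
  let k := Nat.clog 2 (n + c)
  let l := x.take k
  let D := (x.drop k).take (indexOf l)
  l ++ (U D (t n)).getD []

end KOWF

open KOWF

/-!
Prefixing a description `Π` of `x` by its length `ℓ` turns an inverter of `f_n` into an algorithm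
for `K^t`: on input `x`, run the inverter on `ℓ‖x` for every `ℓ ≤ n + c`, and return the least `ℓ`
for which it finds a preimage. It can only err if the inverter fails at the true value
`ℓ = K^t(x)`, and the image `K^t(x)‖x` has probability at least `2^-(k(n) + n + c)`. Since `2^k(n)`
is at most linear in `n`, failing at a `1 / p(n)` fraction of the `x` costs the inverter an inverse
polynomial amount of success, so `f_n` is weakly one-way.

The input lengths `m(n)` have bounded gaps, so truncating the input to the largest available length
gives a single weak one-way function. For a strong one, take the direct product of many independent
copies (Yao): if `B` inverts the product too often, then, for all but a small fraction of the `x`,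
planting `f(x)` at some position and drawing the remaining blocks at random lets `B` succeed with
noticeable probability, and repetition then inverts `f` too often.

Polynomial time is that of multi-stack machines computing on bit strings. Values of all types
are encoded by binary trees, written as balanced bit strings that a pushdown transducer can process;
closure of polynomial time under composition, pairing and bounded iteration then yields the
algorithms above, and the universal machine, as functional programs.
-/

namespace KOWF

open Function

section StackMachine

open Turing Turing.TM2

/-! ### Runs of stack machines -/

section ReachesIn

variable {K : Type*} [DecidableEq K] {Γ : K → Type*} {Λ σ : Type*}

/-- `ReachesIn m n c c'`: the machine `m` goes from the configuration `c` to `c'` in at most `n`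
steps. -/
inductive ReachesIn (m : Λ → Stmt Γ Λ σ) : ℕ → TM2.Cfg Γ Λ σ → TM2.Cfg Γ Λ σ → Prop
  | refl (n : ℕ) (c : TM2.Cfg Γ Λ σ) : ReachesIn m n c c
  | step {n : ℕ} {l : Λ} {v : σ} {S : ∀ k, List (Γ k)} {c : TM2.Cfg Γ Λ σ} :
      ReachesIn m n (stepAux (m l) v S) c → ReachesIn m (n + 1) ⟨some l, v, S⟩ c

variable {m : Λ → Stmt Γ Λ σ} {n n' : ℕ} {c₁ c₂ c₃ : TM2.Cfg Γ Λ σ}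

theorem ReachesIn.trans (h : ReachesIn m n c₁ c₂) (h' : ReachesIn m n' c₂ c₃) :
    ReachesIn m (n + n') c₁ c₃ := by
  induction h with
  | refl n c =>
    induction h' with
    | refl n' c => exact .refl _ c
    | step _ ih => exact .step ih
  | step _ ih => exact Nat.add_right_comm .. ▸ .step (ih h')

theorem ReachesIn.mono (h : ReachesIn m n c₁ c₂) (hn : n ≤ n') : ReachesIn m n' c₁ c₂ := by
  obtain ⟨d, rfl⟩ := Nat.exists_eq_add_of_le hn
  exact h.trans (.refl d c₂)

theorem reachesIn_of_iterate_eq_some (h : (flip bind (TM2.step m))^[n] (some c₁) = some c₂) :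
    ReachesIn m n c₁ c₂ := by
  induction n generalizing c₁ with
  | zero => exact Option.some_injective _ h ▸ .refl 0 c₁
  | succ n ih =>
    rw [iterate_succ_apply] at h
    obtain ⟨_ | l, v, S⟩ := c₁
    · have hnone : (flip bind (TM2.step m))^[n] none = none := iterate_fixed rfl n
      exact absurd (hnone.symm.trans h) (by simp)
    · exact .step (ih h)

theorem ReachesIn.exists_iterate_eq_some (h : ReachesIn m n c₁ c₂) :
    ∃ i ≤ n, (flip bind (TM2.step m))^[i] (some c₁) = some c₂ := by
  induction h with
  | refl n c => exact ⟨0, n.zero_le, rfl⟩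
  | step _ ih =>
    obtain ⟨i, hi, h⟩ := ih
    exact ⟨i + 1, Nat.succ_le_succ hi, h⟩

/-- The number of `push` instructions in a statement; it bounds the growth of the stacks in one
step of a machine. -/
def pushes : Stmt Γ Λ σ → ℕ
  | .push _ _ q => pushes q + 1
  | .peek _ _ q => pushes q
  | .pop _ _ q => pushes q
  | .load _ q => pushes q
  | .branch _ q₁ q₂ => pushes q₁ + pushes q₂
  | .goto _ => 0
  | .halt => 0

theorem length_stepAux_le (q : Stmt Γ Λ σ) (v : σ) (S : ∀ k, List (Γ k)) (k : K) :
    ((stepAux q v S).stk k).length ≤ (S k).length + pushes q := by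
  induction q generalizing v S with
  | push k' f q ih =>
    refine (ih _ _).trans ?_
    obtain rfl | h := eq_or_ne k k'
    · simp only [update_self, List.length_cons, pushes]
      omega
    · simp only [update_of_ne h, pushes]
      omega
  | peek k' f _ ih => exact ih _ _
  | pop k' f q ih =>
    refine (ih _ _).trans (Nat.add_le_add_right ?_ _)
    obtain rfl | h := eq_or_ne k k'
    · simp
    · rw [update_of_ne h]
  | load f _ ih => exact ih _ _
  | branch f q₁ q₂ ih₁ ih₂ =>
    simp only [stepAux, pushes]
    cases f v
    · exact (ih₂ _ _).trans (by omega)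
    · exact (ih₁ _ _).trans (by omega)
  | goto f => simp [stepAux]
  | halt => simp [stepAux]

theorem ReachesIn.length_le {p : ℕ} (hp : ∀ l, pushes (m l) ≤ p) (h : ReachesIn m n c₁ c₂)
    (k : K) : (c₂.stk k).length ≤ (c₁.stk k).length + p * n := by
  induction h with
  | refl => exact Nat.le_add_right _ _
  | @step n l v S c _ ih =>
    have hstep := length_stepAux_le (m l) v S k
    have hl := hp l
    rw [Nat.mul_succ]
    dsimp only
    omega

end ReachesIn

/-! ### Machines as subroutines -/

/-- A variable of type `τ` inside the internal state `σ` of a machine. -/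
structure Lens (σ τ : Type*) where
  get : σ → τ
  put : σ → τ → σ
  get_put : ∀ s x, get (put s x) = x
  put_put : ∀ s x y, put (put s x) y = put s y

namespace Lens

variable {σ τ υ : Type*}

/-- The first component of a pair. -/
def fst : Lens (σ × τ) σ := ⟨fun s => s.1, fun s x => (x, s.2), fun _ _ => rfl, fun _ _ _ => rfl⟩

/-- The second component of a pair. -/
def snd : Lens (σ × τ) τ := ⟨fun s => s.2, fun s x => (s.1, x), fun _ _ => rfl, fun _ _ _ => rfl⟩

/-- A variable of a variable. -/
def comp (b : Lens τ υ) (a : Lens σ τ) : Lens σ υ where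
  get s := b.get (a.get s)
  put s x := a.put s (b.put (a.get s) x)
  get_put s x := by rw [a.get_put, b.get_put]
  put_put s x y := by rw [a.put_put, a.get_put, b.put_put]

end Lens

section Lift

variable {K K' : Type*} {Γ' : K' → Type*} {Λ Λ' σ σ' : Type*}

/-- A statement of a machine as a statement of a bigger one, whose stacks, internal state and
labels contain those of the smaller machine through `ι`, `var` and `φ`, with `e` in place of
`halt`. -/
def liftStmt (ι : K → K') (var : Lens σ' σ) (φ : Λ → Λ') (e : Stmt Γ' Λ' σ') :
    Stmt (fun k => Γ' (ι k)) Λ σ → Stmt Γ' Λ' σ'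
  | .push k f q => .push (ι k) (fun s => f (var.get s)) (liftStmt ι var φ e q)
  | .peek k f q => .peek (ι k) (fun s a => var.put s (f (var.get s) a)) (liftStmt ι var φ e q)
  | .pop k f q => .pop (ι k) (fun s a => var.put s (f (var.get s) a)) (liftStmt ι var φ e q)
  | .load f q => .load (fun s => var.put s (f (var.get s))) (liftStmt ι var φ e q)
  | .branch f q₁ q₂ =>
    .branch (fun s => f (var.get s)) (liftStmt ι var φ e q₁) (liftStmt ι var φ e q₂)
  | .goto f => .goto (fun s => φ (f (var.get s)))
  | .halt => e

variable [DecidableEq K] [DecidableEq K'] {ι : K → K'} {var : Lens σ' σ} {φ : Λ → Λ'}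
  {e : Stmt Γ' Λ' σ'} {emb : (∀ k, List (Γ' (ι k))) → ∀ k, List (Γ' k)}

theorem stepAux_liftStmt (hemb : ∀ S k, emb S (ι k) = S k)
    (hupd : ∀ S k x, update (emb S) (ι k) x = emb (update S k x))
    (q : Stmt (fun k => Γ' (ι k)) Λ σ) (s : σ') (v : σ) (S : ∀ k, List (Γ' (ι k))) :
    stepAux (liftStmt ι var φ e q) (var.put s v) (emb S) =
      match stepAux q v S with
      | ⟨some l, v', S'⟩ => ⟨some (φ l), var.put s v', emb S'⟩
      | ⟨none, v', S'⟩ => stepAux e (var.put s v') (emb S') := by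
  induction q generalizing v S with
  | push k f q ih => simp only [liftStmt, stepAux, var.get_put, hemb, hupd, ih]
  | peek k f q ih => simp only [liftStmt, stepAux, var.get_put, var.put_put, hemb, ih]
  | pop k f q ih => simp only [liftStmt, stepAux, var.get_put, var.put_put, hemb, hupd, ih]
  | load f q ih => simp only [liftStmt, stepAux, var.get_put, var.put_put, ih]
  | branch f q₁ q₂ ih₁ ih₂ =>
    simp only [liftStmt, stepAux, var.get_put]
    cases f v
    · exact ih₂ v S
    · exact ih₁ v S
  | goto f => simp only [liftStmt, stepAux, var.get_put]
  | halt => simp only [liftStmt, stepAux]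

theorem ReachesIn.lift {m : Λ → Stmt (fun k => Γ' (ι k)) Λ σ} {m' : Λ' → Stmt Γ' Λ' σ'}
    (hm : ∀ l, m' (φ l) = liftStmt ι var φ e (m l)) (hemb : ∀ S k, emb S (ι k) = S k)
    (hupd : ∀ S k x, update (emb S) (ι k) x = emb (update S k x)) {n : ℕ} {l : Λ} {v v' : σ}
    {S S' : ∀ k, List (Γ' (ι k))} (h : ReachesIn m n ⟨some l, v, S⟩ ⟨none, v', S'⟩) (s : σ') :
    ReachesIn m' n ⟨some (φ l), var.put s v, emb S⟩ (stepAux e (var.put s v') (emb S')) := by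
  generalize hc : (⟨some l, v, S⟩ : TM2.Cfg _ Λ σ) = c at h
  generalize hc' : (⟨none, v', S'⟩ : TM2.Cfg _ Λ σ) = c' at h
  induction h generalizing l v S with
  | refl n c => simp [← hc'] at hc
  | @step n l v S c h ih =>
    cases hc
    cases hc'
    refine .step ?_
    rw [hm, stepAux_liftStmt hemb hupd]
    rcases hc : stepAux (m l) v S with ⟨_ | l₁, v₁, S₁⟩
    · rw [hc] at h
      cases h
      exact .refl _ _
    · exact ih hc.symm rfl

end Lift

/-! ### Moving the contents of stacks -/

section Move

variable {K : Type*} {Γ : K → Type*} {Λ σ X : Type*}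

/-- Pop a symbol from the stack `k` into the variable `reg`; continue with `body` if there was one
and with `exit` if the stack was empty. -/
def drainStmt (k : K) (reg : Lens σ (Option X)) (f : Γ k → X) (body exit : Stmt Γ Λ σ) :
    Stmt Γ Λ σ :=
  .pop k (fun s a => reg.put s (a.map f)) (.branch (fun s => (reg.get s).isSome) body exit)

/-- Push the contents of the stack `k₁` on the stack `k₂`, one symbol per step, in a loop at the
label `l`; continue with `exit`. -/
def moveStmt [Inhabited X] (k₁ k₂ : K) (reg : Lens σ (Option X)) (f : Γ k₁ → X) (g : X → Γ k₂)
    (l : Λ) (exit : Stmt Γ Λ σ) : Stmt Γ Λ σ :=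
  drainStmt k₁ reg f
    (.push k₂ (fun s => g ((reg.get s).getD default)) (.goto fun _ => l)) exit

variable [DecidableEq K] {m : Λ → Stmt Γ Λ σ} {l l' : Λ} {reg : Lens σ (Option X)} {k k₁ k₂ t : K}
  {exit : Stmt Γ Λ σ}

/-- In the invariant `st L D`, `L` is what is left on the stack `k` and `D` lists the symbols that
were already popped, the last one first. -/
theorem ReachesIn.drain {f : Γ k → X} {body : Stmt Γ Λ σ}
    (hm : m l = drainStmt k reg f body exit) {st : List (Γ k) → List X → ∀ k, List (Γ k)}
    (hst : ∀ L D, st L D k = L)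
    (hbody : ∀ v a L D, stepAux body (reg.put v (some (f a))) (update (st (a :: L) D) k L) =
      ⟨some l, reg.put v (some (f a)), st L (f a :: D)⟩) (v : σ) (L : List (Γ k)) (D : List X) :
    ReachesIn m (L.length + 1) ⟨some l, v, st L D⟩
      (stepAux exit (reg.put v none) (st [] ((L.map f).reverse ++ D))) := by
  induction L generalizing v D with
  | nil =>
    have hnil : update (st [] D) k [] = st [] D := by rw [update_eq_self_iff, hst]
    refine .step ?_
    simpa [hm, drainStmt, stepAux, hst, hnil, reg.get_put] using ReachesIn.refl _ _
  | cons a L ih =>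
    refine .step ?_
    have h := ih (reg.put v (some (f a))) (f a :: D)
    rw [reg.put_put] at h
    simpa [hm, drainStmt, stepAux, hst, hbody, reg.get_put] using h

variable [Inhabited X]

theorem ReachesIn.move {f : Γ k₁ → X} {g : X → Γ k₂}
    (hm : m l = moveStmt k₁ k₂ reg f g l exit) (hk : k₁ ≠ k₂) (v : σ) (S : ∀ k, List (Γ k)) :
    ReachesIn m ((S k₁).length + 1) ⟨some l, v, S⟩ (stepAux exit (reg.put v none)
      (update (update S k₂ (((S k₁).map (g ∘ f)).reverse ++ S k₂)) k₁ [])) := by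
  have h := ReachesIn.drain (st := fun L D => update (update S k₂ (D.map g ++ S k₂)) k₁ L) hm
    (fun L D => update_self ..)
    (fun v a L D => by
      simp only [stepAux, reg.get_put, Option.getD_some, List.map_cons, List.cons_append]
      rw [update_idem, update_of_ne hk.symm, update_self, update_comm hk, update_idem])
    v (S k₁) []
  simpa [List.map_reverse] using h

theorem ReachesIn.transfer {f : Γ k₁ → X} {g : X → Γ t} {f' : Γ t → X} {g' : X → Γ k₂}
    (hm : m l = moveStmt k₁ t reg f g l (.goto fun _ => l'))
    (hm' : m l' = moveStmt t k₂ reg f' g' l' exit) (hg : ∀ x, f' (g x) = x)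
    (h₁ : k₁ ≠ t) (h₂ : t ≠ k₂) (v : σ) (S : ∀ k, List (Γ k)) (hS : S t = []) :
    ReachesIn m (2 * ((S k₁).length + 1)) ⟨some l, v, S⟩ (stepAux exit (reg.put v none)
      (update (update S k₁ []) k₂ ((S k₁).map (g' ∘ f) ++ update S k₁ [] k₂))) := by
  set S₁ := update S k₁ [] with hS₁
  have hfirst := ReachesIn.move hm h₁ v S
  rw [hS, List.append_nil, update_comm h₁.symm, ← hS₁] at hfirst
  have hsecond := ReachesIn.move hm' h₂ (reg.put v none)
    (update S₁ t ((S k₁).map (g ∘ f)).reverse)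
  have hmap : (g' ∘ f') ∘ g ∘ f = g' ∘ f := by
    funext a
    simp [hg]
  have hclear : ∀ L, update (update S₁ k₂ L) t [] = update S₁ k₂ L := by
    intro L
    rw [update_eq_self_iff, update_of_ne h₂, hS₁, update_of_ne h₁.symm, hS]
  rw [reg.put_put, update_self, List.map_reverse, List.reverse_reverse, List.map_map, hmap,
    List.length_reverse, List.length_map, update_comm h₂, update_idem, update_of_ne h₂.symm,
    hclear] at hsecond
  rw [two_mul]
  exact hfirst.trans hsecond

end Move

/-! ### Closure properties of polynomial-time computability -/

theorem eval_mono (P : Polynomial ℕ) : Monotone fun n => P.eval n := by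
  intro a b h
  simp only [Polynomial.eval_eq_sum_range]
  gcongr

/-- Polynomial-time computability with respect to encodings of inputs and outputs. -/
def PolyTimeVia {α β A B : Type} (ea : α → List A) (eb : β → List B) (f : α → β) : Prop :=
  Nonempty (TM2ComputableInPolyTime ea eb f)

theorem initList_eq_update (tm : FinTM2) (s : List (tm.Γ tm.k₀)) :
    initList tm s = ⟨some tm.main, tm.initialState, update (fun _ => []) tm.k₀ s⟩ := by
  unfold initList
  congr 1
  funext k
  obtain rfl | h := eq_or_ne k tm.k₀
  · simp
  · simp [h]

theorem haltList_eq_update (tm : FinTM2) (s : List (tm.Γ tm.k₁)) :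
    haltList tm s = ⟨none, tm.initialState, update (fun _ => []) tm.k₁ s⟩ := by
  unfold haltList
  congr 1
  funext k
  obtain rfl | h := eq_or_ne k tm.k₁
  · simp
  · simp [h]

section PolyTimeVia

variable {α β A B : Type} {ea : α → List A} {eb : β → List B} {f : α → β}

theorem PolyTimeVia.exists_machine (h : PolyTimeVia ea eb f) :
    ∃ (tm : FinTM2) (e₀ : tm.Γ tm.k₀ ≃ A) (e₁ : tm.Γ tm.k₁ ≃ B) (T : Polynomial ℕ),
      ∀ a, ReachesIn tm.m (T.eval (ea a).length)
        ⟨some tm.main, tm.initialState, update (fun _ => []) tm.k₀ ((ea a).map e₀.symm)⟩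
        ⟨none, tm.initialState, update (fun _ => []) tm.k₁ ((eb (f a)).map e₁.symm)⟩ := by
  obtain ⟨M⟩ := h
  refine ⟨M.tm, M.inputAlphabet, M.outputAlphabet, M.time, fun a => ?_⟩
  have hrun := M.outputsFun a
  rw [← initList_eq_update, ← haltList_eq_update]
  exact (reachesIn_of_iterate_eq_some hrun.evals_in_steps).mono hrun.steps_le_m

theorem PolyTimeVia.of_machine {K Λ σ : Type} [DecidableEq K] [Finite K] [Finite Λ] [Finite σ]
    {Γ : K → Type} (m : Λ → Stmt Γ Λ σ) (k₀ k₁ : K) [Finite (Γ k₀)] (l₀ : Λ) (v₀ : σ)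
    (e₀ : Γ k₀ ≃ A) (e₁ : Γ k₁ ≃ B) (T : Polynomial ℕ)
    (h : ∀ a, ReachesIn m (T.eval (ea a).length)
        ⟨some l₀, v₀, update (fun _ => []) k₀ ((ea a).map e₀.symm)⟩
        ⟨none, v₀, update (fun _ => []) k₁ ((eb (f a)).map e₁.symm)⟩) :
    PolyTimeVia ea eb f := by
  have := Fintype.ofFinite K
  have := Fintype.ofFinite Λ
  have := Fintype.ofFinite σ
  have := Fintype.ofFinite (Γ k₀)
  choose steps hle hsteps using fun a => (h a).exists_iterate_eq_some
  refine ⟨⟨⟨⟨k₀, k₁, Γ, Λ, l₀, σ, v₀, m⟩, e₀, e₁⟩, T, fun a => ⟨⟨steps a, ?_⟩, hle a⟩⟩⟩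
  rw [initList_eq_update]
  simp only [Option.map_some, haltList_eq_update]
  exact hsteps a

theorem PolyTimeVia.length_le (h : PolyTimeVia ea eb f) :
    ∃ P : Polynomial ℕ, ∀ a, (eb (f a)).length ≤ P.eval (ea a).length := by
  obtain ⟨tm, e₀, e₁, T, h⟩ := h.exists_machine
  have := tm.ΛFin
  have hp : ∀ l, pushes (tm.m l) ≤ ∑ l, pushes (tm.m l) := fun l =>
    Finset.single_le_sum (f := fun l => pushes (tm.m l)) (fun _ _ => Nat.zero_le _)
      (Finset.mem_univ l)
  refine ⟨Polynomial.X + Polynomial.C (∑ l, pushes (tm.m l)) * T, fun a => ?_⟩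
  have hout := (h a).length_le hp tm.k₁
  simp only [update_self, List.length_map] at hout
  simp only [Polynomial.eval_add, Polynomial.eval_X, Polynomial.eval_mul, Polynomial.eval_C]
  refine hout.trans (Nat.add_le_add_right ?_ _)
  obtain h | h := eq_or_ne tm.k₁ tm.k₀
  · rw [h]
    simp
  · simp [h]

end PolyTimeVia

section SumStk

variable {K₁ K₂ : Type} {Γ₁ : K₁ → Type} {Γ₂ : K₂ → Type}

/-- The stack alphabets of a machine that is made of two parts. -/
@[reducible] def sumΓ (Γ₁ : K₁ → Type) (Γ₂ : K₂ → Type) : K₁ ⊕ K₂ → Type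
  | .inl k => Γ₁ k
  | .inr k => Γ₂ k

/-- The stacks of a machine that is made of two parts. -/
def sumStk (S₁ : ∀ k, List (Γ₁ k)) (S₂ : ∀ k, List (Γ₂ k)) : ∀ k, List (sumΓ Γ₁ Γ₂ k)
  | .inl k => S₁ k
  | .inr k => S₂ k

variable [DecidableEq K₁] [DecidableEq K₂] (S₁ : ∀ k, List (Γ₁ k)) (S₂ : ∀ k, List (Γ₂ k))

theorem update_sumStk_inl (k : K₁) (L : List (Γ₁ k)) :
    update (sumStk S₁ S₂) (.inl k) L = sumStk (update S₁ k L) S₂ := by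
  funext k'
  rcases k' with k' | k'
  · obtain rfl | h := eq_or_ne k' k
    · simp [sumStk]
    · simp [sumStk, h]
  · simp [sumStk]

theorem update_sumStk_inr (k : K₂) (L : List (Γ₂ k)) :
    update (sumStk S₁ S₂) (.inr k) L = sumStk S₁ (update S₂ k L) := by
  funext k'
  rcases k' with k' | k'
  · simp [sumStk]
  · obtain rfl | h := eq_or_ne k' k
    · simp [sumStk]
    · simp [sumStk, h]

theorem update_nil_inl (k : K₁) (L : List (Γ₁ k)) :
    (update (fun _ => []) (.inl k) L : ∀ k, List (sumΓ Γ₁ Γ₂ k)) =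
      sumStk (update (fun _ => []) k L) fun _ => [] := by
  rw [← update_sumStk_inl]
  congr 1
  funext k
  cases k <;> rfl

theorem update_nil_inr (k : K₂) (L : List (Γ₂ k)) :
    (update (fun _ => []) (.inr k) L : ∀ k, List (sumΓ Γ₁ Γ₂ k)) =
      sumStk (fun _ => []) (update (fun _ => []) k L) := by
  rw [← update_sumStk_inr]
  congr 1
  funext k
  cases k <;> rfl

end SumStk

section Comp

variable {K₁ K₂ Λ₁ Λ₂ σ₁ σ₂ B : Type} {Γ₁ : K₁ → Type} {Γ₂ : K₂ → Type} [Inhabited B]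

/-- The composition of two machines: run the first one, move its output to the input stack of the
second one by way of an auxiliary stack, and run the second one. -/
def compMachine (m₁ : Λ₁ → Stmt Γ₁ Λ₁ σ₁) (m₂ : Λ₂ → Stmt Γ₂ Λ₂ σ₂) (o₁ : K₁) (i₂ : K₂) (l₂ : Λ₂)
    (e₁ : Γ₁ o₁ ≃ B) (e₂ : Γ₂ i₂ ≃ B) : Λ₁ ⊕ Λ₂ ⊕ Bool →
      Stmt (sumΓ Γ₁ (sumΓ Γ₂ fun _ : Unit => B)) (Λ₁ ⊕ Λ₂ ⊕ Bool) (σ₁ × σ₂ × Option B)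
  | .inl l => liftStmt .inl .fst .inl (.goto fun _ => .inr (.inr false)) (m₁ l)
  | .inr (.inr false) => moveStmt (.inl o₁) (.inr (.inr ())) (.comp .snd .snd) e₁ id
      (.inr (.inr false)) (.goto fun _ => .inr (.inr true))
  | .inr (.inr true) => moveStmt (.inr (.inr ())) (.inr (.inl i₂)) (.comp .snd .snd) id e₂.symm
      (.inr (.inr true)) (.goto fun _ => .inr (.inl l₂))
  | .inr (.inl l) => liftStmt (fun k => .inr (.inl k)) (.comp .fst .snd) (fun l => .inr (.inl l))
      .halt (m₂ l)

variable [DecidableEq K₁] [DecidableEq K₂] {m₁ : Λ₁ → Stmt Γ₁ Λ₁ σ₁} {m₂ : Λ₂ → Stmt Γ₂ Λ₂ σ₂}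
  {i₁ o₁ : K₁} {i₂ o₂ : K₂} {l₁ : Λ₁} {l₂ : Λ₂} {v₁ : σ₁} {v₂ : σ₂} {e₁ : Γ₁ o₁ ≃ B}
  {e₂ : Γ₂ i₂ ≃ B} {n₁ n₂ : ℕ} {L : List (Γ₁ i₁)} {L' : List B} {L'' : List (Γ₂ o₂)}

theorem reachesIn_compMachine
    (h₁ : ReachesIn m₁ n₁ ⟨some l₁, v₁, update (fun _ => []) i₁ L⟩
      ⟨none, v₁, update (fun _ => []) o₁ (L'.map e₁.symm)⟩)
    (h₂ : ReachesIn m₂ n₂ ⟨some l₂, v₂, update (fun _ => []) i₂ (L'.map e₂.symm)⟩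
      ⟨none, v₂, update (fun _ => []) o₂ L''⟩) :
    ReachesIn (compMachine m₁ m₂ o₁ i₂ l₂ e₁ e₂) (n₁ + (2 * (L'.length + 1) + n₂))
      ⟨some (.inl l₁), (v₁, v₂, none), update (fun _ => []) (.inl i₁) L⟩
      ⟨none, (v₁, v₂, none), update (fun _ => []) (.inr (.inl o₂)) L''⟩ := by
  have hrun₁ := h₁.lift (m' := compMachine m₁ m₂ o₁ i₂ l₂ e₁ e₂) (var := .fst) (φ := Sum.inl)
    (emb := fun S => sumStk S fun _ => []) (fun _ => rfl) (fun _ _ => rfl)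
    (fun S k L => update_sumStk_inl S _ k L) (v₁, v₂, none)
  have hrun₂ := ReachesIn.lift (ι := fun k => .inr (.inl k)) (m := m₂)
    (m' := compMachine m₁ m₂ o₁ i₂ l₂ e₁ e₂) (var := .comp .fst .snd)
    (φ := fun l => .inr (.inl l)) (emb := fun S => sumStk (fun _ => []) (sumStk S fun _ => []))
    (fun _ => rfl) (fun _ _ => rfl)
    (fun S k L => (update_sumStk_inr (fun _ => []) (sumStk S fun _ => []) (.inl k) L).trans
      (congrArg _ (update_sumStk_inl S _ k L)))
    h₂ (v₁, v₂, none)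
  have hmove : ReachesIn (compMachine m₁ m₂ o₁ i₂ l₂ e₁ e₂) (2 * (L'.length + 1))
      ⟨some (.inr (.inr false)), (v₁, v₂, none), update (fun _ => []) (.inl o₁) (L'.map e₁.symm)⟩
      ⟨some (.inr (.inl l₂)), (v₁, v₂, none),
        update (fun _ => []) (.inr (.inl i₂)) (L'.map e₂.symm)⟩ := by
    have h := ReachesIn.transfer (m := compMachine m₁ m₂ o₁ i₂ l₂ e₁ e₂)
      (l := .inr (.inr false)) (l' := .inr (.inr true)) (k₁ := .inl o₁) (k₂ := .inr (.inl i₂))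
      (t := .inr (.inr ())) rfl rfl (fun _ => rfl) (by simp) (by simp) (v₁, v₂, none)
      (update (fun _ => []) (.inl o₁) (L'.map e₁.symm)) (by simp)
    simpa [stepAux, Lens.comp, Lens.snd, Function.comp_def] using h
  rw [update_nil_inl, update_nil_inr, update_nil_inl]
  rw [update_nil_inl, update_nil_inr, update_nil_inl] at hmove
  exact hrun₁.trans (hmove.trans hrun₂)

end Comp

section Pair

variable {K₁ K₂ Λ₁ Λ₂ σ₁ σ₂ A B : Type} {Γ₁ : K₁ → Type} {Γ₂ : K₂ → Type}
  [Inhabited A] [Inhabited B]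

/-- The phases of `pairMachine` outside its two subroutines. -/
inductive PairPhase
  | fetch | split | take | join
  deriving DecidableEq

instance : Fintype PairPhase := ⟨{.fetch, .split, .take, .join}, fun x => by cases x <;> simp⟩

/-- Two machines run on the same input: copy the input to both input stacks by way of an auxiliary
stack, run the machines, put the first output in front of the second one by way of another auxiliary
stack, and put the symbol `b` in front of both. -/
def pairMachine (m₁ : Λ₁ → Stmt Γ₁ Λ₁ σ₁) (m₂ : Λ₂ → Stmt Γ₂ Λ₂ σ₂) {i₁ o₁ : K₁} {i₂ o₂ : K₂}
    (l₁ : Λ₁) (l₂ : Λ₂) (e₁ : Γ₁ i₁ ≃ A) (e₂ : Γ₂ i₂ ≃ A) (f₁ : Γ₁ o₁ ≃ B) (f₂ : Γ₂ o₂ ≃ B)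
    (b : B) : Λ₁ ⊕ Λ₂ ⊕ PairPhase →
      Stmt (sumΓ Γ₁ (sumΓ Γ₂ fun t : Bool => bif t then A else B)) (Λ₁ ⊕ Λ₂ ⊕ PairPhase)
        (σ₁ × σ₂ × Option A × Option B)
  | .inr (.inr .fetch) => moveStmt (.inl i₁) (.inr (.inr true)) (.comp .fst (.comp .snd .snd)) e₁ id
      (.inr (.inr .fetch)) (.goto fun _ => .inr (.inr .split))
  | .inr (.inr .split) => drainStmt (.inr (.inr true)) (.comp .fst (.comp .snd .snd)) id
      (.push (.inl i₁) (fun s => e₁.symm (s.2.2.1.getD default))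
        (.push (.inr (.inl i₂)) (fun s => e₂.symm (s.2.2.1.getD default))
          (.goto fun _ => .inr (.inr .split))))
      (.goto fun _ => .inl l₁)
  | .inl l => liftStmt .inl .fst .inl (.goto fun _ => .inr (.inl l₂)) (m₁ l)
  | .inr (.inl l) => liftStmt (fun k => .inr (.inl k)) (.comp .fst .snd) (fun l => .inr (.inl l))
      (.goto fun _ => .inr (.inr .take)) (m₂ l)
  | .inr (.inr .take) => moveStmt (.inl o₁) (.inr (.inr false)) (.comp .snd (.comp .snd .snd)) f₁ id
      (.inr (.inr .take)) (.goto fun _ => .inr (.inr .join))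
  | .inr (.inr .join) => moveStmt (.inr (.inr false)) (.inr (.inl o₂))
      (.comp .snd (.comp .snd .snd)) id f₂.symm (.inr (.inr .join))
      (.push (.inr (.inl o₂)) (fun _ => f₂.symm b) .halt)

variable [DecidableEq K₁] [DecidableEq K₂] {m₁ : Λ₁ → Stmt Γ₁ Λ₁ σ₁} {m₂ : Λ₂ → Stmt Γ₂ Λ₂ σ₂}
  {i₁ o₁ : K₁} {i₂ o₂ : K₂} {l₁ : Λ₁} {l₂ : Λ₂} {v₁ : σ₁} {v₂ : σ₂} {e₁ : Γ₁ i₁ ≃ A}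
  {e₂ : Γ₂ i₂ ≃ A} {f₁ : Γ₁ o₁ ≃ B} {f₂ : Γ₂ o₂ ≃ B} {b : B} {n₁ n₂ : ℕ} {L : List A}
  {L₁ L₂ : List B}

theorem reachesIn_pairMachine_split (v₁ : σ₁) (v₂ : σ₂) (L : List A) :
    ReachesIn (pairMachine m₁ m₂ l₁ l₂ e₁ e₂ f₁ f₂ b) (2 * (L.length + 1))
      ⟨some (.inr (.inr .fetch)), (v₁, v₂, none, none),
        update (fun _ => []) (.inl i₁) (L.map e₁.symm)⟩
      ⟨some (.inl l₁), (v₁, v₂, none, none),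
        sumStk (update (fun _ => []) i₁ (L.map e₁.symm))
          (sumStk (update (fun _ => []) i₂ (L.map e₂.symm)) fun _ => [])⟩ := by
  have hfetch : ReachesIn (pairMachine m₁ m₂ l₁ l₂ e₁ e₂ f₁ f₂ b) (L.length + 1)
      ⟨some (.inr (.inr .fetch)), (v₁, v₂, none, none),
        update (fun _ => []) (.inl i₁) (L.map e₁.symm)⟩
      ⟨some (.inr (.inr .split)), (v₁, v₂, none, none),
        sumStk (fun _ => []) (sumStk (fun _ => []) (update (fun _ => []) true L.reverse))⟩ := by
    have h := ReachesIn.move (m := pairMachine m₁ m₂ l₁ l₂ e₁ e₂ f₁ f₂ b)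
      (l := .inr (.inr .fetch)) (k₁ := .inl i₁) (k₂ := .inr (.inr true)) rfl (by simp)
      (v₁, v₂, none, none) (update (fun _ => []) (.inl i₁) (L.map e₁.symm))
    simpa [stepAux, Lens.comp, Lens.fst, Lens.snd, Function.comp_def, update_nil_inl,
      update_nil_inr, update_sumStk_inl, update_sumStk_inr] using h
  have hsplit := ReachesIn.drain (m := pairMachine m₁ m₂ l₁ l₂ e₁ e₂ f₁ f₂ b)
    (l := .inr (.inr .split)) (k := .inr (.inr true)) rfl
    (st := fun L D => sumStk (update (fun _ => []) i₁ (D.map e₁.symm))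
      (sumStk (update (fun _ => []) i₂ (D.map e₂.symm)) (update (fun _ => []) true L)))
    (fun L D => by simp [sumStk]) (fun v a L D => by
      simp [stepAux, Lens.comp, Lens.fst, Lens.snd, update_sumStk_inl, update_sumStk_inr,
        sumStk]) (v₁, v₂, none, none) L.reverse []
  rw [two_mul]
  refine hfetch.trans ?_
  simpa [stepAux, Lens.comp, Lens.fst, Lens.snd] using hsplit

theorem reachesIn_pairMachine_join (v₁ : σ₁) (v₂ : σ₂) (L₁ L₂ : List B) :
    ReachesIn (pairMachine m₁ m₂ l₁ l₂ e₁ e₂ f₁ f₂ b) (2 * (L₁.length + 1))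
      ⟨some (.inr (.inr .take)), (v₁, v₂, none, none),
        sumStk (update (fun _ => []) o₁ (L₁.map f₁.symm))
          (sumStk (update (fun _ => []) o₂ (L₂.map f₂.symm)) fun _ => [])⟩
      ⟨none, (v₁, v₂, none, none),
        update (fun _ => []) (.inr (.inl o₂)) ((b :: (L₁ ++ L₂)).map f₂.symm)⟩ := by
  have h := ReachesIn.transfer (m := pairMachine m₁ m₂ l₁ l₂ e₁ e₂ f₁ f₂ b)
      (l := .inr (.inr .take)) (l' := .inr (.inr .join)) (k₁ := .inl o₁) (k₂ := .inr (.inl o₂))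
      (t := .inr (.inr false)) rfl rfl (fun _ => rfl) (by simp) (by simp) (v₁, v₂, none, none)
      (sumStk (update (fun _ => []) o₁ (L₁.map f₁.symm))
          (sumStk (update (fun _ => []) o₂ (L₂.map f₂.symm)) fun _ => [])) (by simp [sumStk])
  simpa [stepAux, Lens.comp, Lens.snd, Function.comp_def, sumStk, update_sumStk_inl,
    update_sumStk_inr, update_nil_inl, update_nil_inr] using h

theorem reachesIn_pairMachine
    (h₁ : ReachesIn m₁ n₁ ⟨some l₁, v₁, update (fun _ => []) i₁ (L.map e₁.symm)⟩
      ⟨none, v₁, update (fun _ => []) o₁ (L₁.map f₁.symm)⟩)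
    (h₂ : ReachesIn m₂ n₂ ⟨some l₂, v₂, update (fun _ => []) i₂ (L.map e₂.symm)⟩
      ⟨none, v₂, update (fun _ => []) o₂ (L₂.map f₂.symm)⟩) :
    ReachesIn (pairMachine m₁ m₂ l₁ l₂ e₁ e₂ f₁ f₂ b)
      (2 * (L.length + 1) + (n₁ + (n₂ + 2 * (L₁.length + 1))))
      ⟨some (.inr (.inr .fetch)), (v₁, v₂, none, none),
        update (fun _ => []) (.inl i₁) (L.map e₁.symm)⟩
      ⟨none, (v₁, v₂, none, none),
        update (fun _ => []) (.inr (.inl o₂)) ((b :: (L₁ ++ L₂)).map f₂.symm)⟩ := by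
  have hrun₁ := h₁.lift (m' := pairMachine m₁ m₂ l₁ l₂ e₁ e₂ f₁ f₂ b) (var := .fst) (φ := Sum.inl)
    (emb := fun S => sumStk S (sumStk (update (fun _ => []) i₂ (L.map e₂.symm)) fun _ => []))
    (fun _ => rfl) (fun _ _ => rfl) (fun S k L => update_sumStk_inl S _ k L) (v₁, v₂, none, none)
  have hrun₂ := ReachesIn.lift (ι := fun k => .inr (.inl k)) (m := m₂)
    (m' := pairMachine m₁ m₂ l₁ l₂ e₁ e₂ f₁ f₂ b) (var := .comp .fst .snd)
    (φ := fun l => .inr (.inl l))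
    (emb := fun S => sumStk (update (fun _ => []) o₁ (L₁.map f₁.symm)) (sumStk S fun _ => []))
    (fun _ => rfl) (fun _ _ => rfl)
    (fun S k L => (update_sumStk_inr _ (sumStk S fun _ => []) (.inl k) L).trans
      (congrArg _ (update_sumStk_inl S _ k L)))
    h₂ (v₁, v₂, none, none)
  exact (reachesIn_pairMachine_split v₁ v₂ L).trans
    (hrun₁.trans (hrun₂.trans (reachesIn_pairMachine_join v₁ v₂ L₁ L₂)))

end Pair

section Loop

variable {K Λ σ : Type} {Γ : K → Type}

/-- The phases of `loopMachine` outside the body of the loop. -/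
inductive LoopPhase
  | check | take | restore
  deriving DecidableEq

instance : Fintype LoopPhase := ⟨{.check, .take, .restore}, fun x => by cases x <;> simp⟩

/-- Run a machine repeatedly, moving its output back to its input stack `i` by way of an auxiliary
stack, for as long as the second symbol on the stack `i` is `true`. -/
def loopMachine (m : Λ → Stmt Γ Λ σ) {i o : K} (l : Λ) (e : Γ i ≃ Bool) (f : Γ o ≃ Bool) :
    Λ ⊕ LoopPhase →
      Stmt (sumΓ Γ fun _ : Unit => Bool) (Λ ⊕ LoopPhase) (σ × Option Bool × Bool)
  | .inl l => liftStmt .inl .fst .inl (.goto fun _ => .inr .take) (m l)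
  | .inr .check =>
    .pop (.inl i) (fun s a => (s.1, a.map e, s.2.2)) <|
    .peek (.inl i) (fun s a => (s.1, s.2.1, decide (a.map e = some true))) <|
    .push (.inl i) (fun s => e.symm (s.2.1.getD default)) <|
    .branch (fun s => s.2.2)
      (.load (fun s => (s.1, none, false)) (.goto fun _ => .inl l))
      (.load (fun s => (s.1, none, false)) .halt)
  | .inr .take => moveStmt (.inl o) (.inr ()) (.comp .fst .snd) f id (.inr .take)
      (.goto fun _ => .inr .restore)
  | .inr .restore => moveStmt (.inr ()) (.inl i) (.comp .fst .snd) id e.symm (.inr .restore)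
      (.goto fun _ => .inr .check)

variable [DecidableEq K] {m : Λ → Stmt Γ Λ σ} {i o : K} {l : Λ} {e : Γ i ≃ Bool} {f : Γ o ≃ Bool}
  {v : σ} {n : ℕ}

theorem stepAux_loopMachine_check (v : σ) (b : Bool) (L : List Bool) :
    stepAux (loopMachine m l e f (.inr .check)) (v, none, false)
        (update (fun _ => []) (.inl i) ((b :: L).map e.symm)) =
      ⟨if L.head? = some true then some (.inl l) else none, (v, none, false),
        update (fun _ => []) (.inl i) ((b :: L).map e.symm)⟩ := by
  by_cases h : L.head? = some true <;> simp [loopMachine, stepAux, h]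

theorem reachesIn_loopMachine_exit {b : Bool} {L : List Bool} (hL : L.head? ≠ some true) :
    ReachesIn (loopMachine m l e f) 1
      ⟨some (.inr .check), (v, none, false), update (fun _ => []) (.inl i) ((b :: L).map e.symm)⟩
      ⟨none, (v, none, false), update (fun _ => []) (.inl i) ((b :: L).map e.symm)⟩ := by
  refine .step ?_
  rw [stepAux_loopMachine_check, if_neg hL]
  exact .refl _ _

theorem reachesIn_loopMachine_round {b : Bool} {L L' : List Bool} (hL : L.head? = some true)
    (h : ReachesIn m n ⟨some l, v, update (fun _ => []) i ((b :: L).map e.symm)⟩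
      ⟨none, v, update (fun _ => []) o (L'.map f.symm)⟩) :
    ReachesIn (loopMachine m l e f) (n + 2 * (L'.length + 1) + 1)
      ⟨some (.inr .check), (v, none, false), update (fun _ => []) (.inl i) ((b :: L).map e.symm)⟩
      ⟨some (.inr .check), (v, none, false), update (fun _ => []) (.inl i) (L'.map e.symm)⟩ := by
  refine .step ?_
  rw [stepAux_loopMachine_check, if_pos hL]
  have hrun := h.lift (m' := loopMachine m l e f) (var := .fst) (φ := Sum.inl)
    (emb := fun S => sumStk S fun _ => []) (fun _ => rfl) (fun _ _ => rfl)
    (fun S k L => update_sumStk_inl S _ k L) (v, none, false)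
  rw [← update_nil_inl, ← update_nil_inl] at hrun
  refine hrun.trans ?_
  have hmove := ReachesIn.transfer (m := loopMachine m l e f) (l := .inr .take)
    (l' := .inr .restore) (k₁ := .inl o) (k₂ := .inl i) (t := .inr ()) rfl rfl (fun _ => rfl)
    (by simp) (by simp) (v, none, false) (update (fun _ => []) (.inl o) (L'.map f.symm)) (by simp)
  simpa [stepAux, Lens.comp, Lens.fst, Lens.snd, Function.comp_def] using hmove

end Loop

section PolyTimeVia

variable {α β γ δ τ A B C : Type} {ea : α → List A} {eb : β → List B} {ec : γ → List C}

theorem PolyTimeVia.comp [Inhabited B] {f : α → β} {g : β → γ} (hg : PolyTimeVia eb ec g)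
    (hf : PolyTimeVia ea eb f) : PolyTimeVia ea ec fun a => g (f a) := by
  obtain ⟨tm₁, e₁, f₁, T₁, h₁⟩ := hf.exists_machine
  obtain ⟨tm₂, e₂, f₂, T₂, h₂⟩ := hg.exists_machine
  obtain ⟨P, hP⟩ := hf.length_le
  have := tm₁.kFin
  have := tm₁.ΛFin
  have := tm₁.σFin
  have := tm₁.Γk₀Fin
  have := tm₂.kFin
  have := tm₂.ΛFin
  have := tm₂.σFin
  have := tm₂.Γk₀Fin
  have := Finite.of_equiv _ e₂
  refine .of_machine (compMachine tm₁.m tm₂.m tm₁.k₁ tm₂.k₀ tm₂.main f₁ e₂) (.inl tm₁.k₀)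
    (.inr (.inl tm₂.k₁)) (.inl tm₁.main) (tm₁.initialState, tm₂.initialState, none) e₁ f₂
    (T₁ + (2 * (P + 1) + T₂.comp P)) fun a => (reachesIn_compMachine (h₁ a) (h₂ (f a))).mono ?_
  simp only [Polynomial.eval_add, Polynomial.eval_mul, Polynomial.eval_one, Polynomial.eval_comp,
    Polynomial.eval_ofNat]
  gcongr
  · exact hP a
  · exact eval_mono T₂ (hP a)

theorem PolyTimeVia.pair [Finite B] [Inhabited A] [Inhabited B] {eb : β → List B}
    {ec : γ → List B} {ed : δ → List B} {f : α → β} {g : α → γ} {h : α → δ}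
    (hf : PolyTimeVia ea eb f) (hg : PolyTimeVia ea ec g) (b : B)
    (hh : ∀ a, ed (h a) = b :: (eb (f a) ++ ec (g a))) : PolyTimeVia ea ed h := by
  obtain ⟨tm₁, e₁, f₁, T₁, h₁⟩ := hf.exists_machine
  obtain ⟨tm₂, e₂, f₂, T₂, h₂⟩ := hg.exists_machine
  obtain ⟨P, hP⟩ := hf.length_le
  have := tm₁.kFin
  have := tm₁.ΛFin
  have := tm₁.σFin
  have := tm₁.Γk₀Fin
  have := tm₂.kFin
  have := tm₂.ΛFin
  have := tm₂.σFin
  have := Finite.of_equiv _ e₁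
  refine .of_machine (pairMachine tm₁.m tm₂.m tm₁.main tm₂.main e₁ e₂ f₁ f₂ b) (.inl tm₁.k₀)
    (.inr (.inl tm₂.k₁)) (.inr (.inr .fetch)) (tm₁.initialState, tm₂.initialState, none, none)
    e₁ f₂ (2 * (.X + 1) + (T₁ + (T₂ + 2 * (P + 1)))) fun a => ?_
  rw [hh]
  refine (reachesIn_pairMachine (h₁ a) (h₂ a)).mono ?_
  simp only [Polynomial.eval_add, Polynomial.eval_mul, Polynomial.eval_one, Polynomial.eval_X,
    Polynomial.eval_ofNat]
  gcongr
  exact hP a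

/-- A loop whose body maps `s` to `step s`. The flag `c s` that keeps it running is read off the
code of `s`, as its second symbol. -/
theorem PolyTimeVia.loop {es : τ → List Bool} {step : τ → τ} (hstep : PolyTimeVia es es step)
    (c : τ → Bool) (hc : ∀ s, ∃ b L, es s = b :: L ∧ decide (L.head? = some true) = c s)
    (ini : α → τ) (N : α → ℕ) (hhalt : ∀ a, c (step^[N a] (ini a)) = false)
    (hrun : ∀ a, ∀ i < N a, c (step^[i] (ini a)) = true) (P : Polynomial ℕ)
    (hN : ∀ a, N a ≤ P.eval (es (ini a)).length)
    (hsize : ∀ a, ∀ i ≤ N a, (es (step^[i] (ini a))).length ≤ P.eval (es (ini a)).length) :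
    PolyTimeVia (fun a => es (ini a)) es fun a => step^[N a] (ini a) := by
  obtain ⟨tm, e, f, T, h⟩ := hstep.exists_machine
  have := tm.kFin
  have := tm.ΛFin
  have := tm.σFin
  have := tm.Γk₀Fin
  refine .of_machine (loopMachine tm.m tm.main e f) (.inl tm.k₀) (.inl tm.k₀) (.inr .check)
    (tm.initialState, none, false) e e (P * (T.comp P + 2 * (P + 1) + 1) + 1) fun a => ?_
  set m := loopMachine tm.m tm.main e f
  set n := (es (ini a)).length
  have hiter : ∀ i ≤ N a, ReachesIn m (i * (T.eval (P.eval n) + 2 * (P.eval n + 1) + 1))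
      ⟨some (.inr .check), (tm.initialState, none, false),
        update (fun _ => []) (.inl tm.k₀) ((es (ini a)).map e.symm)⟩
      ⟨some (.inr .check), (tm.initialState, none, false),
        update (fun _ => []) (.inl tm.k₀) ((es (step^[i] (ini a))).map e.symm)⟩ := by
    intro i hi
    induction i with
    | zero => exact .refl _ _
    | succ i ih =>
      rw [Nat.succ_mul]
      refine (ih (by omega)).trans ?_
      have hround := h (step^[i] (ini a))
      obtain ⟨b, L, hes, hL⟩ := hc (step^[i] (ini a))
      rw [hrun a i hi, decide_eq_true_iff] at hL
      rw [← iterate_succ_apply' step] at hround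
      rw [hes] at hround ⊢
      refine (reachesIn_loopMachine_round hL hround).mono ?_
      rw [← hes]
      gcongr
      · exact eval_mono T (hsize a i (by omega))
      · exact hsize a (i + 1) hi
  obtain ⟨b, L, hes, hL⟩ := hc (step^[N a] (ini a))
  rw [hhalt, decide_eq_false_iff_not] at hL
  have hlast := reachesIn_loopMachine_exit (m := tm.m) (l := tm.main) (e := e) (f := f)
    (v := tm.initialState) (b := b) hL
  rw [← hes] at hlast
  refine ((hiter _ le_rfl).trans hlast).mono ?_
  simp only [Polynomial.eval_add, Polynomial.eval_mul, Polynomial.eval_one, Polynomial.eval_comp,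
    Polynomial.eval_ofNat]
  gcongr
  exact hN a

end PolyTimeVia

/-! ### Pushdown transducers -/

/-- A one-state pushdown transducer, which translates words over `A` to words over `B`. On reading
a letter `a` with `g` on top of its store, it replaces `g` by the first word of `step g a` and
writes the second one; at the end of the input it writes `final g` for each `g` in the store. -/
structure PushdownTransducer (G A B : Type) where
  start : G
  step : G → A → List G × List B
  final : G → List B

/-- The output for a given store and remaining input. -/
def PushdownTransducer.run {G A B : Type} (P : PushdownTransducer G A B) :
    List G → List A → List B
  | c, [] => c.flatMap P.final
  | [], _ :: _ => []
  | g :: c, a :: l => (P.step g a).2 ++ P.run ((P.step g a).1 ++ c) l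

theorem PushdownTransducer.run_nil {G A B : Type} (P : PushdownTransducer G A B) (l : List A) :
    P.run [] l = [] := by
  cases l <;> simp [run]

section PushList

variable {K : Type} {Γ : K → Type} {Λ σ : Type}

/-- Push the letters of the word `w s`, whose length is at most `n`, where `s` is the internal
state. -/
def pushListStmt (k : K) [Inhabited (Γ k)] : ℕ → (σ → List (Γ k)) → Stmt Γ Λ σ → Stmt Γ Λ σ
  | 0, _, q => q
  | n + 1, w, q => .branch (fun s => (w s).isEmpty) q
      (.push k (fun s => (w s).headD default) (pushListStmt k n (fun s => (w s).tail) q))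

theorem stepAux_pushListStmt [DecidableEq K] {k : K} [Inhabited (Γ k)] {n : ℕ}
    {w : σ → List (Γ k)} {v : σ} (h : (w v).length ≤ n) (q : Stmt Γ Λ σ) (S : ∀ k, List (Γ k)) :
    stepAux (pushListStmt k n w q) v S = stepAux q v (update S k ((w v).reverse ++ S k)) := by
  induction n generalizing w S with
  | zero =>
    rw [Nat.le_zero, List.length_eq_zero_iff] at h
    simp [pushListStmt, h]
  | succ n ih =>
    rcases hw : w v with _ | ⟨a, l⟩
    · simp [pushListStmt, stepAux, hw]
    · rw [hw, List.length_cons, Nat.add_le_add_iff_right] at h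
      simp [pushListStmt, stepAux, hw, ih (w := fun s => (w s).tail) (by simpa [hw] using h)]

end PushList

namespace PushdownTransducer

/-- The stacks of the machine that simulates a pushdown transducer. -/
inductive Stack
  | input | store | scratch | output
  deriving DecidableEq

instance : Fintype Stack :=
  ⟨{.input, .store, .scratch, .output}, fun x => by cases x <;> simp⟩

/-- The phases of the machine that simulates a pushdown transducer. -/
inductive Phase
  | init | read | clear | copy
  deriving DecidableEq

instance : Fintype Phase := ⟨{.init, .read, .clear, .copy}, fun x => by cases x <;> simp⟩

variable {G A B : Type}

/-- The stack alphabets of the machine that simulates a pushdown transducer. -/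
@[reducible] def Stack.Γ (G A B : Type) : Stack → Type
  | .input => A
  | .store => G
  | .scratch => B
  | .output => B

/-- The stacks of the machine with the given contents. -/
def contents (l : List A) (c : List G) (w u : List B) : ∀ k, List (Stack.Γ G A B k)
  | .input => l
  | .store => c
  | .scratch => w
  | .output => u

section Stacks

variable (l l' : List A) (c c' : List G) (w w' u u' : List B)

theorem update_contents_input : update (contents l c w u) .input l' = contents l' c w u := by
  funext k
  cases k <;> simp [contents]

theorem update_contents_store : update (contents l c w u) .store c' = contents l c' w u := by
  funext k
  cases k <;> simp [contents]

theorem update_contents_scratch : update (contents l c w u) .scratch w' = contents l c w' u := by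
  funext k
  cases k <;> simp [contents]

theorem update_contents_output : update (contents l c w u) .output u' = contents l c w u' := by
  funext k
  cases k <;> simp [contents]

theorem contents_nil : contents ([] : List A) ([] : List G) ([] : List B) [] = fun _ => [] := by
  funext k
  cases k <;> rfl

end Stacks

section Machine

variable [Inhabited G] [Inhabited B]

/-- The simulation of a pushdown transducer whose words have length at most `n`: it writes the
output on the stack `scratch` first, and reverses it in the end. -/
def machine (P : PushdownTransducer G A B) (n : ℕ) :
    Phase → Stmt (Stack.Γ G A B) Phase (Option A × Option G × Option B)
  | .init => .push .store (fun _ => P.start) (.goto fun _ => .read)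
  | .read => drainStmt .input .fst id
      (.pop .store (fun s g => (s.1, g, s.2.2)) <|
        pushListStmt .store n (fun s => (Option.map₂ (fun g a => (P.step g a).1.reverse)
          s.2.1 s.1).getD []) <|
        pushListStmt .scratch n (fun s => (Option.map₂ (fun g a => (P.step g a).2)
          s.2.1 s.1).getD []) <|
        .goto fun _ => .read)
      (.load (fun _ => (none, none, none)) (.goto fun _ => .clear))
  | .clear => drainStmt .store (.comp .fst .snd) id
      (pushListStmt .scratch n (fun s => (s.2.1.map P.final).getD []) (.goto fun _ => .clear))
      (.goto fun _ => .copy)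
  | .copy => moveStmt .scratch .output (.comp .snd .snd) id id .copy .halt

variable {P : PushdownTransducer G A B} {n : ℕ}

theorem reachesIn_clear (hfinal : ∀ g, (P.final g).length ≤ n) (c : List G) (w : List B) :
    ReachesIn (P.machine n) (c.length + 1 + (n * c.length + w.length + 1))
      ⟨some .clear, (none, none, none), contents [] c w []⟩
      ⟨none, (none, none, none), contents [] [] [] (w.reverse ++ c.flatMap P.final)⟩ := by
  set w' := c.reverse.flatMap (fun g => (P.final g).reverse) ++ w with hw'
  have hw'_reverse : w'.reverse = w.reverse ++ c.flatMap P.final := by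
    simp [hw', List.reverse_flatMap, Function.comp_def]
  have hw'_length : w'.length ≤ n * c.length + w.length := by
    rw [← w'.length_reverse, hw'_reverse, List.length_append, List.length_reverse, add_comm,
      List.length_flatMap, mul_comm]
    gcongr
    simpa using List.sum_le_card_nsmul (c.map fun g => (P.final g).length) n (by simp [hfinal])
  have hclear := ReachesIn.drain (m := P.machine n) (l := .clear) (k := .store) rfl
    (st := fun L D => contents [] L (D.flatMap (fun g => (P.final g).reverse) ++ w) [])
    (fun _ _ => rfl)
    (fun v g L D => by
      simp [stepAux_pushListStmt, stepAux, Lens.comp, Lens.fst, Lens.snd, hfinal,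
        update_contents_store, update_contents_scratch, contents])
    (none, none, none) c []
  have hcopy := ReachesIn.move (m := P.machine n) (l := .copy) (k₁ := .scratch) rfl (by simp)
    (none, none, none) (contents [] [] w' [])
  rw [List.map_id, List.append_nil, ← hw'] at hclear
  simp only [contents, comp_id, List.map_id, List.append_nil, hw'_reverse, update_contents_output,
    update_contents_scratch] at hcopy
  exact hclear.trans (hcopy.mono (by gcongr))

/-- A bound for the number of steps of `machine` with words of length `c`, `l` and `w` on the stacks
`store`, `input` and `scratch`. -/
def time (n l c w : ℕ) : ℕ :=
  l + (c + n * l + 1 + (n * (c + n * l) + (w + n * l) + 1) + 1)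

theorem time_add_one_le {l c c' w w' : ℕ} (hc : c' ≤ c + n) (hw : w' ≤ w + n) :
    time n l c' w' + 1 ≤ time n (l + 1) c w := by
  have hc' : c' + n * l ≤ c + n * (l + 1) := by linarith
  have hw' : w' + n * l ≤ w + n * (l + 1) := by linarith
  simp only [time]
  rw [Nat.add_right_comm]
  gcongr

theorem reachesIn_read (hstep : ∀ g a, (P.step g a).1.length ≤ n ∧ (P.step g a).2.length ≤ n)
    (hfinal : ∀ g, (P.final g).length ≤ n) (v : Option A × Option G × Option B) (l : List A)
    (c : List G) (w : List B) :
    ReachesIn (P.machine n) (time n l.length c.length w.length)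
      ⟨some .read, v, contents l c w []⟩
      ⟨none, (none, none, none), contents [] [] [] (w.reverse ++ P.run c l)⟩ := by
  induction l generalizing v c w with
  | nil =>
    rw [time, List.length_nil, zero_add]
    refine .step ?_
    simpa [machine, drainStmt, stepAux, contents, Lens.fst, update_contents_input, run]
      using reachesIn_clear hfinal c w
  | cons a l ih =>
    rcases c with _ | ⟨g, c⟩
    · refine .mono (.step ?_) (time_add_one_le (w := w.length) (Nat.le_add_right _ n)
        (Nat.le_add_right _ n))
      simpa [machine, drainStmt, stepAux, contents, Lens.fst, update_contents_input, run_nil,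
        stepAux_pushListStmt, update_contents_store, update_contents_scratch]
        using ih (some a, none, v.2.2) [] w
    · obtain ⟨h₁, h₂⟩ := hstep g a
      set c' := (P.step g a).1 ++ c with hc'
      set w' := (P.step g a).2.reverse ++ w with hw'
      refine .mono (.step (n := time n l.length c'.length w'.length) ?_) (time_add_one_le
        (by simp only [hc', List.length_append, List.length_cons]; omega)
        (by simp only [hw', List.length_append, List.length_reverse]; omega))
      simpa [machine, drainStmt, stepAux, contents, Lens.fst, update_contents_input, run,
        stepAux_pushListStmt, update_contents_store, update_contents_scratch, h₁, h₂, hc', hw']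
        using ih (some a, some g, v.2.2) c' w'

end Machine

theorem polyTimeVia {α β : Type} [Finite G] [Finite A] [Finite B] [Inhabited B]
    {ea : α → List A} {eb : β → List B} {f : α → β} (P : PushdownTransducer G A B)
    (h : ∀ a, eb (f a) = P.run [P.start] (ea a)) : PolyTimeVia ea eb f := by
  have : Inhabited G := ⟨P.start⟩
  obtain ⟨n₁, hn₁⟩ := (Set.finite_range fun x : G × A => (P.step x.1 x.2).1.length).bddAbove
  obtain ⟨n₂, hn₂⟩ := (Set.finite_range fun x : G × A => (P.step x.1 x.2).2.length).bddAbove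
  obtain ⟨n₃, hn₃⟩ := (Set.finite_range fun g => (P.final g).length).bddAbove
  set n := n₁ + n₂ + n₃
  have hstep : ∀ g a, (P.step g a).1.length ≤ n ∧ (P.step g a).2.length ≤ n := fun g a =>
    ⟨(hn₁ ⟨(g, a), rfl⟩).trans (by omega), (hn₂ ⟨(g, a), rfl⟩).trans (by omega)⟩
  have hfinal : ∀ g, (P.final g).length ≤ n := fun g => (hn₃ ⟨g, rfl⟩).trans (by omega)
  refine .of_machine (P.machine n) .input .output .init (none, none, none) (.refl A) (.refl B)
    (.X + (1 + n * .X + 1 + (n * (1 + n * .X) + (0 + n * .X) + 1) + 1) + 1) fun a => ?_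
  rw [h, Polynomial.eval_add, Polynomial.eval_one]
  refine .step ?_
  have hread := reachesIn_read hstep hfinal (none, none, none) (ea a) [P.start] []
  simpa [machine, stepAux, time, ← contents_nil, update_contents_input, update_contents_store,
    update_contents_output, contents] using hread

/-- The transducer that replaces each letter `a` by the word `w a` and appends the word `u`. -/
def flatMap {A B : Type} (w : A → List B) (u : List B) : PushdownTransducer Unit A B :=
  ⟨(), fun _ a => ([()], w a), fun _ => u⟩

theorem run_flatMap {A B : Type} (w : A → List B) (u : List B) (l : List A) :
    (flatMap w u).run [()] l = l.flatMap w ++ u := by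
  induction l with
  | nil => simp [run, flatMap]
  | cons a l ih => simpa [run, flatMap] using ih

end PushdownTransducer

theorem PolyTimeVia.of_flatMap {α β A B : Type} [Finite A] [Finite B] [Inhabited B]
    {ea : α → List A} {eb : β → List B} {f : α → β} (w : A → List B) (u : List B)
    (h : ∀ a, eb (f a) = (ea a).flatMap w ++ u) : PolyTimeVia ea eb f :=
  (PushdownTransducer.flatMap w u).polyTimeVia fun a =>
    (h a).trans (PushdownTransducer.run_flatMap w u _).symm

end StackMachine

open scoped BinaryTree

/-! ### Polynomial-time functions between types that are encoded by trees -/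

/-- The word of a binary tree in prefix notation, where `true` stands for a node. -/
def treeWord : BinaryTree Unit → List Bool
  | .nil => [false]
  | .node _ l r => true :: (treeWord l ++ treeWord r)

theorem treeWord_append_inj {s t : BinaryTree Unit} {u v : List Bool}
    (h : treeWord s ++ u = treeWord t ++ v) : s = t ∧ u = v := by
  induction s generalizing t u v with
  | nil =>
    cases t with
    | nil => simpa [treeWord] using h
    | node _ l r => simp [treeWord] at h
  | node _ l r ihl ihr =>
    cases t with
    | nil => simp [treeWord] at h
    | node _ l' r' =>
      simp only [treeWord, List.cons_append, List.append_assoc, List.cons.injEq, true_and] at h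
      obtain ⟨rfl, h₁⟩ := ihl h
      obtain ⟨rfl, h'⟩ := ihr h₁
      exact ⟨rfl, h'⟩

theorem treeWord_injective : Injective treeWord := fun s t h =>
  (treeWord_append_inj (u := []) (v := []) (by simpa using h)).1

/-- Encodings of the elements of a type by binary trees. Pairs are nodes and lists are right
combs, so that projections, pairing and case distinctions are simple operations on trees. -/
class Code (α : Type) where
  enc : α → BinaryTree Unit
  enc_injective : Injective enc

/-- The word that encodes an element of a type. -/
def code {α : Type} [Code α] (a : α) : List Bool := treeWord (Code.enc a)

theorem code_injective {α : Type} [Code α] : Injective (code : α → List Bool) :=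
  treeWord_injective.comp Code.enc_injective

/-- The length of the word that encodes an element of a type. -/
def size {α : Type} [Code α] (a : α) : ℕ := (code a).length

/-- Polynomial-time computability with respect to the encodings by trees. -/
@[fun_prop]
def IsPolyTime {α β : Type} [Code α] [Code β] (f : α → β) : Prop :=
  PolyTimeVia (code : α → _) (code : β → _) f

section Instances

variable {α β : Type} [Code α] [Code β]

instance : Code (BinaryTree Unit) := ⟨id, injective_id⟩

instance : Code Unit := ⟨fun _ => .nil, fun _ _ _ => rfl⟩

instance : Code Bool :=
  ⟨fun b => bif b then .nil △ .nil else .nil, fun a b h => by cases a <;> cases b <;> simp_all⟩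

instance : Code (α × β) :=
  ⟨fun p => Code.enc p.1 △ Code.enc p.2, fun p q h => by
    simp only [BinaryTree.node.injEq, true_and] at h
    exact Prod.ext (Code.enc_injective h.1) (Code.enc_injective h.2)⟩

/-- The right comb of the trees of the elements of a list. -/
def encodeList : List α → BinaryTree Unit
  | [] => .nil
  | a :: l => Code.enc a △ encodeList l

theorem encodeList_injective : Injective (encodeList : List α → BinaryTree Unit) := by
  intro l l' h
  induction l generalizing l' with
  | nil => cases l' <;> simp_all [encodeList]
  | cons a l ih =>
    cases l' with
    | nil => simp [encodeList] at h
    | cons a' l' =>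
      simp only [encodeList, BinaryTree.node.injEq, true_and] at h
      rw [Code.enc_injective h.1, ih h.2]

instance : Code (List α) := ⟨encodeList, encodeList_injective⟩

/-- Numbers are encoded in unary. -/
instance : Code ℕ :=
  ⟨fun n => encodeList (List.replicate n ()), fun m n h => by
    simpa using congrArg List.length (encodeList_injective h)⟩

instance : Code (Option α) :=
  ⟨fun o => encodeList o.toList, fun a b h => by
    have hlist := encodeList_injective h
    cases a <;> cases b <;> simp_all⟩

end Instances

section Size

variable {α β : Type} [Code α] [Code β]

@[simp] theorem code_pair (a : α) (b : β) : code (a, b) = true :: (code a ++ code b) := rfl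

@[simp] theorem code_nil : code ([] : List α) = [false] := rfl

@[simp] theorem code_cons (a : α) (l : List α) : code (a :: l) = true :: (code a ++ code l) := rfl

theorem code_bits (l : List Bool) : code l = l.flatMap (fun b => true :: code b) ++ [false] := by
  induction l with
  | nil => rfl
  | cons b l ih => simp [ih]

@[simp] theorem size_pair (a : α) (b : β) : size (a, b) = size a + size b + 1 := by
  simp [size]

@[simp] theorem size_nil : size ([] : List α) = 1 := rfl

@[simp] theorem size_cons (a : α) (l : List α) : size (a :: l) = size a + size l + 1 := by
  simp [size]

@[simp] theorem size_none : size (none : Option α) = 1 := rfl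

@[simp] theorem size_some (a : α) : size (some a) = size a + 2 := size_cons a []

@[simp] theorem size_nat (n : ℕ) : size n = 2 * n + 1 := by
  change size (List.replicate n ()) = 2 * n + 1
  induction n with
  | zero => rfl
  | succ n ih =>
    have hunit : size () = 1 := rfl
    rw [List.replicate_succ, size_cons, ih, hunit]
    ring

theorem size_pos (a : α) : 0 < size a := by
  unfold size code
  cases Code.enc a <;> simp [treeWord]

theorem size_bool_le (b : Bool) : size b ≤ 3 := by cases b <;> decide

theorem size_append (l l' : List α) : size (l ++ l') + 1 = size l + size l' := by
  induction l with
  | nil => simp [add_comm]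
  | cons a l ih =>
    simp only [List.cons_append, size_cons]
    omega

theorem size_lt_of_mem {a : α} {l : List α} (h : a ∈ l) : size a < size l := by
  induction h with
  | head l => simp only [size_cons]; omega
  | tail b _ ih => simp only [size_cons]; omega

theorem size_le_of_sublist {l l' : List α} (h : l.Sublist l') : size l ≤ size l' := by
  induction h with
  | slnil => exact le_rfl
  | cons a h ih => simp only [size_cons]; omega
  | cons_cons a h ih => simp only [size_cons]; omega

theorem length_lt_size (l : List α) : l.length < size l := by
  induction l with
  | nil => simp
  | cons a l ih => simp only [size_cons, List.length_cons]; omega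

theorem size_bits_le (l : List Bool) : size l ≤ 4 * l.length + 1 := by
  induction l with
  | nil => simp
  | cons b l ih =>
    have hb := size_bool_le b
    simp only [size_cons, List.length_cons]
    omega

end Size

namespace TreeTransducer

/-- Tasks for a transducer that reads the word of a tree: each one reads the word of one subtree,
and writes the word of its left subtree, its right subtree, the tree itself, and so on. -/
inductive Task
  | copy | skip | left | right | select | test
  deriving DecidableEq

instance : Fintype Task :=
  ⟨{.copy, .skip, .left, .right, .select, .test}, fun x => by cases x <;> simp⟩

/-- The tasks that replace a task when a letter is read, and the letters that are written. The task
`test` reads two trees, and writes the left subtree of the second one if the first one is a node,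
and the right subtree otherwise. -/
def step : Task → Bool → List Task × List Bool
  | .copy, true => ([.copy, .copy], [true])
  | .copy, false => ([], [false])
  | .skip, true => ([.skip, .skip], [])
  | .skip, false => ([], [])
  | .left, true => ([.copy, .skip], [])
  | .left, false => ([], [false])
  | .right, true => ([.skip, .copy], [])
  | .right, false => ([], [false])
  | .select, true => ([.test], [])
  | .select, false => ([], [false])
  | .test, true => ([.skip, .skip, .left], [])
  | .test, false => ([.right], [])

/-- The pushdown transducer that does a task. -/
def transducer (task : Task) : PushdownTransducer Task Bool Bool :=
  ⟨task, step, fun _ => []⟩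

variable (task : Task) (t : BinaryTree Unit) (c : List Task) (l : List Bool)

theorem run_cons (g : Task) (b : Bool) : (transducer task).run (g :: c) (b :: l) =
    (step g b).2 ++ (transducer task).run ((step g b).1 ++ c) l := rfl

theorem run_copy : (transducer task).run (.copy :: c) (treeWord t ++ l) =
    treeWord t ++ (transducer task).run c l := by
  induction t generalizing c l with
  | nil => rfl
  | node _ s t ihs iht => simp [treeWord, run_cons, step, ihs, iht]

theorem run_skip : (transducer task).run (.skip :: c) (treeWord t ++ l) =
    (transducer task).run c l := by
  induction t generalizing c l with
  | nil => rfl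
  | node _ s t ihs iht => simp [treeWord, run_cons, step, ihs, iht]

theorem run_left : (transducer task).run (.left :: c) (treeWord t ++ l) =
    treeWord t.left ++ (transducer task).run c l := by
  cases t with
  | nil => rfl
  | node _ s t => simp [treeWord, run_cons, step, run_copy, run_skip, BinaryTree.left]

theorem run_right : (transducer task).run (.right :: c) (treeWord t ++ l) =
    treeWord t.right ++ (transducer task).run c l := by
  cases t with
  | nil => rfl
  | node _ s t => simp [treeWord, run_cons, step, run_copy, run_skip, BinaryTree.right]

/-- Case distinction: `select (c △ (a △ b))` is `b` if `c` is empty, and `a` otherwise. -/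
def select : BinaryTree Unit → BinaryTree Unit
  | .nil => .nil
  | .node _ .nil t => t.right
  | .node _ (.node ..) t => t.left

theorem run_select : (transducer task).run (.select :: c) (treeWord t ++ l) =
    treeWord (select t) ++ (transducer task).run c l := by
  rcases t with _ | ⟨_, _ | ⟨_, _, _⟩, t⟩
  · rfl
  · simp [treeWord, run_cons, step, run_right, select]
  · simp [treeWord, run_cons, step, run_skip, run_left, select]

theorem isPolyTime {f : BinaryTree Unit → BinaryTree Unit}
    (h : ∀ t, (transducer task).run [task] (treeWord t ++ []) =
      treeWord (f t) ++ (transducer task).run [] []) : IsPolyTime f :=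
  (transducer task).polyTimeVia fun t => by
    have hrun : (transducer task).run [task] (treeWord t) = treeWord (f t) := by
      simpa only [PushdownTransducer.run_nil, List.append_nil] using h t
    exact hrun.symm

end TreeTransducer

theorem PolyTimeVia.congr {α α' β β' A B : Type} {ea : α → List A} {eb : β → List B}
    {ea' : α' → List A} {eb' : β' → List B} {f : α → β} {f' : α' → β'}
    (h : PolyTimeVia ea eb f) (i : α' → α) (hi : ∀ a, ea (i a) = ea' a)
    (hf : ∀ a, eb (f (i a)) = eb' (f' a)) : PolyTimeVia ea' eb' f' := by
  obtain ⟨M⟩ := h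
  refine ⟨⟨M.toTM2ComputableAux, M.time, fun a => ?_⟩⟩
  rw [← hi, ← hf]
  exact M.outputsFun (i a)

section Rules

variable {α β γ : Type} [Code α] [Code β] [Code γ]

@[fun_prop]
theorem IsPolyTime.id' : IsPolyTime fun a : α => a := ⟨Turing.idComputableInPolyTime code⟩

@[fun_prop]
theorem IsPolyTime.comp {g : β → γ} {f : α → β} (hg : IsPolyTime g) (hf : IsPolyTime f) :
    IsPolyTime fun a => g (f a) :=
  PolyTimeVia.comp hg hf

@[fun_prop]
theorem IsPolyTime.const (b : β) : IsPolyTime fun _ : α => b :=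
  .of_flatMap (fun _ => []) (code b) fun _ => by simp

@[fun_prop]
theorem IsPolyTime.prodMk {f : α → β} {g : α → γ} (hf : IsPolyTime f) (hg : IsPolyTime g) :
    IsPolyTime fun a => (f a, g a) :=
  PolyTimeVia.pair hf hg true fun _ => rfl

theorem IsPolyTime.of_tree {F : BinaryTree Unit → BinaryTree Unit} (hF : IsPolyTime F) {f : α → β}
    (h : ∀ a, F (Code.enc a) = Code.enc (f a)) : IsPolyTime f :=
  PolyTimeVia.congr hF Code.enc (fun _ => rfl) fun a => congrArg treeWord (h a)

theorem IsPolyTime.of_enc_eq {f : α → β} (h : ∀ a, Code.enc a = Code.enc (f a)) : IsPolyTime f :=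
  .of_tree .id' h

section TreeRules

variable {f g : α → BinaryTree Unit}

@[fun_prop]
theorem IsPolyTime.left (hf : IsPolyTime f) : IsPolyTime fun a => (f a).left :=
  (TreeTransducer.isPolyTime .left fun t => TreeTransducer.run_left _ t _ _).comp hf

@[fun_prop]
theorem IsPolyTime.right (hf : IsPolyTime f) : IsPolyTime fun a => (f a).right :=
  (TreeTransducer.isPolyTime .right fun t => TreeTransducer.run_right _ t _ _).comp hf

@[fun_prop]
theorem IsPolyTime.select (hf : IsPolyTime f) :
    IsPolyTime fun a => TreeTransducer.select (f a) :=
  (TreeTransducer.isPolyTime .select fun t => TreeTransducer.run_select _ t _ _).comp hf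

@[fun_prop]
theorem IsPolyTime.node (hf : IsPolyTime f) (hg : IsPolyTime g) :
    IsPolyTime fun a => f a △ g a :=
  (of_enc_eq (f := fun p : BinaryTree Unit × BinaryTree Unit => p.1 △ p.2)
    fun _ => rfl).comp (hf.prodMk hg)

end TreeRules

@[fun_prop]
theorem IsPolyTime.fst {f : α → β × γ} (hf : IsPolyTime f) : IsPolyTime fun a => (f a).1 :=
  (of_tree (f := Prod.fst) (left .id') fun _ => rfl).comp hf

@[fun_prop]
theorem IsPolyTime.snd {f : α → β × γ} (hf : IsPolyTime f) : IsPolyTime fun a => (f a).2 :=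
  (of_tree (f := Prod.snd) (right .id') fun _ => rfl).comp hf

@[fun_prop]
theorem IsPolyTime.cond {c : α → Bool} {f g : α → β} (hc : IsPolyTime c) (hf : IsPolyTime f)
    (hg : IsPolyTime g) : IsPolyTime fun a => bif c a then f a else g a :=
  (of_tree (f := fun p : Bool × β × β => bif p.1 then p.2.1 else p.2.2) (select .id')
    fun ⟨b, _, _⟩ => by cases b <;> rfl).comp (hc.prodMk (hf.prodMk hg))

@[fun_prop]
theorem IsPolyTime.ite {p : α → Prop} [DecidablePred p] {f g : α → β}
    (hp : IsPolyTime fun a => decide (p a)) (hf : IsPolyTime f) (hg : IsPolyTime g) :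
    IsPolyTime fun a => if p a then f a else g a := by
  simpa only [Bool.cond_decide] using hp.cond hf hg

section BoolRules

variable {f g : α → Bool}

@[fun_prop]
theorem IsPolyTime.and (hf : IsPolyTime f) (hg : IsPolyTime g) :
    IsPolyTime fun a => f a && g a := by
  simpa only [Bool.cond_false_right] using hf.cond hg (const false)

@[fun_prop]
theorem IsPolyTime.or (hf : IsPolyTime f) (hg : IsPolyTime g) :
    IsPolyTime fun a => f a || g a := by
  simpa only [Bool.cond_true_left] using hf.cond (const true) hg

@[fun_prop]
theorem IsPolyTime.not (hf : IsPolyTime f) : IsPolyTime fun a => !f a := by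
  simpa only [Bool.cond_true_right, Bool.or_false] using hf.cond (const false) (const true)

@[fun_prop]
theorem IsPolyTime.decide_and {p q : α → Prop} [DecidablePred p] [DecidablePred q]
    (hp : IsPolyTime fun a => decide (p a)) (hq : IsPolyTime fun a => decide (q a)) :
    IsPolyTime fun a => decide (p a ∧ q a) := by
  simpa only [Bool.decide_and] using hp.and hq

end BoolRules

@[fun_prop]
theorem IsPolyTime.cons {f : α → β} {g : α → List β} (hf : IsPolyTime f) (hg : IsPolyTime g) :
    IsPolyTime fun a => f a :: g a :=
  (of_enc_eq (f := fun p : β × List β => p.1 :: p.2) fun _ => rfl).comp (hf.prodMk hg)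

section ListRules

variable {f : α → List β}

@[fun_prop]
theorem IsPolyTime.tail (hf : IsPolyTime f) : IsPolyTime fun a => (f a).tail :=
  (of_tree (f := fun l : List β => l.tail) (right .id') fun l => by cases l <;> rfl).comp hf

@[fun_prop]
theorem IsPolyTime.headD {g : α → β} (hf : IsPolyTime f) (hg : IsPolyTime g) :
    IsPolyTime fun a => (f a).headD (g a) :=
  (of_tree (f := fun p : List β × β => p.1.headD p.2)
    (F := fun t => TreeTransducer.select (t.left △ (t.left.left △ t.right))) (by fun_prop)
    fun ⟨l, _⟩ => by cases l <;> rfl).comp (hf.prodMk hg)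

@[fun_prop]
theorem IsPolyTime.isEmpty (hf : IsPolyTime f) : IsPolyTime fun a => (f a).isEmpty :=
  (of_tree (f := fun l : List β => l.isEmpty)
    (F := fun t => TreeTransducer.select (t △ (.nil △ (.nil △ .nil)))) (by fun_prop)
    fun l => by cases l <;> rfl).comp hf

@[fun_prop]
theorem IsPolyTime.head? (hf : IsPolyTime f) : IsPolyTime fun a => (f a).head? :=
  (of_tree (f := fun l : List β => l.head?)
    (F := fun t => TreeTransducer.select (t △ ((t.left △ .nil) △ .nil))) (by fun_prop)
    fun l => by cases l <;> rfl).comp hf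

end ListRules

@[fun_prop]
theorem IsPolyTime.optionSome {f : α → β} (hf : IsPolyTime f) : IsPolyTime fun a => some (f a) :=
  (of_tree (f := fun b : β => some b) (F := fun t => t △ .nil) (by fun_prop) fun _ => rfl).comp hf

section OptionRules

variable {f : α → Option β}

@[fun_prop]
theorem IsPolyTime.toList (hf : IsPolyTime f) : IsPolyTime fun a => (f a).toList :=
  (of_enc_eq (f := fun o : Option β => o.toList) fun _ => rfl).comp hf

@[fun_prop]
theorem IsPolyTime.getD {g : α → β} (hf : IsPolyTime f) (hg : IsPolyTime g) :
    IsPolyTime fun a => (f a).getD (g a) := by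
  convert hf.toList.headD hg using 2 with a
  cases f a <;> rfl

@[fun_prop]
theorem IsPolyTime.isNone (hf : IsPolyTime f) : IsPolyTime fun a => (f a).isNone := by
  convert hf.toList.isEmpty using 2 with a
  cases f a <;> rfl

@[fun_prop]
theorem IsPolyTime.isSome (hf : IsPolyTime f) : IsPolyTime fun a => (f a).isSome := by
  simpa only [Option.not_isNone] using hf.isNone.not

end OptionRules

theorem IsPolyTime.exists_size_le {f : α → β} (hf : IsPolyTime f) :
    ∃ P : Polynomial ℕ, ∀ a, size (f a) ≤ P.eval (size a) :=
  PolyTimeVia.length_le hf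

end Rules

/-! ### Folds, lists and numbers in polynomial time -/

section Fold

variable {α ι τ : Type}

/-- One step of the loop that computes a fold: its state consists of the rest of the list, the
parameter, and the accumulated value. -/
def foldStep [Inhabited ι] (g : α → τ → ι → τ) (t : List ι × α × τ) : List ι × α × τ :=
  (t.1.tail, t.2.1, g t.2.1 t.2.2 (t.1.headD default))

theorem iterate_foldStep [Inhabited ι] (g : α → τ → ι → τ) (a : α) {n : ℕ} {l : List ι} (s : τ)
    (h : n ≤ l.length) :
    (foldStep g)^[n] (l, a, s) = (l.drop n, a, (l.take n).foldl (g a) s) := by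
  induction n generalizing l s with
  | zero => simp
  | succ _ ih =>
    cases l with
    | nil => simp at h
    | cons i l => exact ih (g a s i) (by simpa using h)

theorem size_foldl_le [Code τ] {g : τ → ι → τ} {m : ℕ} {l : List ι}
    (h : ∀ s, ∀ i ∈ l, size (g s i) ≤ size s + m) (s : τ) :
    size (l.foldl g s) ≤ size s + l.length * m := by
  induction l generalizing s with
  | nil => simp
  | cons i l ih =>
    have hhead := h s i (by simp)
    have htail := ih (fun s j hj => h s j (List.mem_cons_of_mem _ hj)) (g s i)
    rw [List.length_cons, Nat.succ_mul]
    exact htail.trans (by omega)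

variable [Code α] [Code ι] [Code τ]

section ListFold

variable [Inhabited ι] {l : α → List ι} {g : α → τ → ι → τ} {s₀ : α → τ}

theorem IsPolyTime.foldl_of_bound (hl : IsPolyTime l) (hs : IsPolyTime s₀)
    (hg : IsPolyTime fun p : α × τ × ι => g p.1 p.2.1 p.2.2) (Q : Polynomial ℕ)
    (hQ : ∀ a n, size (((l a).take n).foldl (g a) (s₀ a)) ≤ Q.eval (size a)) :
    IsPolyTime fun a => (l a).foldl (g a) (s₀ a) := by
  have hstep : IsPolyTime (foldStep g) := by
    unfold foldStep
    fun_prop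
  have hini : PolyTimeVia (code : α → _) (fun a => code (l a, a, s₀ a)) fun a => a :=
    PolyTimeVia.congr (by fun_prop : IsPolyTime fun a => (l a, a, s₀ a)) (fun a => a)
      (fun _ => rfl) fun _ => rfl
  have hiter (a : α) {n : ℕ} (hn : n ≤ (l a).length) := iterate_foldStep g a (s₀ a) hn
  have hsize (a : α) (n : ℕ) (hn : n ≤ (l a).length) :
      size ((foldStep g)^[n] (l a, a, s₀ a)) ≤
        (Polynomial.X + Polynomial.X + Q + 2).eval (size (l a, a, s₀ a)) := by
    have hfold := hQ a n
    have hdrop := size_le_of_sublist (List.drop_sublist n (l a))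
    have hmono := eval_mono Q (show size a ≤ size (l a, a, s₀ a) by simp only [size_pair]; omega)
    rw [hiter a hn]
    simp only [size_pair, Polynomial.eval_add, Polynomial.eval_X, Polynomial.eval_ofNat] at hmono ⊢
    omega
  have hlength (a : α) : (l a).length ≤
      (Polynomial.X + Polynomial.X + Q + 2).eval (size (l a, a, s₀ a)) := by
    have hlt := length_lt_size (l a)
    simp only [size_pair, Polynomial.eval_add, Polynomial.eval_X, Polynomial.eval_ofNat]
    omega
  have hloop := PolyTimeVia.loop (es := (code : List ι × α × τ → _)) hstep
    (fun t => !t.1.isEmpty)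
    (fun ⟨l, a, s⟩ => ⟨true, _, code_pair _ _, by cases l <;> simp⟩)
    (fun a => (l a, a, s₀ a)) (fun a => (l a).length)
    (fun a => by simp [hiter a le_rfl])
    (fun a n hn => by simpa [hiter a hn.le] using hn) _ hlength hsize
  have hfinal : IsPolyTime fun a => (([] : List ι), a, (l a).foldl (g a) (s₀ a)) :=
    (hloop.comp hini).congr (fun a => a) (fun _ => rfl) fun a => by
      rw [hiter a le_rfl, List.drop_length, List.take_length]
  exact hfinal.snd.snd

theorem IsPolyTime.foldl_of_invariant (hl : IsPolyTime l) (hs : IsPolyTime s₀)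
    (hg : IsPolyTime fun p : α × τ × ι => g p.1 p.2.1 p.2.2) (I : α → τ → Prop)
    (h₀ : ∀ a, I a (s₀ a)) (hI : ∀ a s, ∀ i ∈ l a, I a s → I a (g a s i)) (Q : Polynomial ℕ)
    (hQ : ∀ a s, I a s → size s ≤ Q.eval (size a)) :
    IsPolyTime fun a => (l a).foldl (g a) (s₀ a) :=
  foldl_of_bound hl hs hg Q fun a _ => hQ a _ <| List.foldlRecOn _ _ (h₀ a) fun s hs i hi =>
    hI a s i (List.mem_of_mem_take hi) hs

theorem IsPolyTime.foldl_of_growth (hl : IsPolyTime l) (hs : IsPolyTime s₀)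
    (hg : IsPolyTime fun p : α × τ × ι => g p.1 p.2.1 p.2.2) (G : Polynomial ℕ)
    (hG : ∀ a s, ∀ i ∈ l a, size (g a s i) ≤ size s + G.eval (size a)) :
    IsPolyTime fun a => (l a).foldl (g a) (s₀ a) := by
  obtain ⟨P, hP⟩ := hl.exists_size_le
  obtain ⟨P₀, hP₀⟩ := hs.exists_size_le
  refine foldl_of_bound hl hs hg (P₀ + P * G) fun a n => ?_
  refine (size_foldl_le (fun s i hi => hG a s i (List.mem_of_mem_take hi)) _).trans ?_
  have hlength : ((l a).take n).length ≤ P.eval (size a) :=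
    (List.length_take_le' n _).trans ((length_lt_size _).le.trans (hP a))
  rw [Polynomial.eval_add, Polynomial.eval_mul]
  gcongr
  exact hP₀ a

end ListFold

theorem IsPolyTime.replicate_unit {n : α → ℕ} (hn : IsPolyTime n) :
    IsPolyTime fun a => List.replicate (n a) () :=
  (of_enc_eq (f := fun n : ℕ => List.replicate n ()) fun _ => rfl).comp hn

section Iterate

variable {n : α → ℕ} {g : α → τ → τ} {s₀ : α → τ}

theorem IsPolyTime.iterate_of_growth (hn : IsPolyTime n) (hs : IsPolyTime s₀)
    (hg : IsPolyTime fun p : α × τ => g p.1 p.2) (G : Polynomial ℕ)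
    (hG : ∀ a s, size (g a s) ≤ size s + G.eval (size a)) :
    IsPolyTime fun a => (g a)^[n a] (s₀ a) := by
  simpa only [List.foldl_const, List.length_replicate] using foldl_of_growth hn.replicate_unit hs
    (g := fun a s _ => g a s) (by fun_prop) G fun a s _ _ => hG a s

theorem IsPolyTime.iterate_of_invariant (hn : IsPolyTime n) (hs : IsPolyTime s₀)
    (hg : IsPolyTime fun p : α × τ => g p.1 p.2) (I : α → τ → Prop) (h₀ : ∀ a, I a (s₀ a))
    (hI : ∀ a s, I a s → I a (g a s)) (Q : Polynomial ℕ)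
    (hQ : ∀ a s, I a s → size s ≤ Q.eval (size a)) :
    IsPolyTime fun a => (g a)^[n a] (s₀ a) := by
  simpa only [List.foldl_const, List.length_replicate] using foldl_of_invariant hn.replicate_unit hs
    (g := fun a s _ => g a s) (by fun_prop) I h₀ (fun a s _ _ => hI a s) Q hQ

end Iterate

end Fold

section NumberRules

variable {α : Type} [Code α] {f g : α → ℕ}

@[fun_prop]
theorem IsPolyTime.succ (hf : IsPolyTime f) : IsPolyTime fun a => f a + 1 :=
  PolyTimeVia.congr ((const ()).cons hf.replicate_unit) (fun a => a) (fun _ => rfl) fun _ => rfl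

@[fun_prop]
theorem IsPolyTime.pred (hf : IsPolyTime f) : IsPolyTime fun a => f a - 1 :=
  PolyTimeVia.congr hf.replicate_unit.tail (fun a => a) (fun _ => rfl) fun a => by
    rw [List.tail_replicate]
    rfl

@[fun_prop]
theorem IsPolyTime.add (hf : IsPolyTime f) (hg : IsPolyTime g) : IsPolyTime fun a => f a + g a := by
  simpa only [Nat.succ_iterate] using iterate_of_growth hg hf
    (g := fun _ => Nat.succ) (succ (by fun_prop)) 2 fun a s => by
      simp only [size_nat, Polynomial.eval_ofNat]
      omega

@[fun_prop]
theorem IsPolyTime.sub (hf : IsPolyTime f) (hg : IsPolyTime g) : IsPolyTime fun a => f a - g a := by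
  simpa only [Nat.pred_iterate] using iterate_of_growth hg hf
    (g := fun _ => Nat.pred) (pred (by fun_prop)) 0 fun a s => by simp

@[fun_prop]
theorem IsPolyTime.mul (hf : IsPolyTime f) (hg : IsPolyTime g) : IsPolyTime fun a => f a * g a := by
  have hmul : IsPolyTime fun p : ℕ × ℕ => (· + p.1)^[p.2] 0 :=
    iterate_of_growth (by fun_prop) (by fun_prop) (by fun_prop) .X fun ⟨m, n⟩ s => by
      simp only [size_pair, size_nat, Polynomial.eval_X]
      omega
  simpa [mul_comm] using hmul.comp (hf.prodMk hg)

theorem IsPolyTime.eval (P : Polynomial ℕ) (hf : IsPolyTime f) :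
    IsPolyTime fun a => P.eval (f a) := by
  induction P using Polynomial.induction_on' with
  | add p q hp hq => simpa only [Polynomial.eval_add] using hp.add hq
  | monomial n c =>
    have hpow : IsPolyTime fun a => f a ^ n := by
      induction n with
      | zero => simpa only [pow_zero] using const 1
      | succ n ih => simpa only [pow_succ] using ih.mul hf
    simpa only [Polynomial.eval_monomial] using (const c).mul hpow

@[fun_prop]
theorem IsPolyTime.decide_le (hf : IsPolyTime f) (hg : IsPolyTime g) :
    IsPolyTime fun a => decide (f a ≤ g a) := by
  convert (hf.sub hg).replicate_unit.isEmpty using 2 with a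
  rw [Bool.eq_iff_iff]
  simp [Nat.sub_eq_zero_iff_le]

@[fun_prop]
theorem IsPolyTime.decide_lt (hf : IsPolyTime f) (hg : IsPolyTime g) :
    IsPolyTime fun a => decide (f a < g a) :=
  hf.succ.decide_le hg

end NumberRules

section ListRules

variable {α ι κ : Type} [Code α] [Code ι] [Code κ]

section BasicRules

variable [Inhabited ι] {l l' : α → List ι}

@[fun_prop]
theorem IsPolyTime.reverse (hl : IsPolyTime l) : IsPolyTime fun a => (l a).reverse := by
  have hfold : IsPolyTime fun l : List ι => l.foldl (fun s i => i :: s) [] :=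
    foldl_of_growth .id' (by fun_prop) (by fun_prop) (.X + 1) fun l s i hi => by
      have hlt := size_lt_of_mem hi
      simp only [size_cons, Polynomial.eval_add, Polynomial.eval_X, Polynomial.eval_one]
      omega
  simpa using hfold.comp hl

@[fun_prop]
theorem IsPolyTime.append (hl : IsPolyTime l) (hl' : IsPolyTime l') :
    IsPolyTime fun a => l a ++ l' a := by
  obtain ⟨P, hP⟩ := hl.exists_size_le
  have hfold : IsPolyTime fun a => (l a).reverse.foldl (fun s i => i :: s) (l' a) :=
    foldl_of_growth hl.reverse hl' (by fun_prop) (P + 1) fun a s i hi => by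
      have hlt := size_lt_of_mem (List.mem_reverse.1 hi)
      have hle := hP a
      simp only [size_cons, Polynomial.eval_add, Polynomial.eval_one]
      omega
  simpa using hfold

@[fun_prop]
theorem IsPolyTime.length (hl : IsPolyTime l) : IsPolyTime fun a => (l a).length := by
  have hfold : IsPolyTime fun a => (l a).foldl (fun s _ => s + 1) 0 :=
    foldl_of_growth hl (by fun_prop) (by fun_prop) 2 fun a s i _ => by
      simp only [size_nat, Polynomial.eval_ofNat]
      omega
  simpa using hfold

end BasicRules

section MapRules

variable [Inhabited ι] {l : α → List ι}

theorem IsPolyTime.flatMap [Inhabited κ] {f : α → ι → List κ} (hl : IsPolyTime l)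
    (hf : IsPolyTime fun p : α × ι => f p.1 p.2) : IsPolyTime fun a => (l a).flatMap (f a) := by
  obtain ⟨P, hP⟩ := hl.exists_size_le
  obtain ⟨Q, hQ⟩ := hf.exists_size_le
  simp only [List.flatMap_eq_foldl]
  have hf' : IsPolyTime fun p : α × List κ × ι => f p.1 p.2.2 :=
    hf.comp (by fun_prop : IsPolyTime fun p : α × List κ × ι => (p.1, p.2.2))
  refine foldl_of_growth hl (const []) (append (.fst (.snd .id')) hf') (Q.comp (.X + P + 1))
    fun a s i hi => ?_
  have hpair : size (a, i) ≤ size a + P.eval (size a) + 1 := by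
    have hlt := size_lt_of_mem hi
    have hle := hP a
    rw [size_pair]
    omega
  have hsize : size (f a i) ≤ Q.eval (size a + P.eval (size a) + 1) :=
    (hQ (a, i)).trans (eval_mono Q hpair)
  have happend := size_append s (f a i)
  simp only [Polynomial.eval_comp, Polynomial.eval_add, Polynomial.eval_X, Polynomial.eval_one]
  omega

theorem IsPolyTime.map [Inhabited κ] {f : α → ι → κ} (hl : IsPolyTime l)
    (hf : IsPolyTime fun p : α × ι => f p.1 p.2) : IsPolyTime fun a => (l a).map (f a) := by
  simpa only [List.map_eq_flatMap] using hl.flatMap (f := fun a i => [f a i]) (by fun_prop)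

variable {p : α → ι → Bool}

theorem IsPolyTime.filter (hl : IsPolyTime l) (hp : IsPolyTime fun x : α × ι => p x.1 x.2) :
    IsPolyTime fun a => (l a).filter (p a) := by
  have hflat := hl.flatMap (f := fun a i => bif p a i then [i] else []) (by fun_prop)
  convert hflat using 2 with a
  induction l a with
  | nil => rfl
  | cons i _ ih => cases h : p a i <;> simp [h, ih]

theorem IsPolyTime.find? (hl : IsPolyTime l) (hp : IsPolyTime fun x : α × ι => p x.1 x.2) :
    IsPolyTime fun a => (l a).find? (p a) := by
  simpa only [List.head?_filter] using (hl.filter hp).head?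

end MapRules

@[fun_prop]
theorem IsPolyTime.drop {n : α → ℕ} {l : α → List ι} (hn : IsPolyTime n) (hl : IsPolyTime l) :
    IsPolyTime fun a => (l a).drop (n a) := by
  have htail : IsPolyTime fun a => List.tail^[n a] (l a) :=
    iterate_of_growth (g := fun _ => List.tail) hn hl (by fun_prop) 0 fun a s => by
      simpa using size_le_of_sublist (List.tail_sublist s)
  simpa only [List.tail_iterate] using htail

@[fun_prop]
theorem IsPolyTime.take [Inhabited ι] {n : α → ℕ} {l : α → List ι} (hn : IsPolyTime n)
    (hl : IsPolyTime l) : IsPolyTime fun a => (l a).take (n a) := by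
  have hdrop : IsPolyTime fun a => ((l a).reverse.drop ((l a).length - n a)).reverse := by fun_prop
  simpa only [List.reverse_drop, List.length_reverse, List.reverse_reverse,
    Nat.sub_sub_eq_min, min_comm, ← List.take_eq_take_min] using hdrop

@[fun_prop]
theorem IsPolyTime.replicate [Inhabited ι] {n : α → ℕ} {f : α → ι} (hn : IsPolyTime n)
    (hf : IsPolyTime f) : IsPolyTime fun a => List.replicate (n a) (f a) := by
  simpa only [List.map_replicate] using
    hn.replicate_unit.map (f := fun a _ => f a) (by fun_prop)

theorem iterate_append_length (k : ℕ) :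
    (fun s : List ℕ => s ++ [s.length])^[k] [] = List.range k := by
  induction k with
  | zero => rfl
  | succ k ih => rw [iterate_succ_apply', ih, List.length_range, List.range_succ]

theorem size_range_le {k m : ℕ} (h : m ≤ k) :
    size (List.range m) ≤ m * (2 * k + 2) + 1 := by
  induction m with
  | zero => simp
  | succ m ih =>
    have happend := size_append (List.range m) [m]
    have hle := ih (by omega)
    rw [List.range_succ, Nat.succ_mul]
    simp only [size_cons, size_nat, size_nil] at happend
    omega

@[fun_prop]
theorem IsPolyTime.range {n : α → ℕ} (hn : IsPolyTime n) :
    IsPolyTime fun a => List.range (n a) := by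
  have hrange : IsPolyTime fun k : ℕ => (fun s : List ℕ => s ++ [s.length])^[k] [] := by
    suffices hfold : IsPolyTime fun k =>
        (List.replicate k ()).foldl (fun (s : List ℕ) _ => s ++ [s.length]) [] by
      simpa only [List.foldl_const, List.length_replicate] using hfold
    refine foldl_of_bound (replicate_unit .id') (const []) (by fun_prop)
      (.X * (2 * .X + 2) + 1) fun k m => ?_
    rw [List.foldl_const, List.length_take, List.length_replicate, iterate_append_length]
    refine (size_range_le le_rfl).trans ?_
    have hmin : min m k ≤ size k := by
      rw [size_nat]
      omega
    simp only [Polynomial.eval_add, Polynomial.eval_mul, Polynomial.eval_X, Polynomial.eval_ofNat,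
      Polynomial.eval_one]
    gcongr
  simpa only [iterate_append_length] using hrange.comp hn

end ListRules

section DecidableEq

variable {α β : Type} [Code α] [Code β]

/-- One step of a comparison of words: the state consists of the answer so far and of the letters
that are not yet compared. -/
def matchStep (s : Bool × List Bool) (b : Bool) : Bool × List Bool :=
  (s.1 && !s.2.isEmpty && (bif b then s.2.headD false else !s.2.headD false), s.2.tail)

theorem foldl_matchStep (l l' : List Bool) (b : Bool) :
    ((l.foldl matchStep (b, l')).1 && (l.foldl matchStep (b, l')).2.isEmpty) =
      (b && l == l') := by
  induction l generalizing l' b with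
  | nil => cases l' <;> simp
  | cons i l ih =>
    rw [List.foldl_cons, matchStep, ih]
    cases l' with
    | nil => simp
    | cons j l' => cases b <;> cases i <;> cases j <;> simp

theorem IsPolyTime.decide_eq_bits {f g : α → List Bool} (hf : IsPolyTime f) (hg : IsPolyTime g) :
    IsPolyTime fun a => decide (f a = g a) := by
  have hfold : IsPolyTime fun a => (f a).foldl matchStep (true, g a) := by
    refine foldl_of_growth (g := fun _ => matchStep) hf (by fun_prop)
      (by unfold matchStep; fun_prop) 3 fun a s i _ => ?_
    have htail := size_le_of_sublist (List.tail_sublist s.2)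
    have hbool := size_bool_le (matchStep s i).1
    change size ((matchStep s i).1, s.2.tail) ≤ size (s.1, s.2) + _
    simp only [size_pair, Polynomial.eval_ofNat]
    omega
  simpa only [foldl_matchStep, Bool.true_and, beq_eq_decide] using hfold.fst.and hfold.snd.isEmpty

theorem IsPolyTime.codeWord {f : α → β} (hf : IsPolyTime f) : IsPolyTime fun a => code (f a) :=
  PolyTimeVia.comp (.of_flatMap (fun b => true :: code b) [false] fun b => code_bits (code b)) hf

@[fun_prop]
theorem IsPolyTime.decide_eq [DecidableEq β] {f g : α → β} (hf : IsPolyTime f)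
    (hg : IsPolyTime g) : IsPolyTime fun a => decide (f a = g a) := by
  simpa only [code_injective.eq_iff] using hf.codeWord.decide_eq_bits hg.codeWord

end DecidableEq

/-! ### Polynomial-time functions and algorithms on bit strings -/

theorem PolyTimeVia.encodeBits :
    PolyTimeVia (id : List Bool → List Bool) code fun l : List Bool => l :=
  .of_flatMap (fun b => true :: code b) [false] code_bits

/-- The store symbols of the transducer that translates the code of a pair of bit strings to the
marked word of the pair; `list s`, `bit s` stand for the rest of a component and for one of its
bits, where `s` is the component, and `skip` for a leaf that is ignored. -/
inductive DecodeSymbol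
  | pair | skip
  | list (s : Bool)
  | bit (s : Bool)
  deriving DecidableEq

namespace DecodeSymbol

instance : Fintype DecodeSymbol :=
  ⟨{.pair, .skip, .list false, .list true, .bit false, .bit true},
    fun x => by rcases x with _ | _ | (_ | _) | (_ | _) <;> simp⟩

/-- The letter for the bit `b` of the first component (`s = false`) or the second one. -/
def letter (s b : Bool) : Bool ⊕ Bool := bif s then .inr b else .inl b

/-- The transducer that translates the code of a pair of bit strings to the marked word of the
pair. -/
def transducer : PushdownTransducer DecodeSymbol Bool (Bool ⊕ Bool) where
  start := pair
  step
    | pair, _ => ([list false, list true], [])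
    | skip, _ => ([], [])
    | list s, b => (bif b then [bit s, list s] else [], [])
    | bit s, b => (bif b then [skip, skip] else [], [letter s b])
  final _ := []

theorem run_list (s : Bool) (l : List Bool) (c : List DecodeSymbol) (w : List Bool) :
    transducer.run (list s :: c) (code l ++ w) = l.map (letter s) ++ transducer.run c w := by
  induction l with
  | nil => rfl
  | cons b l ih => cases b <;> exact congrArg (letter s _ :: ·) ih

end DecodeSymbol

theorem PolyTimeVia.decodeTape : PolyTimeVia code withTape fun p : List Bool × List Bool => p :=
  DecodeSymbol.transducer.polyTimeVia fun p => by
    have hfst := DecodeSymbol.run_list false p.1 [.list true] (code p.2)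
    have hsnd := DecodeSymbol.run_list true p.2 [] []
    rw [PushdownTransducer.run_nil, List.append_nil, List.append_nil] at hsnd
    rw [hsnd] at hfst
    exact hfst.symm

theorem PolyTimeVia.encodeTape : PolyTimeVia withTape code fun p : List Bool × List Bool => p :=
  have hfst : PolyTimeVia withTape code fun p : List Bool × List Bool => p.1 :=
    .of_flatMap (Sum.elim (fun b => true :: code b) fun _ => []) [false] fun p => by
      simp [withTape, List.flatMap_map, code_bits]
  have hsnd : PolyTimeVia withTape code fun p : List Bool × List Bool => p.2 :=
    .of_flatMap (Sum.elim (fun _ => []) fun b => true :: code b) [false] fun p => by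
      simp [withTape, List.flatMap_map, code_bits]
  .pair hfst hsnd true fun _ => rfl

theorem PolyTimeVia.decodeBits :
    PolyTimeVia code (id : List Bool → List Bool) fun l : List Bool => l :=
  have hpair : IsPolyTime fun l : List Bool => (l, ([] : List Bool)) := by fun_prop
  have hfst : PolyTimeVia withTape id fun p : List Bool × List Bool => p.1 :=
    .of_flatMap (Sum.elim (fun b => [b]) fun _ => []) [] fun p => by
      simp [withTape, List.flatMap_map]
  .comp (g := Prod.fst) hfst (.comp .decodeTape hpair)

theorem PolyTime.isPolyTime {f : List Bool → List Bool} (hf : PolyTime f) : IsPolyTime f :=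
  PolyTimeVia.comp (g := fun l : List Bool => l) .encodeBits (.comp hf .decodeBits)

theorem IsPolyTime.polyTime {f : List Bool → List Bool} (hf : IsPolyTime f) : PolyTime f :=
  PolyTimeVia.comp (g := fun l : List Bool => l) .decodeBits (.comp hf .encodeBits)

theorem PPT.isPolyTime (A : PPT) : IsPolyTime A.run :=
  PolyTimeVia.comp (g := fun l : List Bool => l) .encodeBits (.comp A.polyTime .decodeTape)

/-- The probabilistic algorithm with the given number of coins whose run is a polynomial-time
function in the sense of `IsPolyTime`. -/
def PPT.ofIsPolyTime (coins : Polynomial ℕ) (run : List Bool × List Bool → List Bool)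
    (h : IsPolyTime run) : PPT :=
  ⟨coins, run, PolyTimeVia.comp (g := fun l : List Bool => l) .decodeBits (.comp h .encodeTape)⟩

/-! ### The universal machine -/

theorem foldl_takeWhile {ι : Type} (p : ι → Bool) (l acc : List ι) (b : Bool) :
    l.foldl (fun s i => bif s.1 && p i then (true, i :: s.2) else (false, s.2)) (b, acc) =
      (b && l.all p, bif b then (l.takeWhile p).reverse ++ acc else acc) := by
  induction l generalizing b acc with
  | nil => cases b <;> simp
  | cons i l ih =>
    rw [List.foldl_cons]
    cases b <;> cases h : p i <;> simp [h, ih]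

section OptionAndTakeWhile

variable {α β γ ι : Type} [Code α] [Code β] [Code γ] [Code ι]

theorem IsPolyTime.optionBind [Inhabited β] {f : α → Option β} {g : α → β → Option γ}
    (hf : IsPolyTime f) (hg : IsPolyTime fun p : α × β => g p.1 p.2) :
    IsPolyTime fun a => (f a).bind (g a) := by
  have hbind : IsPolyTime fun a => bif (f a).isSome then g a ((f a).getD default) else none :=
    cond hf.isSome (hg.comp (prodMk .id' (getD hf (const default)))) (const none)
  convert hbind using 2 with a
  cases f a <;> rfl

theorem IsPolyTime.optionMap [Inhabited β] {f : α → Option β} {g : α → β → γ}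
    (hf : IsPolyTime f) (hg : IsPolyTime fun p : α × β => g p.1 p.2) :
    IsPolyTime fun a => (f a).map (g a) := by
  simp only [Option.map_eq_bind]
  exact hf.optionBind hg.optionSome

theorem IsPolyTime.takeWhile [Inhabited ι] {p : α → ι → Bool} {l : α → List ι}
    (hl : IsPolyTime l) (hp : IsPolyTime fun x : α × ι => p x.1 x.2) :
    IsPolyTime fun a => (l a).takeWhile (p a) := by
  obtain ⟨P, hP⟩ := hl.exists_size_le
  have _ : IsPolyTime fun x : α × (Bool × List ι) × ι => p x.1 x.2.2 :=
    hp.comp (by fun_prop : IsPolyTime fun x : α × (Bool × List ι) × ι => (x.1, x.2.2))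
  have hfold : IsPolyTime fun a => (l a).foldl (fun (s : Bool × List ι) i =>
      bif s.1 && p a i then (true, i :: s.2) else (false, s.2)) (true, []) :=
    foldl_of_growth (g := fun a (s : Bool × List ι) i =>
        bif s.1 && p a i then (true, i :: s.2) else (false, s.2))
      hl (by fun_prop) (by fun_prop) (P + 4) fun a s i hi => by
        have hlt := size_lt_of_mem hi
        have hle := hP a
        have hpos := size_pos s.1
        have hs : size s = size s.1 + size s.2 + 1 := size_pair s.1 s.2
        have htrue := size_bool_le true
        have hfalse := size_bool_le false
        rw [Polynomial.eval_add, Polynomial.eval_ofNat]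
        cases s.1 && p a i <;>
          simp only [cond_true, cond_false, size_pair, size_cons] <;> omega
  simpa only [foldl_takeWhile, cond_true, List.append_nil, List.reverse_reverse] using
    hfold.snd.reverse

end OptionAndTakeWhile

theorem readUnary_eq (l : List Bool) : readUnary l =
    if (l.takeWhile fun b => b).length < l.length then
      some ((l.takeWhile fun b => b).length, l.drop ((l.takeWhile fun b => b).length + 1))
    else none := by
  induction l with
  | nil => rfl
  | cons b l ih =>
    cases b with
    | false => simp [readUnary]
    | true =>
      rw [readUnary, ih]
      by_cases h : (l.takeWhile fun b => b).length < l.length <;> simp [h]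

@[fun_prop]
theorem IsPolyTime.readUnary {α : Type} [Code α] {f : α → List Bool} (hf : IsPolyTime f) :
    IsPolyTime fun a => readUnary (f a) := by
  simp only [readUnary_eq]
  have _ : IsPolyTime fun a => (f a).takeWhile fun b => b :=
    hf.takeWhile (p := fun _ b => b) (by fun_prop)
  fun_prop

section RuleAndCfg

instance : Inhabited Rule := ⟨⟨0, 0, 0, 0, 0⟩⟩

instance : Code Rule :=
  ⟨fun r => Code.enc (r.q, r.a, r.q', r.b, r.dir), fun r r' h => by
    have := Code.enc_injective h
    cases r; cases r'
    simp_all⟩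

instance : Code Cfg :=
  ⟨fun c => Code.enc (c.state, c.left, c.head, c.right), fun c c' h => by
    have := Code.enc_injective h
    cases c; cases c'
    simp_all⟩

variable {α : Type} [Code α]

theorem IsPolyTime.ruleTuple {f : α → Rule} (hf : IsPolyTime f) :
    IsPolyTime fun a => ((f a).q, (f a).a, (f a).q', (f a).b, (f a).dir) :=
  comp (g := fun r : Rule => (r.q, r.a, r.q', r.b, r.dir)) (of_enc_eq fun _ => rfl) hf

@[fun_prop]
theorem IsPolyTime.rule_q {f : α → Rule} (hf : IsPolyTime f) : IsPolyTime fun a => (f a).q :=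
  hf.ruleTuple.fst

@[fun_prop]
theorem IsPolyTime.rule_a {f : α → Rule} (hf : IsPolyTime f) : IsPolyTime fun a => (f a).a :=
  hf.ruleTuple.snd.fst

@[fun_prop]
theorem IsPolyTime.rule_q' {f : α → Rule} (hf : IsPolyTime f) : IsPolyTime fun a => (f a).q' :=
  hf.ruleTuple.snd.snd.fst

@[fun_prop]
theorem IsPolyTime.rule_b {f : α → Rule} (hf : IsPolyTime f) : IsPolyTime fun a => (f a).b :=
  hf.ruleTuple.snd.snd.snd.fst

@[fun_prop]
theorem IsPolyTime.rule_dir {f : α → Rule} (hf : IsPolyTime f) : IsPolyTime fun a => (f a).dir :=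
  hf.ruleTuple.snd.snd.snd.snd

@[fun_prop]
theorem IsPolyTime.rule_mk {q a q' b d : α → ℕ} (hq : IsPolyTime q) (ha : IsPolyTime a)
    (hq' : IsPolyTime q') (hb : IsPolyTime b) (hd : IsPolyTime d) :
    IsPolyTime fun x => Rule.mk (q x) (a x) (q' x) (b x) (d x) :=
  comp (g := fun p : ℕ × ℕ × ℕ × ℕ × ℕ => Rule.mk p.1 p.2.1 p.2.2.1 p.2.2.2.1 p.2.2.2.2)
    (of_enc_eq fun _ => rfl) (prodMk hq (prodMk ha (prodMk hq' (prodMk hb hd))))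

theorem IsPolyTime.cfgTuple {f : α → Cfg} (hf : IsPolyTime f) :
    IsPolyTime fun a => ((f a).state, (f a).left, (f a).head, (f a).right) :=
  comp (g := fun c : Cfg => (c.state, c.left, c.head, c.right)) (of_enc_eq fun _ => rfl) hf

@[fun_prop]
theorem IsPolyTime.cfg_state {f : α → Cfg} (hf : IsPolyTime f) :
    IsPolyTime fun a => (f a).state :=
  hf.cfgTuple.fst

@[fun_prop]
theorem IsPolyTime.cfg_left {f : α → Cfg} (hf : IsPolyTime f) : IsPolyTime fun a => (f a).left :=
  hf.cfgTuple.snd.fst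

@[fun_prop]
theorem IsPolyTime.cfg_head {f : α → Cfg} (hf : IsPolyTime f) : IsPolyTime fun a => (f a).head :=
  hf.cfgTuple.snd.snd.fst

@[fun_prop]
theorem IsPolyTime.cfg_right {f : α → Cfg} (hf : IsPolyTime f) :
    IsPolyTime fun a => (f a).right :=
  hf.cfgTuple.snd.snd.snd

@[fun_prop]
theorem IsPolyTime.cfg_mk {q h : α → ℕ} {l r : α → List ℕ} (hq : IsPolyTime q) (hl : IsPolyTime l)
    (hh : IsPolyTime h) (hr : IsPolyTime r) :
    IsPolyTime fun a => Cfg.mk (q a) (l a) (h a) (r a) :=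
  comp (g := fun p : ℕ × List ℕ × ℕ × List ℕ => Cfg.mk p.1 p.2.1 p.2.2.1 p.2.2.2)
    (of_enc_eq fun _ => rfl) (prodMk hq (prodMk hl (prodMk hh hr)))

theorem size_rule (r : Rule) : size r = 2 * (r.q + r.a + r.q' + r.b + r.dir) + 9 := by
  change size (r.q, r.a, r.q', r.b, r.dir) = _
  simp only [size_pair, size_nat]
  omega

theorem size_cfg (c : Cfg) :
    size c = size c.left + size c.right + 2 * (c.state + c.head) + 5 := by
  change size (c.state, c.left, c.head, c.right) = _
  simp only [size_pair, size_nat]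
  omega

end RuleAndCfg

section Descriptions

variable {α : Type} [Code α]

theorem IsPolyTime.readRule {f : α → List Bool} (hf : IsPolyTime f) :
    IsPolyTime fun a => readRule (f a) := by
  refine comp (g := KOWF.readRule) ?_ hf
  unfold KOWF.readRule
  simp only [Option.bind_eq_bind, Option.pure_def]
  iterate 5 refine optionBind (readUnary (by fun_prop)) ?_
  fun_prop

theorem readUnary_length {l l' : List Bool} {k : ℕ} (h : readUnary l = some (k, l')) :
    k + 1 + l'.length = l.length := by
  rw [readUnary_eq, ite_eq_iff] at h
  simp only [Option.some.injEq, Prod.mk.injEq, reduceCtorEq, and_false, or_false] at h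
  obtain ⟨hlt, rfl, rfl⟩ := h
  rw [List.length_drop]
  omega

theorem readRule_length {l l' : List Bool} {r : Rule} (h : readRule l = some (r, l')) :
    size r + 1 + 2 * l'.length = 2 * l.length := by
  simp only [readRule, Option.bind_eq_bind, Option.bind_eq_some_iff] at h
  obtain ⟨⟨q, l₁⟩, hq, ⟨a, l₂⟩, ha, ⟨q', l₃⟩, hq', ⟨b, l₄⟩, hb, ⟨d, l₅⟩, hd, h⟩ := h
  simp only [Option.pure_def, Option.some.injEq, Prod.mk.injEq] at h
  obtain ⟨rfl, rfl⟩ := h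
  have hlq := readUnary_length hq
  have hla := readUnary_length ha
  have hlq' := readUnary_length hq'
  have hlb := readUnary_length hb
  have hld := readUnary_length hd
  rw [size_rule]
  simp only at hlq hla hlq' hlb hld ⊢
  omega

/-- Given the rules that have been read, in reverse order, and the rest of a description, read one
more rule. -/
def readMore (s : Option (Machine × List Bool)) : Option (Machine × List Bool) :=
  s.bind fun p => (readRule p.2).map fun x => (x.1 :: p.1, x.2)

theorem iterate_readMore (k : ℕ) (M : Machine) (l : List Bool) :
    readMore^[k] (some (M, l)) = (readRules k l).map fun p => (p.1.reverse ++ M, p.2) := by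
  induction k generalizing M l with
  | zero => rfl
  | succ k ih =>
    rw [iterate_succ_apply]
    simp only [readMore, readRules, Option.bind_some, Option.bind_eq_bind]
    rcases readRule l with _ | ⟨r, l'⟩
    · exact iterate_fixed rfl k
    · simp only [Option.map_some, Option.bind_some]
      rw [ih]
      rcases readRules k l' with _ | ⟨M', l''⟩ <;> simp

theorem size_add_length_readMore {m : ℕ} {s : Option (Machine × List Bool)}
    (hs : ∀ p, s = some p → size p.1 + 2 * p.2.length ≤ m) :
    ∀ p, readMore s = some p → size p.1 + 2 * p.2.length ≤ m := by
  rintro ⟨M, l⟩ hp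
  simp only [readMore, Option.bind_eq_some_iff, Option.map_eq_some_iff, Prod.mk.injEq] at hp
  obtain ⟨⟨M', l'⟩, rfl, ⟨r, l''⟩, h, rfl, rfl⟩ := hp
  have hle := hs _ rfl
  have hlength := readRule_length h
  simp only [size_cons] at hle hlength ⊢
  omega

theorem IsPolyTime.readRules {k : α → ℕ} {f : α → List Bool} (hk : IsPolyTime k)
    (hf : IsPolyTime f) : IsPolyTime fun a => readRules (k a) (f a) := by
  have hstep : IsPolyTime readMore :=
    optionBind .id' (optionMap (readRule (by fun_prop)) (by fun_prop))
  have hiter : IsPolyTime fun a => readMore^[k a] (some (([] : Machine), f a)) := by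
    obtain ⟨P, hP⟩ := hf.exists_size_le
    refine iterate_of_invariant (g := fun _ s => readMore s) hk (by fun_prop)
      (hstep.comp (.snd .id'))
      (fun a s => ∀ p, s = some p → size p.1 + 2 * p.2.length ≤ 1 + 2 * (f a).length)
      ?_ (fun a s => size_add_length_readMore) (6 * P + 4) ?_
    · rintro a p ⟨⟩
      simp
    · rintro a (_ | ⟨M, l⟩) hs
      · simp
      · have hle := hs _ rfl
        have hsize := hP a
        have hlength := length_lt_size (f a)
        have hbits := size_bits_le l
        simp only [size_some, size_pair, Polynomial.eval_add, Polynomial.eval_mul,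
          Polynomial.eval_ofNat] at hle ⊢
        omega
  convert hiter.optionMap (g := fun _ p => (p.1.reverse, p.2)) (by fun_prop) using 2 with a
  rw [iterate_readMore]
  rcases KOWF.readRules (k a) (f a) with _ | ⟨M, l⟩ <;> simp

theorem IsPolyTime.decodeDesc {f : α → List Bool} (hf : IsPolyTime f) :
    IsPolyTime fun a => decodeDesc (f a) :=
  optionBind (readUnary hf) (readRules (by fun_prop) (by fun_prop))

end Descriptions

section Simulation

theorem size_apply_le (c : Cfg) (r : Rule) : size (c.apply r) ≤ size c + size r := by
  have htail (l : List ℕ) : size l.tail + 2 * l.headD 0 ≤ size l := by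
    cases l <;> simp only [List.tail_nil, List.headD_nil, List.tail_cons, List.headD_cons,
      size_cons, size_nat] <;> omega
  have hleft := htail c.left
  have hright := htail c.right
  rw [size_rule, size_cfg c]
  unfold Cfg.apply
  split_ifs <;> rw [size_cfg] <;> simp only [size_cons, size_nat] <;> omega

theorem size_step_getD_le (M : Machine) (c : Cfg) :
    size ((step M c).getD c) ≤ size c + size M := by
  unfold step
  rcases h : M.find? _ with _ | r
  · rw [Option.map_none, Option.getD_none]
    omega
  · rw [Option.map_some, Option.getD_some]
    exact (size_apply_le c r).trans
      (Nat.add_le_add_left (size_lt_of_mem (List.mem_of_find?_eq_some h)).le _)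

theorem IsPolyTime.init : IsPolyTime Cfg.init := by
  have hsymbol : IsPolyTime bitSymbol := by
    unfold bitSymbol
    fun_prop
  have _ : IsPolyTime fun w : List Bool => w.map bitSymbol := map .id' (hsymbol.comp (.snd .id'))
  unfold Cfg.init
  fun_prop

theorem IsPolyTime.output : IsPolyTime Cfg.output := by
  unfold Cfg.output
  refine map (takeWhile (by fun_prop) ?_) (by fun_prop)
  simp only [Bool.decide_or]
  fun_prop

theorem IsPolyTime.step : IsPolyTime fun p : Machine × Cfg => step p.1 p.2 := by
  have happly : IsPolyTime fun p : Cfg × Rule => p.1.apply p.2 := by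
    unfold Cfg.apply
    fun_prop
  exact optionMap (find? (by fun_prop) (by fun_prop))
    (happly.comp (by fun_prop : IsPolyTime fun p : (Machine × Cfg) × Rule => (p.1.2, p.2)))

variable {α : Type} [Code α]

theorem IsPolyTime.runFor {M : α → Machine} {w : α → List Bool} {t : α → ℕ} (hM : IsPolyTime M)
    (hw : IsPolyTime w) (ht : IsPolyTime t) : IsPolyTime fun a => runFor (M a) (w a) (t a) := by
  obtain ⟨P, hP⟩ := hM.exists_size_le
  have hlast : IsPolyTime fun a =>
      (fun c => (KOWF.step (M a) c).getD c)^[t a] (Cfg.init (w a)) :=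
    iterate_of_growth (g := fun a c => (KOWF.step (M a) c).getD c) ht (init.comp hw)
      (getD (step.comp (by fun_prop : IsPolyTime fun p : α × Cfg => (M p.1, p.2))) (.snd .id')) P
      fun a c => (size_step_getD_le (M a) c).trans (Nat.add_le_add_left (hP a) _)
  have hrun := cond (isNone (step.comp (hM.prodMk hlast))) (optionSome (output.comp hlast))
    (const none)
  simpa only [KOWF.runFor, cond_eq_ite] using hrun

@[fun_prop]
theorem IsPolyTime.U {D : α → List Bool} {t : α → ℕ} (hD : IsPolyTime D) (ht : IsPolyTime t) :
    IsPolyTime fun a => U (D a) (t a) :=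
  optionBind (decodeDesc hD) (runFor (by fun_prop) (by fun_prop) (ht.comp (.fst .id')))

end Simulation

/-! ### Binary numbers, logarithms and integer-valued polynomials -/

/-- Add one to a binary number, least significant bit first. -/
def incr : List Bool → List Bool
  | [] => [true]
  | false :: l => true :: l
  | true :: l => false :: incr l

/-- The `k` bits of a number below `2 ^ k`, least significant first. -/
def bits (k i : ℕ) : List Bool := incr^[i] (List.replicate k false)

section Binary

theorem incr_eq (l : List Bool) : incr l = (l.takeWhile fun b => b).map (fun _ => false) ++
    true :: l.drop ((l.takeWhile fun b => b).length + 1) := by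
  induction l with
  | nil => rfl
  | cons b l ih =>
    cases b with
    | false => simp [incr]
    | true => simp [incr, ih]

theorem size_incr_le (l : List Bool) : size (incr l) ≤ size l + 4 := by
  induction l with
  | nil => decide
  | cons b l ih =>
    have hsize_true : size true = 3 := rfl
    have hsize_false : size false = 1 := rfl
    cases b <;> simp only [incr, size_cons] <;> omega

theorem encodePosNum_succ (n : PosNum) :
    Computability.encodePosNum n.succ = incr (Computability.encodePosNum n) := by
  induction n with
  | one => rfl
  | bit0 n _ => rfl
  | bit1 n ih => simp [PosNum.succ, Computability.encodePosNum, incr, ih]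

theorem encodeNat_eq (n : ℕ) : Computability.encodeNat n = incr^[n] [] := by
  induction n with
  | zero => rfl
  | succ n ih =>
    rw [iterate_succ_apply', ← ih, Computability.encodeNat, Computability.encodeNat, Nat.cast_succ,
      Num.add_one]
    cases (n : Num) with
    | zero => rfl
    | pos n => exact encodePosNum_succ n

theorem indexOf_incr (l : List Bool) : indexOf (incr l) = indexOf l + 1 := by
  unfold indexOf
  induction l with
  | nil => rfl
  | cons b l ih => cases b <;> simp [incr, Nat.ofDigits_cons] at ih ⊢ <;> omega

theorem length_incr {l : List Bool} (h : indexOf l < 2 ^ l.length) :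
    (incr l).length = l.length := by
  unfold indexOf at h
  induction l with
  | nil => simp at h
  | cons b l ih =>
    cases b with
    | false => rfl
    | true =>
      simp only [List.map_cons, Nat.ofDigits_cons, List.length_cons, pow_succ, Bool.toNat_true] at h
      rw [incr, List.length_cons, List.length_cons, ih (by omega)]

theorem bits_succ (k i : ℕ) : bits k (i + 1) = incr (bits k i) := iterate_succ_apply' ..

theorem indexOf_bits (k i : ℕ) : indexOf (bits k i) = i + 1 := by
  induction i with
  | zero => simp [bits, indexOf]
  | succ i ih => rw [bits_succ, indexOf_incr, ih]

theorem length_bits {k i : ℕ} (h : i < 2 ^ k) : (bits k i).length = k := by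
  induction i with
  | zero => simp [bits]
  | succ i ih =>
    have hlength := ih (by omega)
    rw [bits_succ, length_incr (by rwa [indexOf_bits, hlength]), hlength]

theorem foldl_min_ofDigits (m : ℕ) (l : List Bool) :
    l.reverse.foldl (fun s b => min m (2 * s + bif b then 1 else 0)) 0 =
      min m (Nat.ofDigits 2 (l.map Bool.toNat)) := by
  induction l with
  | nil => simp
  | cons b l ih =>
    rw [List.reverse_cons, List.foldl_append, ih, List.map_cons, Nat.ofDigits_cons]
    cases b <;> simp <;> omega

variable {α : Type} [Code α]

theorem IsPolyTime.iterate_incr {n : α → ℕ} {f : α → List Bool} (hn : IsPolyTime n)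
    (hf : IsPolyTime f) : IsPolyTime fun a => incr^[n a] (f a) := by
  refine iterate_of_growth (g := fun _ s => incr s) hn hf ?_ 4 fun a s => by
    simpa using size_incr_le s
  have htake : IsPolyTime fun p : α × List Bool => p.2.takeWhile fun b => b :=
    takeWhile (p := fun _ b => b) (by fun_prop) (by fun_prop)
  have _ : IsPolyTime fun p : α × List Bool => (p.2.takeWhile fun b => b).map fun _ => false :=
    htake.map (by fun_prop)
  simp only [incr_eq]
  fun_prop

theorem IsPolyTime.encodeNat {n : α → ℕ} (hn : IsPolyTime n) :
    IsPolyTime fun a => Computability.encodeNat (n a) := by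
  simpa only [encodeNat_eq] using hn.iterate_incr (const [])

@[fun_prop]
theorem IsPolyTime.bits {k i : α → ℕ} (hk : IsPolyTime k) (hi : IsPolyTime i) :
    IsPolyTime fun a => bits (k a) (i a) :=
  hi.iterate_incr (replicate hk (const false))

@[fun_prop]
theorem IsPolyTime.natMin {f g : α → ℕ} (hf : IsPolyTime f) (hg : IsPolyTime g) :
    IsPolyTime fun a => min (f a) (g a) := by
  simpa only [Nat.sub_sub_eq_min] using sub hf (sub hf hg)

theorem IsPolyTime.take_indexOf {ι : Type} [Code ι] [Inhabited ι] {l : α → List ι}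
    {f : α → List Bool} (hl : IsPolyTime l) (hf : IsPolyTime f) :
    IsPolyTime fun a => (l a).take (indexOf (f a)) := by
  -- The index may be exponentially large, so it is computed only up to the length of the list.
  have hmin : IsPolyTime fun p : ℕ × List Bool =>
      min p.1 (Nat.ofDigits 2 (p.2.map Bool.toNat)) := by
    simp only [← foldl_min_ofDigits]
    refine foldl_of_invariant (l := fun p : ℕ × List Bool => p.2.reverse)
      (g := fun p s b => min p.1 (2 * s + bif b then 1 else 0)) (by fun_prop) (by fun_prop)
      (by fun_prop) (fun p s => s ≤ p.1) (by simp) (by simp) .X fun p s hs => ?_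
    rw [Polynomial.eval_X, size_nat, size_pair, size_nat]
    omega
  convert take (succ (hmin.comp (hl.length.prodMk hf))) hl using 2 with a
  rw [List.take_eq_take_iff, indexOf]
  dsimp only
  omega

end Binary

section Clog

/-- One step of the computation of `⌈log₂ N⌉`: double the first component and count the step, until
the first component is at least `N`. -/
def clogStep (N : ℕ) (s : ℕ × ℕ) : ℕ × ℕ := bif decide (s.1 < N) then (2 * s.1, s.2 + 1) else s

theorem iterate_clogStep (N k : ℕ) :
    (clogStep N)^[k] (1, 0) = (2 ^ min k (Nat.clog 2 N), min k (Nat.clog 2 N)) := by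
  induction k with
  | zero => simp
  | succ k ih =>
    rw [iterate_succ_apply', ih, clogStep]
    rcases lt_or_ge k (Nat.clog 2 N) with h | h
    · have hlt := (Nat.lt_clog_iff_pow_lt one_lt_two).1 h
      simp [min_eq_left h.le, min_eq_left (Nat.succ_le_of_lt h), hlt, pow_succ, mul_comm]
    · have hnot : ¬2 ^ Nat.clog 2 N < N := (Nat.le_pow_clog one_lt_two N).not_gt
      rw [min_eq_right h, min_eq_right (Nat.le_succ_of_le h), decide_eq_false hnot, cond_false]

theorem IsPolyTime.clog {α : Type} [Code α] {n : α → ℕ} (hn : IsPolyTime n) :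
    IsPolyTime fun a => Nat.clog 2 (n a) := by
  have hiter : IsPolyTime fun N : ℕ => (clogStep N)^[N] (1, 0) := by
    refine iterate_of_invariant (g := clogStep) .id' (const (1, 0)) (by unfold clogStep; fun_prop)
      (fun N s => s.2 < s.1 ∧ s.1 ≤ 2 * N + 1) (by simp) ?_ (4 * .X + 4) ?_
    · rintro N s ⟨hlt, hle⟩
      unfold clogStep
      by_cases h : s.1 < N <;> simp only [h, decide_true, decide_false, cond_true, cond_false] <;>
        omega
    · rintro N ⟨i, j⟩ ⟨hlt, hle⟩
      simp only [size_pair, size_nat, Polynomial.eval_add, Polynomial.eval_mul, Polynomial.eval_X,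
        Polynomial.eval_ofNat] at hlt hle ⊢
      omega
  convert snd (hiter.comp hn) using 2 with a
  rw [iterate_clogStep, min_eq_right (Nat.clog_le_of_le_pow Nat.lt_two_pow_self.le)]

end Clog

section IntegerValued

theorem IsPolyTime.sum {α : Type} [Code α] {n : α → ℕ} {f : α → ℕ → ℕ} (hn : IsPolyTime n)
    (hf : IsPolyTime fun p : α × ℕ => f p.1 p.2) :
    IsPolyTime fun a => ∑ j ∈ Finset.range (n a), f a j := by
  have hflat : IsPolyTime fun a =>
      ((List.range (n a)).flatMap fun j => List.replicate (f a j) ()).length :=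
    length (flatMap (by fun_prop) (replicate_unit hf))
  convert hflat using 2 with a
  simp only [List.length_flatMap, List.length_replicate]
  rfl

open fwdDiff

theorem exists_isPolyTime_sub_of_fwdDiff_iter_eq_zero {d : ℕ} {u : ℕ → ℤ}
    (h : (Δ_[1])^[d] u = 0) :
    ∃ a b : ℕ → ℕ, IsPolyTime a ∧ IsPolyTime b ∧ ∀ n, u n = a n - b n := by
  induction d generalizing u with
  | zero => exact ⟨fun _ => 0, fun _ => 0, .const 0, .const 0, fun n => by simpa using congrFun h n⟩
  | succ d ih =>
    obtain ⟨a, b, ha, hb, hab⟩ := ih (u := Δ_[1] u) h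
    refine ⟨fun n => (u 0).toNat + ∑ j ∈ Finset.range n, a j,
      fun n => (-u 0).toNat + ∑ j ∈ Finset.range n, b j,
      .add (.const _) (.sum .id' (ha.comp (.snd .id'))),
      .add (.const _) (.sum .id' (hb.comp (.snd .id'))), fun n => ?_⟩
    induction n with
    | zero => simp
    | succ n ih' =>
      have hdiff := hab n
      rw [fwdDiff] at hdiff
      simp only [Finset.sum_range_succ]
      push_cast at ih' ⊢
      omega

theorem fwdDiff_iter_eq_zero_of_eq_eval {u : ℕ → ℤ} {P : Polynomial ℝ}
    (h : ∀ n : ℕ, (u n : ℝ) = P.eval (n : ℝ)) : (Δ_[1])^[P.natDegree + 1] u = 0 := by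
  funext n
  have hP := congrFun (Polynomial.fwdDiff_iter_degree_add_one_eq_zero P) n
  rw [fwdDiff_iter_eq_sum_shift] at hP ⊢
  rw [← Int.cast_inj (α := ℝ)]
  simpa [h] using hP

theorem isPolyTime_of_eq_eval {t : ℕ → ℕ} {T : Polynomial ℝ}
    (hT : ∀ n : ℕ, 1 ≤ n → (t n : ℝ) = T.eval (n : ℝ)) : IsPolyTime t := by
  obtain ⟨a, b, ha, hb, hab⟩ := exists_isPolyTime_sub_of_fwdDiff_iter_eq_zero <|
    fwdDiff_iter_eq_zero_of_eq_eval (u := fun n => t (n + 1)) (P := T.comp (.X + 1)) fun n => by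
      simpa using hT (n + 1) (by omega)
  have hite : IsPolyTime fun n : ℕ => if n ≤ 0 then t 0 else a (n - 1) - b (n - 1) :=
    .ite (by fun_prop) (by fun_prop) (.sub (ha.comp (by fun_prop)) (hb.comp (by fun_prop)))
  convert hite using 2 with n
  cases n with
  | zero => rfl
  | succ n =>
    have hn := hab n
    rw [if_neg (Nat.not_succ_le_zero n), Nat.add_sub_cancel]
    omega

end IntegerValued

/-! ### The candidate functions -/

section Candidate

variable {α : Type} [Code α]

@[fun_prop]
theorem IsPolyTime.unary {n : α → ℕ} (hn : IsPolyTime n) : IsPolyTime fun a => unary (n a) :=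
  append (replicate hn (const true)) (const [false])

@[fun_prop]
theorem IsPolyTime.withSecurity {n : α → ℕ} {y : α → List Bool} (hn : IsPolyTime n)
    (hy : IsPolyTime y) : IsPolyTime fun a => withSecurity (n a) (y a) :=
  append (unary hn) hy

theorem IsPolyTime.ktLength {c : ℕ} {n : α → ℕ} (hn : IsPolyTime n) :
    IsPolyTime fun a => ktLength c (n a) :=
  have hadd := add hn (const c)
  add (clog hadd) hadd

theorem IsPolyTime.ktFun {t : ℕ → ℕ} (ht : IsPolyTime t) {c : ℕ} {n : α → ℕ} {x : α → List Bool}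
    (hn : IsPolyTime n) (hx : IsPolyTime x) : IsPolyTime fun a => ktFun t c (n a) (x a) := by
  have hlog := clog (add hn (const c))
  have htake := take hlog hx
  exact append htake (getD (U (take_indexOf (drop hlog hx) htake) (ht.comp hn)) (const []))

end Candidate

/-! ### Averages and frequencies over bit strings -/

section Average

open Finset

variable {n a b : ℕ} {g h : List Bool → ℝ}

theorem avg_congr (hgh : ∀ x, x.length = n → g x = h x) : avg n g = avg n h := by
  unfold avg
  congr 1
  exact sum_congr rfl fun x _ => hgh _ List.length_ofFn

theorem avg_mono (hgh : ∀ x, x.length = n → g x ≤ h x) : avg n g ≤ avg n h := by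
  unfold avg
  gcongr with x
  exact hgh _ List.length_ofFn

theorem avg_const (n : ℕ) (r : ℝ) : avg n (fun _ => r) = r := by
  simp [avg]

theorem avg_add (n : ℕ) (g h : List Bool → ℝ) :
    avg n (fun x => g x + h x) = avg n g + avg n h := by
  simp [avg, sum_add_distrib, add_div]

theorem avg_sub (n : ℕ) (g h : List Bool → ℝ) :
    avg n (fun x => g x - h x) = avg n g - avg n h := by
  simp [avg, sum_sub_distrib, sub_div]

theorem avg_mul_left (n : ℕ) (r : ℝ) (g : List Bool → ℝ) :
    avg n (fun x => r * g x) = r * avg n g := by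
  simp [avg, ← mul_sum, mul_div_assoc]

theorem avg_sum {ι : Type*} (s : Finset ι) (n : ℕ) (g : ι → List Bool → ℝ) :
    avg n (fun x => ∑ i ∈ s, g i x) = ∑ i ∈ s, avg n (g i) := by
  simp only [avg, sum_div]
  exact sum_comm

theorem avg_nonneg (hg : ∀ x, x.length = n → 0 ≤ g x) : 0 ≤ avg n g :=
  (avg_const n 0).symm.le.trans (avg_mono hg)

theorem avg_le_of_forall_le {r : ℝ} (hg : ∀ x, x.length = n → g x ≤ r) : avg n g ≤ r :=
  (avg_mono hg).trans (avg_const n r).le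

theorem avg_comm (a b : ℕ) (g : List Bool → List Bool → ℝ) :
    avg a (fun x => avg b (fun y => g x y)) = avg b (fun y => avg a (fun x => g x y)) := by
  simp only [avg, sum_div]
  rw [sum_comm]
  exact sum_congr rfl fun x _ => sum_congr rfl fun y _ => div_right_comm ..

theorem avg_append (a b : ℕ) (g : List Bool → ℝ) :
    avg (a + b) g = avg a fun x => avg b fun y => g (x ++ y) := by
  unfold avg
  rw [← (Fin.appendEquiv a b).sum_comp, Fintype.sum_prod_type, pow_add, ← sum_div, div_div,
    mul_comm (2 ^ a : ℝ)]
  congr 1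
  refine sum_congr rfl fun x _ => sum_congr rfl fun y _ => ?_
  simp [Fin.appendEquiv, List.ofFn_fin_append]

theorem avg_take (hle : a ≤ n) (g : List Bool → ℝ) : avg n (fun x => g (x.take a)) = avg a g := by
  obtain ⟨b, rfl⟩ := Nat.exists_eq_add_of_le hle
  rw [avg_append]
  refine avg_congr fun x hx => ?_
  rw [avg_congr (h := fun _ => g x) fun y _ => by rw [← hx, List.take_left], avg_const]

theorem avg_le_of_injOn (φ : List Bool → List Bool) (hφ : ∀ x, x.length = a → (φ x).length = b)
    (hinj : Set.InjOn φ {x | x.length = a}) (hgh : ∀ x, x.length = a → g x ≤ h (φ x))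
    (hh : ∀ x, 0 ≤ h x) : 2 ^ a * avg a g ≤ 2 ^ b * avg b h := by
  unfold avg
  rw [mul_div_cancel₀ _ (by positivity), mul_div_cancel₀ _ (by positivity)]
  let ψ : (Fin a → Bool) → (Fin b → Bool) := fun x i => (φ (List.ofFn x)).getD i false
  have hofFn (x : Fin a → Bool) : List.ofFn (ψ x) = φ (List.ofFn x) := by
    have hlength := hφ _ (List.length_ofFn (f := x))
    refine List.ext_getElem (by simp [hlength]) fun i _ hi => ?_
    simp [ψ, List.getElem?_eq_getElem hi]
  have hψ : Function.Injective ψ := fun x y hxy => by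
    refine List.ofFn_injective (hinj List.length_ofFn List.length_ofFn ?_)
    rw [← hofFn x, ← hofFn y, hxy]
  calc ∑ x, g (List.ofFn x) ≤ ∑ x, h (List.ofFn (ψ x)) :=
        sum_le_sum fun x _ => (hgh _ List.length_ofFn).trans (by rw [hofFn])
    _ = ∑ y ∈ univ.map ⟨ψ, hψ⟩, h (List.ofFn y) := by rw [sum_map]; rfl
    _ ≤ _ := sum_le_sum_of_subset_of_nonneg (subset_univ _) fun _ _ _ => hh _

end Average

section Frequency

open Classical in
/-- The fraction of the strings of length `n` that satisfy `P`. -/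
noncomputable def freq (n : ℕ) (P : List Bool → Prop) : ℝ := avg n fun x => if P x then 1 else 0

variable {n a : ℕ} {P Q : List Bool → Prop}

theorem freq_nonneg (n : ℕ) (P : List Bool → Prop) : 0 ≤ freq n P :=
  avg_nonneg fun _ _ => by split_ifs <;> norm_num

theorem freq_le_one (n : ℕ) (P : List Bool → Prop) : freq n P ≤ 1 :=
  avg_le_of_forall_le fun _ _ => by split_ifs <;> norm_num

theorem freq_mono (hPQ : ∀ x, x.length = n → P x → Q x) : freq n P ≤ freq n Q :=
  avg_mono fun x hx => by
    by_cases hP : P x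
    · simp only [if_pos hP, if_pos (hPQ x hx hP), le_refl]
    · split_ifs <;> norm_num

theorem freq_not (n : ℕ) (P : List Bool → Prop) : freq n (fun x => ¬P x) = 1 - freq n P := by
  rw [freq, freq, ← avg_const n 1, ← avg_sub, avg_const]
  exact avg_congr fun x _ => by split_ifs <;> norm_num

theorem freq_take (hle : a ≤ n) (P : List Bool → Prop) :
    freq n (fun x => P (x.take a)) = freq a P := by
  classical exact avg_take hle fun x => if P x then 1 else 0

theorem freq_append (a b : ℕ) (P : List Bool → Prop) :
    freq (a + b) P = avg a fun x => freq b fun y => P (x ++ y) := avg_append a b _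

theorem PPT.prob_eq_freq (A : PPT) (x : List Bool) (S : Set (List Bool)) :
    A.prob x S = freq (A.coins.eval x.length) fun R => A.run (x, R) ∈ S := rfl

theorem PPT.prob_nonneg (A : PPT) (x : List Bool) (S : Set (List Bool)) : 0 ≤ A.prob x S :=
  freq_nonneg _ _

theorem PPT.prob_le_one (A : PPT) (x : List Bool) (S : Set (List Bool)) : A.prob x S ≤ 1 :=
  freq_le_one _ _

theorem PPT.prob_le_prob {A B : PPT} {x y : List Bool} {S S' : Set (List Bool)}
    (hcoins : B.coins.eval y.length ≤ A.coins.eval x.length)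
    (hrun : ∀ R : List Bool, B.run (y, R.take (B.coins.eval y.length)) ∈ S → A.run (x, R) ∈ S') :
    B.prob y S ≤ A.prob x S' := by
  rw [prob_eq_freq, prob_eq_freq, ← freq_take hcoins]
  exact freq_mono fun R _ => hrun R

end Frequency

/-! ### Challenges with a security parameter -/

section Challenge

/-- The security parameter `m` of an input `(1^m, y)`. -/
def security (w : List Bool) : ℕ := ((readUnary w).getD (0, [])).1

/-- The challenge `y` of an input `(1^m, y)`. -/
def challenge (w : List Bool) : List Bool := ((readUnary w).getD (0, [])).2

@[simp]
theorem security_withSecurity (m : ℕ) (y : List Bool) : security (withSecurity m y) = m := by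
  rw [security, withSecurity, readUnary_unary, Option.getD_some]

@[simp]
theorem challenge_withSecurity (m : ℕ) (y : List Bool) : challenge (withSecurity m y) = y := by
  rw [challenge, withSecurity, readUnary_unary, Option.getD_some]

@[simp]
theorem length_withSecurity (m : ℕ) (y : List Bool) :
    (withSecurity m y).length = m + 1 + y.length := by
  simp [withSecurity, unary, add_assoc, add_comm 1]

variable {α : Type} [Code α] {w : α → List Bool}

@[fun_prop]
theorem IsPolyTime.security (hw : IsPolyTime w) : IsPolyTime fun a => security (w a) :=
  fst (getD (readUnary hw) (const _))

@[fun_prop]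
theorem IsPolyTime.challenge (hw : IsPolyTime w) : IsPolyTime fun a => challenge (w a) :=
  snd (getD (readUnary hw) (const _))

/-- The probability that `A`, given `(1^m, f(x))` for a uniform string `x` of length `m`, finds a
preimage of `f(x)` of length `m`, as in the definition of `IsWeakOWFFamily`. -/
noncomputable def invProbOn (m : ℕ) (f : List Bool → List Bool) (A : PPT) : ℝ :=
  avg m fun x => A.prob (withSecurity m (f x)) {x' | x'.length = m ∧ f x' = f x}

theorem invProbOn_le_one (m : ℕ) (f : List Bool → List Bool) (A : PPT) : invProbOn m f A ≤ 1 :=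
  avg_le_of_forall_le fun _ _ => A.prob_le_one _ _

theorem invProbOn_congr {m : ℕ} {f g : List Bool → List Bool} (A : PPT)
    (hfg : ∀ x, x.length = m → f x = g x) : invProbOn m f A = invProbOn m g A :=
  avg_congr fun x hx => by
    rw [hfg x hx]
    congr 1
    ext x'
    exact and_congr_right fun hx' => by rw [hfg x' hx']

end Challenge

/-! ### The candidate family is weakly one-way -/

section Descriptions

theorem exists_description (t : ℕ → ℕ) (x : List Bool) :
    ∃ D : List Bool, D.length = Kt t x ∧ U D (t x.length) = some x :=
  Nat.sInf_mem (s := {k | ∃ D : List Bool, D.length = k ∧ U D (t x.length) = some x})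
    ⟨_, false :: x, rfl, U_false_cons x _⟩

theorem Kt_le_length {t : ℕ → ℕ} {D x : List Bool} (hD : U D (t x.length) = some x) :
    Kt t x ≤ D.length :=
  Nat.sInf_le ⟨D, rfl, hD⟩

theorem Kt_pos (t : ℕ → ℕ) (x : List Bool) : 0 < Kt t x := by
  obtain ⟨_ | ⟨b, D⟩, hlength, hD⟩ := exists_description t x
  · cases hD
  · simp [← hlength]

end Descriptions

section Search

/-- The value `ℓ‖x` of the candidate function, where `ℓ` stands for the number `i + 1`. -/
def labelled (c i : ℕ) (x : List Bool) : List Bool := bits (Nat.clog 2 (x.length + c)) i ++ x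

variable {t : ℕ → ℕ} {c : ℕ}

theorem length_bits_clog {n i : ℕ} (hi : i < n) : (bits (Nat.clog 2 n) i).length = Nat.clog 2 n :=
  length_bits (hi.trans_le (Nat.le_pow_clog one_lt_two n))

theorem eq_of_labelled_eq {i j : ℕ} {x y : List Bool} (hlength : x.length = y.length)
    (h : labelled c i x = labelled c j y) : x = y :=
  List.append_inj_right' h hlength

theorem Kt_le_of_ktFun_eq {x z : List Bool} {i : ℕ} (hx : x ≠ []) (hi : i < x.length + c)
    (hz : z.length = ktLength c x.length) (h : ktFun t c x.length z = labelled c i x) :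
    Kt t x ≤ i + 1 := by
  obtain ⟨hlabel, hout⟩ := List.append_inj h <| by
    rw [length_bits_clog hi, List.length_take, hz, ktLength]
    omega
  rw [hlabel, indexOf_bits] at hout
  rcases hU : U ((z.drop (Nat.clog 2 (x.length + c))).take (i + 1)) (t x.length) with _ | x'
  · rw [hU] at hout
    exact absurd hout.symm hx
  · rw [hU, Option.getD_some] at hout
    subst hout
    exact (Kt_le_length hU).trans (List.length_take_le _ _)

theorem exists_ktFun_eq_labelled {x : List Bool} (hc : Kt t x ≤ x.length + c) :
    ∃ z : List Bool, z.length = ktLength c x.length ∧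
      ktFun t c x.length z = labelled c (Kt t x - 1) x := by
  obtain ⟨D, hD, hU⟩ := exists_description t x
  have hpos := Kt_pos t x
  have hlength := length_bits_clog (show Kt t x - 1 < x.length + c by omega)
  refine ⟨bits (Nat.clog 2 (x.length + c)) (Kt t x - 1) ++
    (D ++ List.replicate (x.length + c - Kt t x) false), ?_, ?_⟩
  · rw [List.length_append, List.length_append, hlength, hD, List.length_replicate, ktLength]
    omega
  · simp only [ktFun, labelled, List.take_left' hlength, List.drop_left' hlength, indexOf_bits]
    rw [show Kt t x - 1 + 1 = D.length by omega, List.take_left, hU, Option.getD_some]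

variable (A : PPT) (t c)

/-- The answer of `A`, with random tape `R`, to `1^m` and `ℓ‖x`, where `ℓ` stands for `i + 1`. -/
def candidate (x R : List Bool) (i : ℕ) : List Bool :=
  let w := withSecurity (ktLength c x.length) (labelled c i x)
  A.run (w, R.take (A.coins.eval w.length))

/-- The least `i < |x| + c` for which the answer of `A` is correct, and `0` if there is none. -/
def searchIndex (x R : List Bool) : ℕ :=
  ((List.range (x.length + c)).find? fun i =>
    decide ((candidate c A x R i).length = ktLength c x.length ∧
      ktFun t c x.length (candidate c A x R i) = labelled c i x)).getD 0

variable {t c A}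

theorem searchIndex_eq {x R : List Bool} {i : ℕ} (hx : x ≠ []) (hi : i < x.length + c)
    (hiK : Kt t x = i + 1) (hz : (candidate c A x R i).length = ktLength c x.length)
    (h : ktFun t c x.length (candidate c A x R i) = labelled c i x) :
    searchIndex t c A x R = i := by
  rw [searchIndex, List.find?_range_eq_some.2 ⟨decide_eq_true ⟨hz, h⟩, List.mem_range.2 hi, ?_⟩,
    Option.getD_some]
  intro j hj
  rw [Bool.not_eq_true', decide_eq_false_iff_not]
  rintro ⟨hlength, hvalue⟩
  have hle := Kt_le_of_ktFun_eq hx (hj.trans hi) hlength hvalue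
  omega

theorem isPolyTime_searchIndex (ht : IsPolyTime t) :
    IsPolyTime fun p : List Bool × List Bool => searchIndex t c A p.1 p.2 := by
  have hclog : IsPolyTime fun p : (List Bool × List Bool) × ℕ => Nat.clog 2 (p.1.1.length + c) :=
    .clog (by fun_prop)
  have hlength : IsPolyTime fun p : (List Bool × List Bool) × ℕ => ktLength c p.1.1.length :=
    .ktLength (by fun_prop)
  have hlabel : IsPolyTime fun p : (List Bool × List Bool) × ℕ => labelled c p.2 p.1.1 :=
    .append (.bits hclog (by fun_prop)) (by fun_prop)
  have hcand : IsPolyTime fun p : (List Bool × List Bool) × ℕ => candidate c A p.1.1 p.1.2 p.2 :=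
    A.isPolyTime.comp (.prodMk (by fun_prop) (.take (.eval _ (by fun_prop)) (by fun_prop)))
  have hfun : IsPolyTime fun p : (List Bool × List Bool) × ℕ =>
      ktFun t c p.1.1.length (candidate c A p.1.1 p.1.2 p.2) := .ktFun ht (by fun_prop) hcand
  exact .getD (.find? (by fun_prop) (by fun_prop)) (.const 0)

variable (t c A)

/-- The algorithm for `K^t` obtained from an inverter `A` of the candidate family. -/
noncomputable def ktSolver (ht : IsPolyTime t) : PPT :=
  .ofIsPolyTime (A.coins.comp (4 * .X + .C (3 * c + 1)))
    (fun p => Computability.encodeNat (searchIndex t c A p.1 p.2 + 1))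
    (isPolyTime_searchIndex ht).succ.encodeNat

variable {t c A}

theorem prob_le_prob_ktSolver (ht : IsPolyTime t) {x z : List Bool} (hx : x ≠ [])
    (hc : Kt t x ≤ x.length + c) (hz : ktFun t c x.length z = labelled c (Kt t x - 1) x) :
    A.prob (withSecurity (ktLength c x.length) (ktFun t c x.length z))
      {z' | z'.length = ktLength c x.length ∧ ktFun t c x.length z' = ktFun t c x.length z} ≤
    (ktSolver t c A ht).prob x {Computability.encodeNat (Kt t x)} := by
  have hpos := Kt_pos t x
  have hi : Kt t x - 1 < x.length + c := by omega
  rw [hz]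
  refine PPT.prob_le_prob ?_ fun R hR => ?_
  · simp only [ktSolver, PPT.ofIsPolyTime, Polynomial.eval_comp]
    refine eval_mono _ ?_
    have hclog : Nat.clog 2 (x.length + c) ≤ x.length + c :=
      Nat.clog_le_of_le_pow Nat.lt_two_pow_self.le
    simp only [length_withSecurity, ktLength, labelled, List.length_append, length_bits_clog hi,
      Polynomial.eval_add, Polynomial.eval_mul, Polynomial.eval_ofNat, Polynomial.eval_X,
      Polynomial.eval_C]
    omega
  · change Computability.encodeNat (searchIndex t c A x R + 1) = _
    rw [searchIndex_eq hx hi (by omega) hR.1 hR.2, Nat.sub_add_cancel hpos]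

theorem one_sub_prob_ktSolver_le (ht : IsPolyTime t) (hc : ∀ x : List Bool, Kt t x ≤ x.length + c)
    {n : ℕ} (hn : n ≠ 0) :
    1 - avg n (fun x => (ktSolver t c A ht).prob x {Computability.encodeNat (Kt t x)}) ≤
      2 ^ (Nat.clog 2 (n + c) + c) * (1 - invProbOn (ktLength c n) (ktFun t c n) A) := by
  -- Each `x` of length `n` has its own preimage `φ x`, and these make up a `2 ^ (n - m(n))`
  -- fraction of the domain.
  choose φ hφ hval using fun x => exists_ktFun_eq_labelled (hc x)
  have hcount := avg_le_of_injOn (a := n) (b := ktLength c n)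
    (g := fun x => 1 - (ktSolver t c A ht).prob x {Computability.encodeNat (Kt t x)})
    (h := fun z => 1 - A.prob (withSecurity (ktLength c n) (ktFun t c n z))
      {z' | z'.length = ktLength c n ∧ ktFun t c n z' = ktFun t c n z}) φ
    (fun x hx => hx ▸ hφ x) ?_ ?_ fun z => sub_nonneg.2 (A.prob_le_one _ _)
  · have hlength : ktLength c n = n + (Nat.clog 2 (n + c) + c) := by rw [ktLength]; ring
    rw [avg_sub, avg_sub, avg_const, avg_const, ← invProbOn, hlength, pow_add, mul_assoc,
      ← hlength] at hcount
    exact le_of_mul_le_mul_left hcount (by positivity)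
  · rintro x rfl y (hy : y.length = x.length) hxy
    exact eq_of_labelled_eq hy.symm <| (hval x).symm.trans (by rw [hxy, ← hy, hval y])
  · rintro x rfl
    exact sub_le_sub_left (prob_le_prob_ktSolver ht (by rintro rfl; exact hn rfl) (hc x) (hval x)) 1

end Search

theorem two_pow_clog_le (n : ℕ) : 2 ^ Nat.clog 2 n ≤ 2 * n + 1 := by
  rcases le_or_gt n 1 with hn | hn
  · interval_cases n <;> simp
  · have hlt := Nat.pow_pred_clog_lt_self one_lt_two hn
    rw [← Nat.succ_pred_eq_of_pos (Nat.clog_pos one_lt_two hn), pow_succ]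
    omega

theorem isWeakOWFFamily_ktFun {t : ℕ → ℕ} (ht : IsPolyTime t) {α : ℕ → ℝ} {q : Polynomial ℕ}
    (hq : ∀ n, 0 < q.eval n) (hα : ∀ᶠ n in Filter.atTop, 1 / ((q.eval n : ℕ) : ℝ) ≤ α n)
    (hard : IsHardOnAverage α fun x => Computability.encodeNat (Kt t x)) {c : ℕ}
    (hc : ∀ x : List Bool, Kt t x ≤ x.length + c) :
    IsWeakOWFFamily (ktLength c) (ktFun t c) := by
  have hcomputable : IsPolyTime fun w => ktFun t c (security w) (challenge w) :=
    .ktFun ht (by fun_prop) (by fun_prop)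
  refine ⟨⟨_, hcomputable.polyTime, fun n x _ => ?_⟩, q * ((2 * (.X + .C c) + 1) * .C (2 ^ c)),
    fun n => ?_, fun A => ?_⟩
  · rw [← withSecurity, security_withSecurity, challenge_withSecurity]
  · rw [Polynomial.eval_mul]
    exact Nat.mul_pos (hq n) (by simp)
  · filter_upwards [hard (ktSolver t c A ht), hα, Filter.eventually_ge_atTop 1] with n hfail hαn hn
    have hqn : (0 : ℝ) < (q.eval n : ℕ) := Nat.cast_pos.2 (hq n)
    have hinv := one_sub_prob_ktSolver_le (A := A) ht hc (n := n) (by omega)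
    have hnonneg := sub_nonneg.2 (invProbOn_le_one (ktLength c n) (ktFun t c n) A)
    have hpow : (2 : ℝ) ^ (Nat.clog 2 (n + c) + c) ≤ (2 * (n + c) + 1) * 2 ^ c := by
      rw [pow_add]
      gcongr
      exact_mod_cast two_pow_clog_le (n + c)
    change invProbOn (ktLength c n) (ktFun t c n) A < _
    rw [lt_sub_comm]
    calc 1 / (((q * ((2 * (.X + .C c) + 1) * .C (2 ^ c))).eval n : ℕ) : ℝ)
        = 1 / (q.eval n : ℕ) / ((2 * (n + c) + 1) * 2 ^ c) := by simp [field]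
      _ < 1 - invProbOn (ktLength c n) (ktFun t c n) A := by
          rw [div_lt_iff₀' (by positivity)]
          linarith [mul_le_mul_of_nonneg_right hpow hnonneg]

/-! ### From a family to a single weak one-way function -/

section MaxIndex

theorem findGreatest_eq_find? (p : ℕ → Prop) [DecidablePred p] (n : ℕ) :
    Nat.findGreatest p n =
      ((List.range (n + 1)).reverse.find? fun i => decide (p i)).getD 0 := by
  induction n with
  | zero => by_cases h : p 0 <;> simp [h]
  | succ n ih =>
    rw [List.range_succ, List.reverse_append, Nat.findGreatest_succ, ih]
    by_cases h : p (n + 1) <;> simp [h]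

/-- The largest `n ≤ N` with `m n ≤ N`, and `0` if there is none. -/
def maxIndex (m : ℕ → ℕ) (N : ℕ) : ℕ := Nat.findGreatest (fun n => m n ≤ N) N

theorem IsPolyTime.maxIndex {α : Type} [Code α] {m : ℕ → ℕ} {N : α → ℕ} (hm : IsPolyTime m)
    (hN : IsPolyTime N) : IsPolyTime fun a => maxIndex m (N a) := by
  simp only [KOWF.maxIndex, findGreatest_eq_find?]
  exact getD (find? (by fun_prop) (decide_le (hm.comp (by fun_prop)) (by fun_prop))) (const 0)

variable {m : ℕ → ℕ} {n N : ℕ}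

theorem apply_maxIndex_le (h : m 0 ≤ N) : m (maxIndex m N) ≤ N :=
  Nat.findGreatest_spec (P := fun n => m n ≤ N) (Nat.zero_le N) h

theorem le_maxIndex (hm : ∀ n, n ≤ m n) (h : m n ≤ N) : n ≤ maxIndex m N :=
  Nat.le_findGreatest ((hm n).trans h) h

theorem lt_apply_maxIndex_add_one (hm : ∀ n, n ≤ m n) (N : ℕ) : N < m (maxIndex m N + 1) := by
  by_contra h
  have hle := le_maxIndex hm (not_lt.1 h)
  omega

theorem tendsto_maxIndex (hm : ∀ n, n ≤ m n) :
    Filter.Tendsto (maxIndex m) Filter.atTop Filter.atTop :=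
  Filter.tendsto_atTop.2 fun n => (Filter.eventually_ge_atTop (m n)).mono fun _ => le_maxIndex hm

end MaxIndex

section Glue

/-- The functions `fun x => g (1^n‖x)` on strings of length `m n`, as one function on all strings:
the input is truncated to the largest available length `m n`, and the output also contains the
length of the input, so that preimages of a value all have the same length. -/
def glue (m : ℕ → ℕ) (g : List Bool → List Bool) (x : List Bool) : List Bool :=
  withSecurity x.length (g (unary (maxIndex m x.length) ++ x.take (m (maxIndex m x.length))))

/-- The instance of `glue` that has `r` excess bits and corresponds to the instance `w` of the
family. -/
def gluedChallenge (r : ℕ) (w : List Bool) : List Bool :=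
  withSecurity (security w + r) (withSecurity (security w + r) (challenge w))

variable {m : ℕ → ℕ} {g : List Bool → List Bool}

theorem isPolyTime_glue (hm : IsPolyTime m) (hg : IsPolyTime g) : IsPolyTime (glue m g) := by
  have hindex : IsPolyTime fun x : List Bool => maxIndex m x.length := hm.maxIndex (by fun_prop)
  exact .withSecurity (by fun_prop)
    (hg.comp (.append hindex.unary (.take (hm.comp hindex) (by fun_prop))))

theorem isPolyTime_gluedChallenge (r : ℕ) : IsPolyTime (gluedChallenge r) := by
  unfold gluedChallenge
  fun_prop

theorem gluedChallenge_withSecurity (r m : ℕ) (y : List Bool) :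
    gluedChallenge r (withSecurity m y) = withSecurity (m + r) (withSecurity (m + r) y) := by
  rw [gluedChallenge, security_withSecurity, challenge_withSecurity]

/-- The inverter for a family obtained from an inverter `B` for the glued function, run on inputs
with `r` excess bits. -/
noncomputable def truncatedInverter (B : PPT) (r : ℕ) : PPT :=
  .ofIsPolyTime (B.coins.comp (2 * .X + .C (2 * r)))
    (fun p => (B.run (gluedChallenge r p.1,
      p.2.take (B.coins.eval (gluedChallenge r p.1).length))).take (security p.1)) <| by
    have hchallenge : IsPolyTime fun p : List Bool × List Bool => gluedChallenge r p.1 :=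
      (isPolyTime_gluedChallenge r).comp (by fun_prop)
    exact .take (by fun_prop) <| B.isPolyTime.comp <|
      hchallenge.prodMk (.take (.eval _ hchallenge.length) (by fun_prop))

theorem invProb_glue_le (B : PPT) {r n : ℕ} (hn : maxIndex m (m n + r) = n) :
    invProb (glue m g) B (m n + r) ≤
      invProbOn (m n) (fun x => g (unary n ++ x)) (truncatedInverter B r) := by
  rw [invProb, invProbOn, ← avg_take (Nat.le_add_right (m n) r)]
  refine avg_mono fun x hx => PPT.prob_le_prob ?_ fun R hR => ?_
  · simp only [truncatedInverter, PPT.ofIsPolyTime, Polynomial.eval_comp]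
    refine eval_mono _ ?_
    simp only [glue, hx, hn, length_withSecurity, Polynomial.eval_add, Polynomial.eval_mul,
      Polynomial.eval_ofNat, Polynomial.eval_X, Polynomial.eval_C]
    omega
  · simp only [glue, hx, hn, Set.mem_preimage, Set.mem_singleton_iff] at hR
    simp only [truncatedInverter, PPT.ofIsPolyTime, gluedChallenge_withSecurity,
      security_withSecurity]
    generalize B.run _ = z at hR ⊢
    have hlength : z.length = m n + r := by simpa using congrArg security hR
    have hvalue := congrArg challenge hR
    rw [challenge_withSecurity, challenge_withSecurity, hlength, hn] at hvalue
    exact ⟨by simp [hlength], hvalue⟩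

theorem exists_eq_apply_maxIndex_add {d N : ℕ} (hle : ∀ n, n ≤ m n)
    (hgap : ∀ n, m (n + 1) ≤ m n + d) (hN : m 0 ≤ N) : ∃ r < d, N = m (maxIndex m N) + r := by
  have hspec := apply_maxIndex_le hN
  have hlt := lt_apply_maxIndex_add_one hle N
  have hstep := hgap (maxIndex m N)
  exact ⟨N - m (maxIndex m N), by omega, by omega⟩

theorem IsWeakOWFFamily.exists_isWeakOWF {f : ℕ → List Bool → List Bool} {d : ℕ}
    (h : IsWeakOWFFamily m f) (hm : IsPolyTime m) (hle : ∀ n, n ≤ m n)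
    (hgap : ∀ n, m (n + 1) ≤ m n + d) : ∃ F, IsWeakOWF F := by
  obtain ⟨⟨g, hg, hgf⟩, s, hs, hweak⟩ := h
  refine ⟨glue m g, (isPolyTime_glue hm hg.isPolyTime).polyTime, s, hs, fun B => ?_⟩
  have hfail : ∀ᶠ n in Filter.atTop, ∀ r < d,
      invProbOn (m n) (f n) (truncatedInverter B r) < 1 - 1 / ((s.eval n : ℕ) : ℝ) :=
    (Set.finite_lt_nat d).eventually_all.2 fun r _ => hweak (truncatedInverter B r)
  filter_upwards [(tendsto_maxIndex hle).eventually hfail, Filter.eventually_ge_atTop (m 0)]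
    with N hfailN hN
  obtain ⟨r, hr, hNr⟩ := exists_eq_apply_maxIndex_add hle hgap hN
  set n := maxIndex m N
  have hinv : invProb (glue m g) B N ≤ invProbOn (m n) (f n) (truncatedInverter B r) := by
    rw [hNr, ← invProbOn_congr _ (hgf n)]
    exact invProb_glue_le B (by rw [← hNr])
  have hmono : 1 / ((s.eval N : ℕ) : ℝ) ≤ 1 / (s.eval n : ℕ) :=
    one_div_le_one_div_of_le (Nat.cast_pos.2 (hs n))
      (Nat.cast_le.2 (eval_mono s ((hle n).trans (by omega))))
  linarith [hfailN r hr]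

end Glue

theorem le_ktLength (c n : ℕ) : n ≤ ktLength c n := by
  unfold ktLength
  omega

theorem ktLength_add_one_le (c n : ℕ) : ktLength c (n + 1) ≤ ktLength c n + 2 := by
  have hclog : Nat.clog 2 (n + 1 + c) ≤ Nat.clog 2 (n + c) + 1 := by
    refine Nat.clog_le_of_le_pow ?_
    rcases Nat.eq_zero_or_pos (n + c) with h | h
    · simp [show n = 0 by omega, show c = 0 by omega]
    · have hle := Nat.le_pow_clog one_lt_two (n + c)
      rw [pow_succ]
      omega
  unfold ktLength
  omega

/-! ### Blocks of bit strings -/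

section Block

open Finset

/-- The `i`-th block of length `n` of a string, counting from `0`. -/
def block (n i : ℕ) (X : List Bool) : List Bool := (X.drop (i * n)).take n

/-- The string `X` with its `i`-th block of length `n` replaced by `x`. -/
def setBlock (n i : ℕ) (x X : List Bool) : List Bool :=
  X.take (i * n) ++ (x ++ X.drop ((i + 1) * n))

variable {n m i j N : ℕ} {x y u v X : List Bool}

theorem block_zero_append (hx : x.length = n) : block n 0 (x ++ y) = x := by
  rw [block, zero_mul, List.drop_zero, List.take_left' hx]

theorem block_add_one_append (hx : x.length = n) : block n (i + 1) (x ++ y) = block n i y := by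
  rw [block, add_mul, one_mul, add_comm, ← List.drop_drop, List.drop_left' hx, block]

theorem setBlock_append_append (hu : u.length = i * n) (hy : y.length = n) :
    setBlock n i x (u ++ (y ++ v)) = u ++ (x ++ v) := by
  rw [setBlock, List.take_left' hu, add_mul, one_mul, ← List.drop_drop, List.drop_left' hu,
    List.drop_left' hy]

theorem add_one_mul_le_of_lt (h : n * m ≤ N) (hi : i < m) : (i + 1) * n ≤ N :=
  (Nat.mul_le_mul_right n hi).trans (by rwa [mul_comm])

theorem length_setBlock (h : n * m ≤ N) (hi : i < m) (hx : x.length = n) (hX : X.length = N) :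
    (setBlock n i x X).length = N := by
  have hend := add_one_mul_le_of_lt h hi
  rw [add_mul] at hend
  simp only [setBlock, List.length_append, List.length_take, List.length_drop, hx, hX, add_mul]
  omega

theorem block_setBlock (h : n * m ≤ N) (hi : i < m) (hx : x.length = n) (hX : X.length = N) :
    block n j (setBlock n i x X) = if j = i then x else block n j X := by
  have hend := add_one_mul_le_of_lt h hi
  rw [add_mul, one_mul] at hend
  have htake : (X.take (i * n)).length = i * n := by rw [List.length_take, hX]; omega
  split_ifs with hji
  · rw [hji, block, setBlock, List.drop_left' htake, List.take_left' hx]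
  · rcases lt_or_gt_of_ne hji with hlt | hgt
    · have hbefore : j * n + n ≤ i * n := by
        simpa only [Nat.succ_mul] using Nat.mul_le_mul_right n (Nat.succ_le_of_lt hlt)
      rw [block, setBlock, List.drop_append_of_le_length (by omega),
        List.take_append_of_le_length (by rw [List.length_drop]; omega), block, List.drop_take,
        List.take_take, min_eq_left (by omega)]
    · have hafter : (i + 1) * n ≤ j * n := Nat.mul_le_mul_right n (Nat.succ_le_of_lt hgt)
      have hlength : (X.take (i * n) ++ x).length = (i + 1) * n := by
        rw [List.length_append, htake, hx, add_mul, one_mul]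
      rw [block, setBlock, ← List.append_assoc, List.drop_append,
        List.drop_eq_nil_of_le (by omega), hlength, List.drop_drop, List.nil_append,
        Nat.add_sub_cancel' hafter, block]

theorem avg_eq_avg_setBlock (h : n * m ≤ N) (hi : i < m) (b : List Bool → ℝ) :
    avg N b = avg n fun x => avg N fun X => b (setBlock n i x X) := by
  obtain ⟨r, rfl⟩ := Nat.exists_eq_add_of_le (add_one_mul_le_of_lt h hi)
  have hsplit (g : List Bool → ℝ) : avg ((i + 1) * n + r) g =
      avg (i * n) fun u => avg n fun y => avg r fun v => g (u ++ (y ++ v)) := by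
    rw [add_mul, one_mul, add_assoc, avg_append]
    exact avg_congr fun u _ => avg_append n r _
  calc avg ((i + 1) * n + r) b
      = avg (i * n) fun u => avg n fun x => avg r fun v => b (u ++ (x ++ v)) := hsplit b
    _ = avg n fun x => avg (i * n) fun u => avg r fun v => b (u ++ (x ++ v)) := avg_comm _ _ _
    _ = avg n fun x => avg ((i + 1) * n + r) fun X => b (setBlock n i x X) :=
        avg_congr fun x _ => by
          rw [hsplit]
          refine avg_congr fun u hu => ?_
          rw [← avg_const n (avg r fun v => b (u ++ (x ++ v)))]
          exact avg_congr fun y hy => avg_congr fun v _ => by rw [setBlock_append_append hu hy]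

theorem avg_mul_block (h : n * m ≤ N) (hi : i < m) (g b : List Bool → ℝ) :
    avg N (fun X => g (block n i X) * b X) =
      avg n fun x => g x * avg N fun X => b (setBlock n i x X) := by
  rw [avg_eq_avg_setBlock h hi]
  refine avg_congr fun x hx => ?_
  rw [← avg_mul_left]
  exact avg_congr fun X hX => by rw [block_setBlock h hi hx hX, if_pos rfl]

theorem avg_prod_block (h : n * m ≤ N) (g : List Bool → ℝ) :
    avg N (fun X => ∏ i ∈ range m, g (block n i X)) = avg n g ^ m := by
  induction m generalizing N with
  | zero => simp [avg_const]
  | succ m ih =>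
    rw [mul_add, mul_one, add_comm] at h
    obtain ⟨r, rfl⟩ := Nat.exists_eq_add_of_le (le_of_add_le_left h)
    rw [avg_append, pow_succ, ← ih (Nat.le_of_add_le_add_left h), ← avg_mul_left]
    refine avg_congr fun x hx => ?_
    rw [mul_comm, ← avg_mul_left]
    refine avg_congr fun y _ => ?_
    rw [prod_range_succ', block_zero_append hx, mul_comm]
    simp only [block_add_one_append hx]

theorem freq_forall_block (h : n * m ≤ N) (P : List Bool → Prop) :
    freq N (fun X => ∀ i < m, P (block n i X)) = freq n P ^ m := by
  classical
  rw [freq, freq, ← avg_prod_block h]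
  refine avg_congr fun X _ => ?_
  simp only [prod_boole, mem_range]
  congr

/-- At each of the first `m` positions, fixing the block to be `x` makes the average of `b` over
strings of length `N` smaller than `δ`. -/
def IsHardBlock (b : List Bool → ℝ) (δ : ℝ) (n m N : ℕ) (x : List Bool) : Prop :=
  ∀ i < m, avg N (fun X => b (setBlock n i x X)) < δ

open Classical in
theorem le_sum_add_of_blocks {b : List Bool → ℝ} (hb₀ : ∀ X, 0 ≤ b X) (hb₁ : ∀ X, b X ≤ 1)
    (P : List Bool → Prop) (X : List Bool) :
    b X ≤ (∑ i ∈ range m, (if P (block n i X) then 1 else 0) * b X) +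
      if ∀ i < m, ¬P (block n i X) then 1 else 0 := by
  have hterm : ∀ i ∈ range m, 0 ≤ (if P (block n i X) then 1 else 0) * b X := fun i _ =>
    mul_nonneg (by split_ifs <;> norm_num) (hb₀ X)
  split_ifs with hnone
  · linarith [sum_nonneg hterm, hb₁ X]
  · push Not at hnone
    obtain ⟨i, hi, hP⟩ := hnone
    have hle := single_le_sum hterm (mem_range.2 hi)
    rwa [if_pos hP, one_mul, ← add_zero (∑ _ ∈ _, _)] at hle

theorem avg_le_of_isHardBlock (h : n * m ≤ N) {b : List Bool → ℝ} (hb₀ : ∀ X, 0 ≤ b X)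
    (hb₁ : ∀ X, b X ≤ 1) {δ : ℝ} (hδ : 0 ≤ δ) :
    avg N b ≤ m * δ + (1 - freq n (IsHardBlock b δ n m N)) ^ m := by
  classical
  refine (avg_mono fun X _ => le_sum_add_of_blocks (n := n) (m := m) hb₀ hb₁
    (IsHardBlock b δ n m N) X).trans ?_
  rw [avg_add, avg_sum, ← freq_not, ← freq_forall_block h]
  refine add_le_add ?_ (le_of_eq (avg_congr fun X _ => by congr))
  refine (sum_le_card_nsmul _ _ δ fun i hi => ?_).trans (by simp)
  rw [avg_mul_block h (mem_range.1 hi) fun x => if IsHardBlock b δ n m N x then 1 else 0]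
  refine avg_le_of_forall_le fun x _ => ?_
  split_ifs with hhard
  · simpa using (hhard i (mem_range.1 hi)).le
  · simpa using hδ

end Block

/-! ### Hardness amplification -/

section Amplification

variable (f : List Bool → List Bool) (M : Polynomial ℕ) (B : PPT)

/-- The largest `n ≤ N` such that `M(n)` blocks of length `n` fit into `N` bits. -/
def blockLength (N : ℕ) : ℕ := maxIndex (fun n => n * M.eval n) N

/-- The direct product of `f`: the values of `f` at `M(n)` blocks of length `n`, where `n` is the
largest length available. The length of the input is part of the output, so that preimages of a
value all have the same blocks. -/
def product (X : List Bool) : List Bool :=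
  code (X.length, (List.range (M.eval (blockLength M X.length))).map fun j =>
    f (block (blockLength M X.length) j X))

/-- The value of `product f M` at `X` with the entry `i` replaced by `y`, for `X` of length `N`
with blocks of length `n`. -/
def planted (n : ℕ) (y : List Bool) (N i : ℕ) (X : List Bool) : List Bool :=
  code (N, (List.range (M.eval n)).map fun j => if j = i then y else f (block n j X))

/-- The attempt at inverting `f` at `y` by running `B` with `y` planted at `i`; the first `N` bits
of `R` provide the other blocks and the remaining ones the coins of `B`. -/
def attempt (n : ℕ) (y R : List Bool) (N i : ℕ) : List Bool :=
  let v := withSecurity N (planted f M n y N i (R.take N))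
  block n i (B.run (v, (R.drop N).take (B.coins.eval v.length)))

/-- The search for a preimage of `y` of length `n` that makes `T(n)` attempts, with `S(n)` random
bits each, for every input length below `L(n)` of the product and every position. -/
def blockSearch (T S L : Polynomial ℕ) (n : ℕ) (y R : List Bool) : List Bool :=
  (((List.range (T.eval n)).flatMap fun j => (List.range (L.eval n)).flatMap fun N =>
    (List.range (M.eval n)).map fun i =>
      attempt f M B n y (block (S.eval n) j R) N i).find? fun x => decide (f x = y)).getD []

variable {f M B}

section IsPolyTime

variable {α : Type} [Code α]

@[fun_prop]
theorem IsPolyTime.block {n i : α → ℕ} {X : α → List Bool} (hn : IsPolyTime n) (hi : IsPolyTime i)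
    (hX : IsPolyTime X) : IsPolyTime fun a => block (n a) (i a) (X a) := by
  unfold KOWF.block
  fun_prop

theorem isPolyTime_product (hf : IsPolyTime f) : IsPolyTime (product f M) := by
  have hindex : IsPolyTime fun X : List Bool => blockLength M X.length :=
    .maxIndex (.mul .id' (.eval _ .id')) (by fun_prop)
  refine .codeWord (.prodMk (by fun_prop) (.map (.range (.eval _ hindex)) (hf.comp ?_)))
  exact .block (hindex.comp (.fst .id')) (by fun_prop) (by fun_prop)

theorem isPolyTime_attempt (hf : IsPolyTime f) {n N i : α → ℕ} {y R : α → List Bool}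
    (hn : IsPolyTime n) (hy : IsPolyTime y) (hR : IsPolyTime R) (hN : IsPolyTime N)
    (hi : IsPolyTime i) : IsPolyTime fun a => attempt f M B (n a) (y a) (R a) (N a) (i a) := by
  have hv : IsPolyTime fun a => withSecurity (N a)
      (planted f M (n a) (y a) (N a) (i a) ((R a).take (N a))) :=
    .withSecurity hN (.codeWord (hN.prodMk (.map (.range (.eval _ hn))
      (.ite (by fun_prop) (by fun_prop) (hf.comp (by fun_prop))))))
  exact hn.block hi (B.isPolyTime.comp (hv.prodMk (.take (.eval _ hv.length) (by fun_prop))))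

theorem isPolyTime_blockSearch (hf : IsPolyTime f) (T S L : Polynomial ℕ) {n : α → ℕ}
    {y R : α → List Bool} (hn : IsPolyTime n) (hy : IsPolyTime y) (hR : IsPolyTime R) :
    IsPolyTime fun a => blockSearch f M B T S L (n a) (y a) (R a) := by
  refine .getD (.find? (.flatMap (.range (.eval _ hn)) (.flatMap (.range (.eval _ ?_))
    (.map (.range (.eval _ ?_)) (isPolyTime_attempt hf ?_ ?_ (.block (.eval _ ?_) ?_ ?_) ?_ ?_))))
    (.decide_eq (hf.comp (.snd .id')) ?_)) (.const _)
  all_goals fun_prop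

end IsPolyTime

/-- The inverter of `f` that runs `blockSearch`. -/
noncomputable def blockInverter (hf : IsPolyTime f) (M : Polynomial ℕ) (B : PPT)
    (T S L : Polynomial ℕ) : PPT :=
  .ofIsPolyTime (S * T) (fun p => blockSearch f M B T S L (security p.1) (challenge p.1) p.2)
    (isPolyTime_blockSearch hf T S L (by fun_prop) (by fun_prop) (by fun_prop))

theorem blockLength_mul_eval_le (M : Polynomial ℕ) (N : ℕ) :
    blockLength M N * M.eval (blockLength M N) ≤ N :=
  apply_maxIndex_le (m := fun n => n * M.eval n) (by simp)

theorem planted_eq {N i : ℕ} (hi : i < M.eval (blockLength M N)) {x X : List Bool}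
    (hx : x.length = blockLength M N) (hX : X.length = N) :
    planted f M (blockLength M N) (f x) N i X = product f M (setBlock (blockLength M N) i x X) := by
  have hfit := blockLength_mul_eval_le M N
  rw [planted, product, length_setBlock hfit hi hx hX]
  congr 2
  exact List.map_congr_left fun j _ => by rw [block_setBlock hfit hi hx hX, apply_ite f]

theorem apply_block_eq_of_product_eq {X X' : List Bool} (h : product f M X = product f M X') {i : ℕ}
    (hi : i < M.eval (blockLength M X.length)) :
    f (block (blockLength M X.length) i X) = f (block (blockLength M X.length) i X') := by
  obtain ⟨hlength, hvalues⟩ := Prod.mk.inj (code_injective h)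
  rw [← hlength] at hvalues
  exact List.map_inj_left.1 hvalues i (List.mem_range.2 hi)

/-- The probability that `A` inverts `f` when it is given `f x`. -/
noncomputable def successProb (f : List Bool → List Bool) (A : PPT) (x : List Bool) : ℝ :=
  A.prob (withSecurity x.length (f x)) (f ⁻¹' {f x})

theorem successProb_nonneg (f : List Bool → List Bool) (A : PPT) (x : List Bool) :
    0 ≤ successProb f A x := A.prob_nonneg _ _

theorem successProb_le_one (f : List Bool → List Bool) (A : PPT) (x : List Bool) :
    successProb f A x ≤ 1 := A.prob_le_one _ _

theorem invProb_eq_avg_successProb (f : List Bool → List Bool) (A : PPT) (n : ℕ) :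
    invProb f A n = avg n (successProb f A) :=
  avg_congr fun x hx => by rw [successProb, hx]

theorem apply_attempt_append {N i : ℕ} (hi : i < M.eval (blockLength M N)) {x X R : List Bool}
    (hx : x.length = blockLength M N) (hX : X.length = N)
    (h : let v := withSecurity N (product f M (setBlock (blockLength M N) i x X))
      product f M (B.run (v, R.take (B.coins.eval v.length))) =
        product f M (setBlock (blockLength M N) i x X)) :
    f (attempt f M B (blockLength M N) (f x) (X ++ R) N i) = f x := by
  have hfit := blockLength_mul_eval_le M N
  have hlength := length_setBlock hfit hi hx hX
  have hblock := apply_block_eq_of_product_eq h.symm (i := i) (by rwa [hlength])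
  rw [hlength, block_setBlock hfit hi hx hX, if_pos rfl] at hblock
  simp only [attempt, List.take_left' hX, List.drop_left' hX, planted_eq hi hx hX]
  exact hblock.symm

theorem avg_successProb_setBlock_le {N i S : ℕ} (hi : i < M.eval (blockLength M N))
    (hS : ∀ X : List Bool, X.length = N →
      N + B.coins.eval (withSecurity N (product f M X)).length ≤ S) {x : List Bool}
    (hx : x.length = blockLength M N) :
    avg N (fun X => successProb (product f M) B (setBlock (blockLength M N) i x X)) ≤
      freq S fun R => f (attempt f M B (blockLength M N) (f x) R N i) = f x := by
  obtain ⟨r, rfl⟩ := Nat.exists_eq_add_of_le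
    ((Nat.le_add_right N _).trans (hS (List.replicate N false) List.length_replicate))
  rw [freq_append]
  refine avg_mono fun X hX => ?_
  have hlength := length_setBlock (blockLength_mul_eval_le M N) hi hx hX
  have hcoins := Nat.le_of_add_le_add_left (hS _ hlength)
  rw [successProb, hlength, PPT.prob_eq_freq, ← freq_take hcoins]
  exact freq_mono fun R _ => apply_attempt_append hi hx hX

theorem apply_blockSearch {T S L : Polynomial ℕ} {n : ℕ} {y R : List Bool} {j N i : ℕ}
    (hj : j < T.eval n) (hN : N < L.eval n) (hi : i < M.eval n)
    (h : f (attempt f M B n y (block (S.eval n) j R) N i) = y) :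
    f (blockSearch f M B T S L n y R) = y := by
  rw [blockSearch]
  generalize hl : List.flatMap _ _ = l
  have hmem : attempt f M B n y (block (S.eval n) j R) N i ∈ l :=
    hl ▸ List.mem_flatMap.2 ⟨j, List.mem_range.2 hj, List.mem_flatMap.2 ⟨N, List.mem_range.2 hN,
      List.mem_map_of_mem (List.mem_range.2 hi)⟩⟩
  have hfound : (l.find? fun x => decide (f x = y)).isSome :=
    List.find?_isSome.2 ⟨_, hmem, decide_eq_true h⟩
  obtain ⟨z, hz⟩ := Option.isSome_iff_exists.1 hfound
  simpa only [hz, Option.getD_some, decide_eq_true_eq] using List.find?_some hz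

theorem le_successProb_blockInverter (hf : IsPolyTime f) (T : Polynomial ℕ) {S L : Polynomial ℕ}
    {N i : ℕ} (hN : N < L.eval (blockLength M N)) (hi : i < M.eval (blockLength M N))
    (hS : ∀ X : List Bool, X.length = N →
      N + B.coins.eval (withSecurity N (product f M X)).length ≤ S.eval (blockLength M N))
    {x : List Bool} (hx : x.length = blockLength M N) :
    1 - (1 - avg N fun X => successProb (product f M) B (setBlock (blockLength M N) i x X)) ^
        T.eval (blockLength M N) ≤ successProb f (blockInverter hf M B T S L) x := by
  have havg := avg_successProb_setBlock_le hi hS hx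
  rw [successProb, hx, PPT.prob_eq_freq]
  set n := blockLength M N
  set Pass : List Bool → Prop := fun R => f (attempt f M B n (f x) R N i) = f x
  set len := (blockInverter hf M B T S L).coins.eval (withSecurity n (f x)).length
  have hle : S.eval n * T.eval n ≤ len := by
    have hn : n ≤ (withSecurity n (f x)).length := by rw [length_withSecurity]; omega
    exact (Nat.mul_le_mul (eval_mono S hn) (eval_mono T hn)).trans_eq Polynomial.eval_mul.symm
  calc 1 - (1 - _) ^ T.eval n
      ≤ 1 - (1 - freq (S.eval n) Pass) ^ T.eval n := by
        gcongr
        exact sub_nonneg.2 (freq_le_one _ _)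
    _ = freq len fun R => ¬∀ j < T.eval n, ¬Pass (block (S.eval n) j R) := by
        rw [freq_not, freq_forall_block hle fun R => ¬Pass R, freq_not]
    _ ≤ _ := freq_mono fun R _ hR => by
        push Not at hR
        obtain ⟨j, hj, hpass⟩ := hR
        simp only [blockInverter, PPT.ofIsPolyTime, security_withSecurity, challenge_withSecurity]
        exact apply_blockSearch hj hN hi hpass

end Amplification

section AmplificationBounds

variable {f : List Bool → List Bool} {M : Polynomial ℕ} {B : PPT}

theorem one_sub_pow_le_one_div {a c : ℝ} {m : ℕ} (ha : a ≤ 1) (hc : 0 < c)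
    (hexp : c ≤ Real.exp (m * a)) : (1 - a) ^ m ≤ 1 / c :=
  calc (1 - a) ^ m ≤ Real.exp (-a) ^ m :=
        pow_le_pow_left₀ (sub_nonneg.2 ha) (Real.one_sub_le_exp_neg a) m
    _ = 1 / Real.exp (m * a) := by rw [← Real.exp_nat_mul, mul_neg, Real.exp_neg, one_div]
    _ ≤ 1 / c := one_div_le_one_div_of_le hc hexp

theorem one_sub_freq_isHardBlock_sub_le (hf : IsPolyTime f) (T : Polynomial ℕ) {S L : Polynomial ℕ}
    {N : ℕ} (hN : N < L.eval (blockLength M N))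
    (hS : ∀ X : List Bool, X.length = N →
      N + B.coins.eval (withSecurity N (product f M X)).length ≤ S.eval (blockLength M N))
    {δ : ℝ} (hδ : δ ≤ 1) :
    1 - freq (blockLength M N) (IsHardBlock (successProb (product f M) B) δ (blockLength M N)
        (M.eval (blockLength M N)) N) - (1 - δ) ^ T.eval (blockLength M N) ≤
      invProb f (blockInverter hf M B T S L) (blockLength M N) := by
  classical
  rw [invProb_eq_avg_successProb, ← freq_not, freq,
    ← avg_const (blockLength M N) ((1 - δ) ^ _), ← avg_sub]
  refine avg_mono fun x hx => ?_
  split_ifs with hhard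
  · have hpow : 0 ≤ (1 - δ) ^ T.eval (blockLength M N) := pow_nonneg (sub_nonneg.2 hδ) _
    linarith [successProb_nonneg f (blockInverter hf M B T S L) x]
  · rw [IsHardBlock] at hhard
    push Not at hhard
    obtain ⟨i, hi, hδi⟩ := hhard
    refine le_trans ?_ (le_successProb_blockInverter hf T hN hi hS hx)
    gcongr
    exact sub_nonneg.2 (avg_le_of_forall_le fun _ _ => successProb_le_one _ _ _)

theorem invProb_product_le (hf : IsPolyTime f) {T S L : Polynomial ℕ} {N s Q : ℕ}
    (hn : 0 < blockLength M N) (hs : 0 < s) (hQ : 0 < Q) (hN : N < L.eval (blockLength M N))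
    (hS : ∀ X : List Bool, X.length = N →
      N + B.coins.eval (withSecurity N (product f M X)).length ≤ S.eval (blockLength M N))
    (hM : M.eval (blockLength M N) = 2 * blockLength M N * s)
    (hT : T.eval (blockLength M N) = 4 * M.eval (blockLength M N) * s * Q)
    (hexp : 2 * (Q : ℝ) ≤ Real.exp (blockLength M N))
    (hweak : invProb f (blockInverter hf M B T S L) (blockLength M N) < 1 - 1 / (s : ℝ)) :
    invProb (product f M) B N ≤ 1 / (Q : ℝ) := by
  have hfit := blockLength_mul_eval_le M N
  have hinverter {δ : ℝ} := one_sub_freq_isHardBlock_sub_le hf T hN hS (δ := δ)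
  set n := blockLength M N
  set m := M.eval n
  set b := successProb (product f M) B
  have hmℝ : (m : ℝ) = 2 * n * s := by rw [hM]; norm_num
  have hm : 0 < m := by rw [hM]; positivity
  set δ : ℝ := 1 / (2 * m * Q) with hδ
  have hδ₁ : δ ≤ 1 := by
    rw [hδ, div_le_one (by positivity)]
    exact_mod_cast Nat.one_le_iff_ne_zero.2 (by positivity)
  set h := freq n (IsHardBlock b δ n m N)
  have hattempts : (1 - δ) ^ T.eval n ≤ 1 / (2 * s) := by
    have hTδ : T.eval n * δ = 2 * s := by
      rw [hT, hδ]
      push_cast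
      field_simp
      norm_num
    refine one_sub_pow_le_one_div hδ₁ (by positivity) ?_
    linarith [hTδ ▸ Real.add_one_le_exp (2 * (s : ℝ))]
  have hhard : 1 / (2 * (s : ℝ)) ≤ h := by
    have hhalves : 1 / (s : ℝ) = 1 / (2 * s) + 1 / (2 * s) := by field_simp; norm_num
    linarith [hinverter hδ₁]
  have hblocks : (1 - h) ^ m ≤ 1 / (2 * Q) := by
    refine one_sub_pow_le_one_div (freq_le_one _ _) (by positivity) (hexp.trans ?_)
    rw [Real.exp_le_exp]
    calc (n : ℝ) = m * (1 / (2 * s)) := by rw [hmℝ]; field_simp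
      _ ≤ m * h := by gcongr
  calc invProb (product f M) B N = avg N b := invProb_eq_avg_successProb _ _ _
    _ ≤ m * δ + (1 - h) ^ m :=
        avg_le_of_isHardBlock hfit (successProb_nonneg _ _) (successProb_le_one _ _) (by positivity)
    _ ≤ m * δ + 1 / (2 * Q) := by gcongr
    _ = 1 / Q := by rw [hδ]; field_simp; norm_num

theorem IsPolyTime.exists_length_le {α : Type} [Code α] {g : List Bool → List α}
    (hg : IsPolyTime g) : ∃ P : Polynomial ℕ, ∀ X, (g X).length ≤ P.eval X.length := by
  obtain ⟨P, hP⟩ := hg.exists_size_le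
  refine ⟨P.comp (4 * .X + 1), fun X => ((length_lt_size _).le.trans (hP X)).trans ?_⟩
  rw [Polynomial.eval_comp]
  exact eval_mono P ((size_bits_le X).trans (by simp))

theorem eventually_polynomial_eval_le_exp (P : Polynomial ℕ) :
    ∀ᶠ n : ℕ in Filter.atTop, ((P.eval n : ℕ) : ℝ) ≤ Real.exp n := by
  have hlim := (Polynomial.tendsto_div_exp_atTop (P.map (Nat.castRingHom ℝ))).comp
    tendsto_natCast_atTop_atTop
  filter_upwards [hlim.eventually (gt_mem_nhds one_pos)] with n hn
  rw [Function.comp_apply, div_lt_one (Real.exp_pos _), Polynomial.eval_natCast_map] at hn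
  exact hn.le

theorem eventually_invProb_product_le (hf : IsPolyTime f) {s : Polynomial ℕ}
    (hs : ∀ n, 0 < s.eval n)
    (hweak : ∀ A : PPT, ∀ᶠ n in Filter.atTop, invProb f A n < 1 - 1 / ((s.eval n : ℕ) : ℝ))
    (B : PPT) (k : ℕ) :
    ∀ᶠ N in Filter.atTop, invProb (product f (2 * .X * s)) B N ≤ 1 / (N : ℝ) ^ k := by
  set M : Polynomial ℕ := 2 * .X * s with hM
  have hMeval (n : ℕ) : M.eval n = 2 * n * s.eval n := by simp [hM]
  obtain ⟨P, hP⟩ := IsPolyTime.exists_length_le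
    (g := fun X => withSecurity X.length (product f M X))
    (.withSecurity (by fun_prop) (isPolyTime_product hf))
  set L : Polynomial ℕ := (.X + 1) * M.comp (.X + 1) with hL
  have hle (n : ℕ) : n ≤ n * M.eval n := by
    rcases Nat.eq_zero_or_pos n with rfl | hn
    · simp
    · exact Nat.le_mul_of_pos_right n (by rw [hMeval]; have := hs n; positivity)
  have hindex : Filter.Tendsto (blockLength M) Filter.atTop Filter.atTop := tendsto_maxIndex hle
  filter_upwards [hindex.eventually (hweak (blockInverter hf M B (4 * M * s * L ^ k)
      (L + B.coins.comp (P.comp L)) L)),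
    hindex.eventually (eventually_polynomial_eval_le_exp (2 * L ^ k)),
    hindex.eventually (Filter.eventually_gt_atTop 0), Filter.eventually_gt_atTop 0]
    with N hweakN hexp hn hN₀
  have hN : N < L.eval (blockLength M N) := by
    simpa [hL, blockLength] using lt_apply_maxIndex_add_one hle N
  have hS (X : List Bool) (hX : X.length = N) :
      N + B.coins.eval (withSecurity N (product f M X)).length ≤
        (L + B.coins.comp (P.comp L)).eval (blockLength M N) := by
    subst hX
    simp only [Polynomial.eval_add, Polynomial.eval_comp]
    exact add_le_add hN.le (eval_mono _ ((hP X).trans (eval_mono P hN.le)))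
  calc invProb (product f M) B N ≤ 1 / ((L.eval (blockLength M N) ^ k : ℕ) : ℝ) :=
        invProb_product_le hf hn (hs _) (pow_pos (hN₀.trans hN) k) hN hS (hMeval _) (by simp)
          (by simpa using hexp) hweakN
    _ ≤ 1 / (N : ℝ) ^ k := by
        rw [Nat.cast_pow]
        gcongr

theorem superpolynomialDecay_of_eventually_le {μ : ℕ → ℝ} (hnonneg : ∀ n, 0 ≤ μ n)
    (hle : ∀ k : ℕ, ∀ᶠ n in Filter.atTop, μ n ≤ 1 / (n : ℝ) ^ k) :
    Asymptotics.SuperpolynomialDecay Filter.atTop (fun n : ℕ => (n : ℝ)) μ := fun k => by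
  refine squeeze_zero' (.of_forall fun n => mul_nonneg (by positivity) (hnonneg n)) ?_
    tendsto_one_div_atTop_nhds_zero_nat
  filter_upwards [hle (k + 1), Filter.eventually_gt_atTop 0] with n hn hn₀
  calc (n : ℝ) ^ k * μ n ≤ (n : ℝ) ^ k * (1 / (n : ℝ) ^ (k + 1)) := by gcongr
    _ = 1 / n := by rw [pow_succ]; field_simp

theorem IsWeakOWF.exists_isOWF (h : IsWeakOWF f) : ∃ g, IsOWF g := by
  obtain ⟨hf, s, hs, hweak⟩ := h
  obtain ⟨g, hg, hle⟩ : ∃ g, IsPolyTime g ∧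
      ∀ (B : PPT) (k : ℕ), ∀ᶠ N in Filter.atTop, invProb g B N ≤ 1 / (N : ℝ) ^ k :=
    ⟨_, isPolyTime_product hf.isPolyTime, eventually_invProb_product_le hf.isPolyTime hs hweak⟩
  refine ⟨g, hg.polyTime, fun B => ⟨invProb g B, ?_, fun _ => le_rfl⟩⟩
  refine superpolynomialDecay_of_eventually_le (fun n => ?_) (hle B)
  rw [invProb_eq_avg_successProb]
  exact avg_nonneg fun X _ => successProb_nonneg _ B X

end AmplificationBounds

section RealPolynomial

theorem exists_nat_polynomial_ge (p : Polynomial ℝ) :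
    ∃ P : Polynomial ℕ, ∀ n : ℕ, p.eval (n : ℝ) ≤ (P.eval n : ℕ) := by
  induction p using Polynomial.induction_on' with
  | add p q hp hq =>
    obtain ⟨P, hP⟩ := hp
    obtain ⟨Q, hQ⟩ := hq
    exact ⟨P + Q, fun n => by simpa using add_le_add (hP n) (hQ n)⟩
  | monomial d a =>
    refine ⟨.monomial d ⌈a⌉₊, fun n => ?_⟩
    simp only [Polynomial.eval_monomial, Nat.cast_mul, Nat.cast_pow]
    gcongr
    exact Nat.le_ceil a

theorem exists_nat_polynomial_one_div_le {p : Polynomial ℝ}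
    (hp : ∀ n : ℕ, 1 ≤ n → 0 < p.eval (n : ℝ)) :
    ∃ q : Polynomial ℕ, (∀ n, 0 < q.eval n) ∧
      ∀ᶠ n : ℕ in Filter.atTop, 1 / ((q.eval n : ℕ) : ℝ) ≤ 1 / p.eval (n : ℝ) := by
  obtain ⟨P, hP⟩ := exists_nat_polynomial_ge p
  refine ⟨P + 1, by simp, (Filter.eventually_ge_atTop 1).mono fun n hn => ?_⟩
  refine one_div_le_one_div_of_le (hp n hn) ((hP n).trans ?_)
  simp

end RealPolynomial

end KOWF

theorem mainTheorem2_general {t : ℕ → ℕ} (ht : IsPolyTime t) {α : ℕ → ℝ} {q : Polynomial ℕ}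
    (hq : ∀ n, 0 < q.eval n) (hα : ∀ᶠ n in Filter.atTop, 1 / ((q.eval n : ℕ) : ℝ) ≤ α n)
    (hard : IsHardOnAverage α fun x => Computability.encodeNat (Kt t x)) :
    (∀ c : ℕ, (∀ x : List Bool, Kt t x ≤ x.length + c) →
      IsWeakOWFFamily (ktLength c) (ktFun t c)) ∧
    (∃ f : List Bool → List Bool, IsWeakOWF f) ∧
    (∃ f : List Bool → List Bool, IsOWF f) := by
  have hfamily (c : ℕ) (hc : ∀ x : List Bool, Kt t x ≤ x.length + c) :
      IsWeakOWFFamily (ktLength c) (ktFun t c) := isWeakOWFFamily_ktFun ht hq hα hard hc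
  obtain ⟨f, hf⟩ := (hfamily 1 (Kt_le t)).exists_isWeakOWF (.ktLength .id') (le_ktLength 1)
    (ktLength_add_one_le 1)
  exact ⟨hfamily, ⟨f, hf⟩, hf.exists_isOWF⟩

theorem mainTheorem2 (t : ℕ → ℕ) (T p : Polynomial ℝ)
    (hT : ∀ n : ℕ, 1 ≤ n → (t n : ℝ) = T.eval (n : ℝ))
    (ht : ∀ n : ℕ, 1 ≤ n → 0 < t n)
    (hp : ∀ n : ℕ, 1 ≤ n → 0 < p.eval (n : ℝ))
    (hard : IsHardOnAverage (fun n => 1 / p.eval (n : ℝ))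
      (fun x => Computability.encodeNat (Kt t x))) :
    (∀ c : ℕ, (∀ x : List Bool, Kt t x ≤ x.length + c) →
      IsWeakOWFFamily (ktLength c) (ktFun t c)) ∧
    (∃ f : List Bool → List Bool, IsWeakOWF f) ∧
    (∃ f : List Bool → List Bool, IsOWF f) := by
  obtain ⟨q, hq, hqp⟩ := exists_nat_polynomial_one_div_le hp
  exact mainTheorem2_general (isPolyTime_of_eq_eval hT) hq hqp hard
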